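/- Let $n\ge 2$, $\lambda=\frac{n-1}{2}$, and let $d\in\mathbb N_0$. Let $\mathcal S^n\subset\mathbb R^{n+1}$ be the unit sphere with surface measure $\sigma$ of total mass $\Sigma_n$, with spherical coordinates $(\theta_1,\dots,\theta_{n-1},\varphi)$ ($x_\tau=\sin\theta_1\cdots\sin\theta_{\tau-1}\cos\theta_\tau$ for $1\le\tau\le n-1$, $x_n=\sin\theta_1\cdots\sin\theta_{n-1}\cos\varphi$, $x_{n+1}=\sin\theta_1\cdots\sin\theta_{n-1}\sin\varphi$), and let $$Y_l^{(k_1,\dots,\pm k_{n-1})}=A_l^k\prod_{\tau=1}^{n-1}C_{k_{\tau-1}-k_\tau}^{\frac{n-\tau}2+k_\tau}(\cos\theta_\tau)\sin^{k_\tau}\theta_\tau\; e^{\pm ik_{n-1}\varphi},\qquad l=k_0\ge k_1\ge\dots\ge k_{n-1}\ge 0,$$ be the hyperspherical harmonics, where $C_m^\mu$ are the Gegenbauer polynomials and $$A_l^k=\left(\frac1{\Gamma(\frac{n+1}2)}\prod_{\tau=1}^{n-1}\frac{2^{n-\tau+2k_\tau-2}(k_{\tau-1}-k_\tau)!\,(n-\tau+2k_{\tau-1})\,\Gamma^2(\frac{n-\tau}2+k_\tau)}{\sqrt\pi\,(n-\tau+k_{\tau-1}+k_\tau-1)!}\right)^{1/2}$$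 are the constants which make them orthonormal for $\langle g,h\rangle=\frac1{\Sigma_n}\int_{\mathcal S^n}\overline g\,h\,d\sigma$. Write $Y_l^k$ for $Y_l^{(k,0,\dots,0)}$ (for $n=2$ this is $Y_l^{k}$, and there is also $Y_l^{-k}$), with $Y_l^{\pm k}=0$ for $k>l$, and let $a_l^k(g)=\langle Y_l^k,g\rangle$ for $k\ge 0$. Put $\widetilde Y_l^k=Y_l^k$ if $n\ge 3$ or $k=0$, and $\widetilde Y_l^k=Y_l^k+Y_l^{-k}$ if $n=2$ and $k\ge1$. For $0\le k\le l$ let $$\beta_{l,k}=\sqrt{\frac{(k+1)(2\lambda+k-1)(l-k)(2\lambda+l+k)}{(2\lambda+2k-1)(2\lambda+2k+1)}}\quad(n\ge3),\qquad \beta_{l,k}=\frac{\sqrt{(l-k)(l+k+1)}}2\quad(n=2).$$ Let $\Upsilon_\Theta$ be the rotation $(x_1,x_2)\mapsto(x_1\cos\Theta-x_2\sin\Theta,\;x_1\sin\Theta+x_2\cos\Theta)$ of $\mathbb R^{n+1}$ that fixes $x_3,\dots,x_{n+1}$. Let $f:\mathcal S^n\to\mathbb C$ be a (Borel measurable) zonal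 function, i.e. $f(x)$ depends only on $x_1$, such that for every $x$ the function $\Theta\mapsto f(\Upsilon_\Theta x)$ is $d$ times differentiable on $\mathbb R$ and such that the functions $$f^{(m)}(x)=\left.\frac{\partial^m}{\partial\Theta^m}f(\Upsilon_\Theta x)\right|_{\Theta=0},\qquad 0\le m\le d,$$ belong to $\mathcal L^2(\mathcal S^n)$. Then, with convergence in $\mathcal L^2(\mathcal S^n)$, $$f^{(d)}=\sum_{l=0}^\infty\sum_{j=0}^{\lfloor d/2\rfloor}a_l^{2j+(d\bmod2)}(f^{(d)})\,\widetilde Y_l^{\,2j+(d\bmod 2)},$$ and $a_l^k(f^{(d)})=0$ for all $l$ and all $k>d$. The coefficients obey the following recursion, for all $l\ge0$ (products $\beta_{l,k}\,a_l^{k'}$ with $k>l$ or $k'>l$ are read as $0$). If $d$ is odd, then for all $j\ge0$ $$a_l^{2j+1}(f^{(d)})=\beta_{l,2j+1}\,a_l^{2j+2}(f^{(d-1)})-\beta_{l,2j}\,a_l^{2j}(f^{(d-1)}),\qquad a_l^{2j}(f^{(d)})=0.$$ If $d$ is even, then $a_l^{2j+1}(f^{(d)})=0$ for all $j\ge0$,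 and if moreover $d\ge2$, then $$a_l^0(f^{(d)})=\beta_{l,0}\,a_l^1(f^{(d-1)})\quad(n\ge3),\qquad a_l^0(f^{(d)})=2\beta_{l,0}\,a_l^1(f^{(d-1)})\quad(n=2),$$ $$a_l^{2j}(f^{(d)})=\beta_{l,2j}\,a_l^{2j+1}(f^{(d-1)})-\beta_{l,2j-1}\,a_l^{2j-1}(f^{(d-1)})\qquad(j\ge1).$$ -/

import Mathlib

open MeasureTheory Filter Topology
open scoped Nat

noncomputable section

namespace DirSphere

/-- The ambient Euclidean space `ℝ^{n+1}`; the coordinate `x_τ` (`1 ≤ τ ≤ n+1`) of the literature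
is `x (τ - 1)` here. -/
abbrev Amb (n : ℕ) : Type := EuclideanSpace ℝ (Fin (n + 1))

/-- The unit sphere `S^n ⊆ ℝ^{n+1}`. -/
abbrev Sph (n : ℕ) : Type := Metric.sphere (0 : Amb n) 1

/-- The rotation invariant surface measure `dσ` on `S^n`. -/
def surfaceMeasure (n : ℕ) : Measure (Sph n) := (volume : Measure (Amb n)).toSphere

/-- The total mass `Σ_n = 2 π^{(n+1)/2} / Γ((n+1)/2)` of the surface measure. -/
def sphereArea (n : ℕ) : ℝ :=
  2 * Real.pi ^ (((n : ℝ) + 1) / 2) / Real.Gamma (((n : ℝ) + 1) / 2)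

/-! ### Spherical coordinates -/

/-- The Cartesian coordinate `x_τ`, `1 ≤ τ ≤ n + 1`. -/
def coord {n : ℕ} (x : Sph n) (τ : ℕ) : ℝ := x.1 (Fin.ofNat (n + 1) (τ - 1))

/-- `(x_τ² + x_{τ+1}² + ⋯ + x_{n+1}²)^{1/2}`, which is `sin θ_1 ⋯ sin θ_{τ-1}`. -/
def tailRadius {n : ℕ} (x : Sph n) (τ : ℕ) : ℝ :=
  √(∑ i ∈ Finset.Icc τ (n + 1), coord x i ^ 2)

/-- The polar angle `θ_τ ∈ [0, π]`, `1 ≤ τ ≤ n - 1`, determined by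
`x_τ = sin θ_1 ⋯ sin θ_{τ-1} cos θ_τ`.  Where the tail radius vanishes the angle is arbitrary
(here `π / 2`) and the harmonics below do not depend on it. -/
def polarAngle {n : ℕ} (x : Sph n) (τ : ℕ) : ℝ := Real.arccos (coord x τ / tailRadius x τ)

/-- The azimuth `φ` (modulo `2π`), determined by
`x_n = sin θ_1 ⋯ sin θ_{n-1} cos φ`, `x_{n+1} = sin θ_1 ⋯ sin θ_{n-1} sin φ`. -/
def azimuth {n : ℕ} (x : Sph n) : ℝ := Complex.arg ⟨coord x n, coord x (n + 1)⟩

/-! ### Hyperspherical harmonics -/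

/-- The Gegenbauer polynomial `C_l^lam(t)` (for `lam > 0`). -/
def gegenbauer (lam : ℝ) (l : ℕ) (t : ℝ) : ℝ :=
  ∑ j ∈ Finset.range (l / 2 + 1),
    (-1) ^ j * Real.Gamma (lam + l - j) / (j ! * (l - 2 * j)! * Real.Gamma lam)
      * (2 * t) ^ (l - 2 * j)

/-- The normalization constant `A_l^k`.  A multi-index `l = k_0 ≥ k_1 ≥ ⋯ ≥ k_{n-1} ≥ 0` is encoded
as `k : ℕ → ℕ` (values beyond `n - 1` are not used), so that `l` is `k 0`. -/
def harmonicConst (n : ℕ) (k : ℕ → ℕ) : ℝ :=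
  √(1 / Real.Gamma (((n : ℝ) + 1) / 2) *
    ∏ τ ∈ Finset.Icc 1 (n - 1),
      (2 : ℝ) ^ ((n : ℤ) - τ + 2 * k τ - 2) * (k (τ - 1) - k τ)! * ((n : ℝ) - τ + 2 * k (τ - 1))
          * Real.Gamma (((n : ℝ) - τ) / 2 + k τ) ^ 2
        / (√Real.pi * (n - τ + k (τ - 1) + k τ - 1)!))

/-- The hyperspherical harmonic
`Y_l^{(k_1, …, k_{n-2}, s k_{n-1})} = A_l^k ∏_τ C_{k_{τ-1}-k_τ}^{(n-τ)/2+k_τ}(cos θ_τ) sin^{k_τ} θ_τ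
  · exp(i s k_{n-1} φ)`, where `s = 1` or `s = -1` is the sign in front of `k_{n-1}`. -/
def harmonic (n : ℕ) (k : ℕ → ℕ) (s : ℤ) (x : Sph n) : ℂ :=
  (harmonicConst n k : ℂ) *
    (∏ τ ∈ Finset.Icc 1 (n - 1),
      ((gegenbauer (((n : ℝ) - τ) / 2 + k τ) (k (τ - 1) - k τ) (Real.cos (polarAngle x τ))
        * Real.sin (polarAngle x τ) ^ k τ : ℝ) : ℂ)) *
    Complex.exp (Complex.I * s * k (n - 1) * azimuth x)

/-- The multi-index `(l; k, 0, …, 0)`. -/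
def multiIndex (l k : ℕ) : ℕ → ℕ
  | 0 => l
  | 1 => k
  | _ => 0

/-- `Y_l^{(s k, 0, …, 0)}` for `n = 2` (where it is `Y_l^{s k}`), and `Y_l^{(k, 0, …, 0)}` for
`n ≥ 3` (where the sign `s` has no effect), with the convention that it is `0` for `k > l`. -/
def Y (n l k : ℕ) (s : ℤ) (x : Sph n) : ℂ :=
  if k ≤ l then harmonic n (multiIndex l k) s x else 0

/-- The function that carries the `k`-th coefficient in the expansion:
`Y_l^{(k, 0, …, 0)}` for `n ≥ 3`; for `n = 2` it is `Y_l^0` if `k = 0` and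
`Y_l^k + Y_l^{-k}` if `k ≥ 1`. -/
def symY (n l k : ℕ) (x : Sph n) : ℂ :=
  if n = 2 ∧ k ≠ 0 then Y n l k 1 x + Y n l k (-1) x else Y n l k 1 x

/-- The Fourier coefficient `a_l^k(g) = ⟨Y_l^{(k, 0, …, 0)}, g⟩
= Σ_n⁻¹ ∫ conj(Y_l^{(k, 0, …, 0)}) g dσ` (`Y_l^k` when `n = 2`). -/
def sphCoeff (n l k : ℕ) (g : Sph n → ℂ) : ℂ :=
  (1 / sphereArea n : ℝ) * ∫ x, (starRingEnd ℂ) (Y n l k 1 x) * g x ∂(surfaceMeasure n)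

/-- The constants `β_{l,k}` with `λ = (n - 1) / 2`.  For `n = 2` the common factor `2 λ + k - 1 = k`
of numerator and denominator of the general formula, which vanishes at `k = 0`, is cancelled. -/
def beta (n l k : ℕ) : ℝ :=
  if n = 2 then √(((l : ℝ) - k) * (l + k + 1)) / 2
  else
    let lam : ℝ := ((n : ℝ) - 1) / 2
    √(((k : ℝ) + 1) * (2 * lam + k - 1) * ((l : ℝ) - k) * (2 * lam + l + k)
      / ((2 * lam + 2 * k - 1) * (2 * lam + 2 * k + 1)))

/-! ### Zonal functions and derivatives of rotations -/

/-- A function on the sphere is zonal if its value at `x` depends only on `⟨ê, x⟩ = x_1`. -/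
def IsZonal {n : ℕ} (f : Sph n → ℂ) : Prop :=
  ∀ x y : Sph n, coord x 1 = coord y 1 → f x = f y

/-- The matrix of the rotation by the angle `Θ` in the `(x_1, x_2)`-plane. -/
def rotMatrix (n : ℕ) (Θ : ℝ) : Matrix (Fin (n + 1)) (Fin (n + 1)) ℝ :=
  Matrix.of fun i j =>
    if (i : ℕ) = 0 ∧ (j : ℕ) = 0 then Real.cos Θ
    else if (i : ℕ) = 0 ∧ (j : ℕ) = 1 then -Real.sin Θ
    else if (i : ℕ) = 1 ∧ (j : ℕ) = 0 then Real.sin Θ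
    else if (i : ℕ) = 1 ∧ (j : ℕ) = 1 then Real.cos Θ
    else if i = j then 1
    else 0

theorem rotMatrix_norm {n : ℕ} (hn : 2 ≤ n) (Θ : ℝ) (x : Amb n) :
    ‖WithLp.toLp 2 ((rotMatrix n Θ).mulVec x)‖ = ‖x‖ := by
  obtain ⟨m, rfl⟩ : ∃ m, n = m + 1 := ⟨n - 1, by omega⟩
  rw [EuclideanSpace.norm_eq, EuclideanSpace.norm_eq]
  congr 1
  simp only [Real.norm_eq_abs, sq_abs]
  rw [Fin.sum_univ_succ, Fin.sum_univ_succ, Fin.sum_univ_succ (n := m + 1), Fin.sum_univ_succ]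
  have e0 : ∀ i : Fin m, (0 : Fin (m + 1 + 1)) ≠ i.succ.succ := fun i => (Fin.succ_ne_zero _).symm
  have e1 : ∀ i : Fin m, (1 : Fin (m + 1 + 1)) ≠ i.succ.succ := fun i h => by
    simpa using congrArg Fin.val h
  have h0 : (rotMatrix (m + 1) Θ).mulVec x 0 = Real.cos Θ * x 0 - Real.sin Θ * x 1 := by
    simp [Matrix.mulVec, dotProduct, rotMatrix, Fin.sum_univ_succ, e0]
    ring
  have h1 : (rotMatrix (m + 1) Θ).mulVec x 1 = Real.sin Θ * x 0 + Real.cos Θ * x 1 := by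
    simp [Matrix.mulVec, dotProduct, rotMatrix, Fin.sum_univ_succ, e1]
  have h2 : ∀ i : Fin m, (rotMatrix (m + 1) Θ).mulVec x i.succ.succ = x i.succ.succ := by
    intro i
    simp [Matrix.mulVec, dotProduct, rotMatrix]
  simp only [Fin.succ_zero_eq_one, h0, h1, h2]
  nlinarith [Real.sin_sq_add_cos_sq Θ]

/-- The rotation `Υ_Θ` acting on the sphere. -/
def rot {n : ℕ} (hn : 2 ≤ n) (Θ : ℝ) (x : Sph n) : Sph n :=
  ⟨WithLp.toLp 2 ((rotMatrix n Θ).mulVec x.1), by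
    have hx := x.2
    rw [mem_sphere_zero_iff_norm] at hx ⊢
    rw [rotMatrix_norm hn, hx]⟩

/-- `f^{(d)}(x) = ∂^d/∂Θ^d f(Υ_Θ x)` at `Θ = 0`. -/
def thetaDeriv {n : ℕ} (hn : 2 ≤ n) (f : Sph n → ℂ) (d : ℕ) (x : Sph n) : ℂ :=
  iteratedDeriv d (fun Θ : ℝ => f (rot hn Θ x)) 0

end DirSphere

end

open DirSphere

noncomputable section
namespace DirSphere

/-! ### Gegenbauer polynomials in homogeneous form -/

/-! The functions f^(m) are successive derivatives along the rotations of the (x_1, x_2)-plane. By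
rotation invariance of the measure, integrating f^(m+1) against a polynomial p gives minus the
integral of f^(m) against D p, with D = x_1 ∂_2 - x_2 ∂_1 (`integral_rotD_mul`). The recursion is
therefore the adjoint of a formula for D on harmonics. As f is zonal, every f^(m) depends on x_1 and
x_2 only, so only harmonics that are polynomials in these two coordinates matter.

Up to constants these harmonics are `solid`: C_{l-k}^{λ+k}(x_1) H_k, where H_k is a homogenized
Gegenbauer polynomial of parameter (n-2)/2 in x_2 and 1 - x_1², or a homogenized Chebyshev
polynomial when n = 2, where that parameter degenerates to 0. `AngularFamily` records the properties
shared by both cases. They imply the ladder formula: D takes order k to a combination of the orders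
k - 1 and k + 1 of the same degree (`D_solid_zero`, `D_solid_succ`).

The ladder also supplies orthogonality and norms without evaluating integrals. The analytic inputs
are that D has mean zero and that zonal functions are orthogonal to p(x_1) H_k for k ≥ 1
(`pairing_zonal`). From them follow orthogonality in order and in degree and the ratios of norms
(`norm_ladder`, `solid_orthogonal_degree`, `norm_degree`). Comparing these ratios with the Gamma
quotients in the normalization constants turns the ladder coefficients into β_{l,k}
(`orderConst_sq_order`, `beta_sq`).

For the expansion, a square integrable function of x_1, x_2 is approximated by polynomials in x_1,
x_2 (`exists_poly_near`), these lie in the span of the harmonics (`adjoin_le_span`), and orthogonal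
projection does the rest (`tendsto_orthogonal_expansion`). Finally, f itself has only order 0, and
each derivative moves the order by one step up or down; so f^(d) has only orders k ≤ d with the
parity of d. -/

/-- The coefficient of `(2y)^i s^j` in the homogeneous Gegenbauer polynomial. -/
def gegCoeff (ν : ℝ) (i j : ℕ) : ℝ :=
  (-1) ^ j * Real.Gamma (ν + i + j) / (j ! * i ! * Real.Gamma ν)

theorem gegCoeff_succ_left {ν : ℝ} (hν : 0 < ν) (i j : ℕ) :
    (i + 1) * gegCoeff ν (i + 1) j = ν * gegCoeff (ν + 1) i j := by
  have h := (Real.Gamma_pos_of_pos hν).ne'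
  have e : ν + ((i + 1 : ℕ) : ℝ) + j = ν + 1 + i + j := by push_cast; ring
  simp only [gegCoeff, e, Real.Gamma_add_one hν.ne', Nat.factorial_succ]
  push_cast
  have := Nat.cast_add_one_ne_zero (R := ℝ) i
  field_simp

theorem gegCoeff_succ_right {ν : ℝ} (hν : 0 < ν) (i j : ℕ) :
    (j + 1) * gegCoeff ν i (j + 1) = -(ν * gegCoeff (ν + 1) i j) := by
  have h := (Real.Gamma_pos_of_pos hν).ne'
  have e : ν + i + ((j + 1 : ℕ) : ℝ) = ν + 1 + i + j := by push_cast; ring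
  simp only [gegCoeff, e, Real.Gamma_add_one hν.ne', Nat.factorial_succ]
  push_cast
  have := Nat.cast_add_one_ne_zero (R := ℝ) j
  field_simp
  ring

theorem gegCoeff_raise {ν : ℝ} (hν : 0 < ν) (i j : ℕ) :
    (ν + i + j) * gegCoeff ν i j = ν * gegCoeff (ν + 1) i j := by
  have h := (Real.Gamma_pos_of_pos hν).ne'
  have e : ν + 1 + i + j = (ν + i + j) + 1 := by ring
  have h2 : ν + i + j ≠ 0 := by positivity
  simp only [gegCoeff, e, Real.Gamma_add_one hν.ne', Real.Gamma_add_one h2]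
  field_simp

variable {A : Type*} [CommRing A] [Algebra ℝ A]

/-- The term of bidegree `(i, j)` of a homogeneous Gegenbauer polynomial. -/
def gegTerm (ν : ℝ) (y s : A) (i : ℤ) (j : ℕ) : A :=
  if i < 0 then 0 else gegCoeff ν i.toNat j • ((2 * y) ^ i.toNat * s ^ j)

theorem gegTerm_natCast (ν : ℝ) (y s : A) (i j : ℕ) :
    gegTerm ν y s i j = gegCoeff ν i j • ((2 * y) ^ i * s ^ j) := by
  simp [gegTerm]

theorem gegTerm_neg (ν : ℝ) (y s : A) {i : ℤ} (hi : i < 0) (j : ℕ) : gegTerm ν y s i j = 0 := by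
  simp [gegTerm, hi]

/-- The homogeneous Gegenbauer polynomial `s^{m/2} C_m^ν(y / √s)`, which is `0` for `m < 0`. -/
def geg (ν : ℝ) (m : ℤ) (y s : A) : A :=
  ∑ j ∈ Finset.range (m.toNat + 1), gegTerm ν y s (m - 2 * j) j

/-- Surplus terms have a negative exponent and vanish by the convention in `gegTerm`. Polynomials of
different degrees can thus be compared term by term over a common range. -/
theorem geg_eq_sum (ν : ℝ) (m : ℤ) (y s : A) (M : ℕ) (hM : m < 2 * M) :
    geg ν m y s = ∑ j ∈ Finset.range M, gegTerm ν y s (m - 2 * j) j := by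
  have key : ∀ M M' : ℕ, m < 2 * M → M ≤ M' →
      ∑ j ∈ Finset.range M, gegTerm ν y s (m - 2 * j) j =
        ∑ j ∈ Finset.range M', gegTerm ν y s (m - 2 * j) j := by
    intro M M' h h'
    refine Finset.sum_subset (Finset.range_mono h') fun j _ hj => gegTerm_neg _ _ _ ?_ _
    simp only [Finset.mem_range, not_lt] at hj
    omega
  rw [geg, key _ (max (m.toNat + 1) M) (by omega) (le_max_left _ _),
    key M (max (m.toNat + 1) M) hM (le_max_right _ _)]

theorem geg_of_neg (ν : ℝ) {m : ℤ} (hm : m < 0) (y s : A) : geg ν m y s = 0 := by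
  rw [geg_eq_sum ν m y s 0 (by simpa using hm)]; simp

theorem geg_zero {ν : ℝ} (hν : 0 < ν) (y s : A) : geg ν 0 y s = 1 := by
  have h := (Real.Gamma_pos_of_pos hν).ne'
  simp [geg, gegTerm, gegCoeff, h]

theorem map_geg {B : Type*} [CommRing B] [Algebra ℝ B] (g : A →ₐ[ℝ] B) (ν : ℝ) (m : ℤ) (y s : A) :
    g (geg ν m y s) = geg ν m (g y) (g s) := by
  simp only [geg, map_sum, gegTerm]
  refine Finset.sum_congr rfl fun j _ => ?_
  split_ifs <;> simp [map_ofNat g 2]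

/-- The Euler operator y ∂_y multiplies a monomial by its exponent, and ∂_y raises the parameter.
Allowing a negative index makes the rule valid at i = 0 as well. -/
theorem gegTerm_deg_left {ν : ℝ} (hν : 0 < ν) (y s : A) (i : ℤ) (j : ℕ) :
    (i : ℝ) • gegTerm ν y s i j = (2 * ν) • (y * gegTerm (ν + 1) y s (i - 1) j) := by
  rcases lt_trichotomy i 0 with hi | rfl | hi
  · rw [gegTerm_neg _ _ _ hi, gegTerm_neg _ _ _ (by omega)]; simp
  · rw [gegTerm_neg (ν + 1) _ _ (by omega)]; simp
  · obtain ⟨i, rfl⟩ : ∃ k : ℕ, i = ((k + 1 : ℕ) : ℤ) := ⟨(i - 1).toNat, by omega⟩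
    have e : ((i + 1 : ℕ) : ℤ) - 1 = (i : ℤ) := by push_cast; ring
    rw [e, gegTerm_natCast, gegTerm_natCast, smul_smul]
    have := gegCoeff_succ_left hν i j
    push_cast
    rw [this, pow_succ]
    simp only [Algebra.smul_def, map_mul, map_ofNat]
    ring

theorem gegTerm_deg_right {ν : ℝ} (hν : 0 < ν) (y s : A) (i : ℤ) (j : ℕ) :
    ((j : ℝ) + 1) • gegTerm ν y s i (j + 1) = -(ν • (s * gegTerm (ν + 1) y s i j)) := by
  rcases lt_or_ge i 0 with hi | hi
  · rw [gegTerm_neg _ _ _ hi, gegTerm_neg _ _ _ hi]; simp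
  · lift i to ℕ using hi
    rw [gegTerm_natCast, gegTerm_natCast, smul_smul, gegCoeff_succ_right hν, pow_succ]
    simp only [Algebra.smul_def, map_mul, map_neg]
    ring

theorem gegTerm_raise {ν : ℝ} (hν : 0 < ν) (y s : A) (i : ℤ) (j : ℕ) :
    (ν + i + j) • gegTerm ν y s i j = ν • gegTerm (ν + 1) y s i j := by
  rcases lt_or_ge i 0 with hi | hi
  · rw [gegTerm_neg _ _ _ hi, gegTerm_neg _ _ _ hi]; simp
  · lift i to ℕ using hi
    rw [gegTerm_natCast, gegTerm_natCast, smul_smul, smul_smul]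
    have := gegCoeff_raise hν i j
    push_cast
    rw [this]

theorem derivation_gegTerm_left (D : Derivation ℝ A A) {ν : ℝ} (hν : 0 < ν) (y s : A) (i : ℤ) :
    D (gegTerm ν y s i 0) = (2 * ν) • (gegTerm (ν + 1) y s (i - 1) 0 * D y) := by
  rcases lt_trichotomy i 0 with hi | rfl | hi
  · rw [gegTerm_neg _ _ _ hi, gegTerm_neg _ _ _ (by omega)]; simp
  · rw [gegTerm_neg (ν + 1) _ _ (by omega)]; simp [gegTerm]
  · obtain ⟨i, rfl⟩ : ∃ k : ℕ, i = ((k + 1 : ℕ) : ℤ) := ⟨(i - 1).toNat, by omega⟩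
    have e : ((i + 1 : ℕ) : ℤ) - 1 = (i : ℤ) := by push_cast; ring
    rw [e, gegTerm_natCast, gegTerm_natCast]
    have h2 : D (2 * y) = 2 * D y := by
      rw [Derivation.leibniz, show D (2 : A) = 0 by simpa using D.map_natCast 2]
      simp
    have := congrArg (algebraMap ℝ A) (gegCoeff_succ_left hν i 0)
    simp only [map_mul, map_add, map_natCast, map_one] at this
    simp only [Derivation.leibniz, Derivation.leibniz_pow, Derivation.map_algebraMap, h2, pow_zero,
      zero_add, smul_eq_mul, Algebra.smul_def, map_mul, map_ofNat,
      Nat.add_sub_cancel, Derivation.map_one_eq_zero, mul_zero]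
    push_cast
    linear_combination (2 * y) ^ i * 2 * D y * this

theorem derivation_gegTerm (D : Derivation ℝ A A) {ν : ℝ} (hν : 0 < ν) (y s : A) (i : ℤ) (j : ℕ) :
    D (gegTerm ν y s i (j + 1)) = (2 * ν) • (gegTerm (ν + 1) y s (i - 1) (j + 1) * D y)
      - ν • (gegTerm (ν + 1) y s i j * D s) := by
  have h2 : D (2 * y) = 2 * D y := by
    rw [Derivation.leibniz, show D (2 : A) = 0 by simpa using D.map_natCast 2]
    simp
  rcases lt_trichotomy i 0 with hi | rfl | hi
  · rw [gegTerm_neg _ _ _ hi, gegTerm_neg _ _ _ hi, gegTerm_neg _ _ _ (by omega)]; simp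
  · rw [gegTerm_neg (ν + 1) _ _ (i := 0 - 1) (by omega)]
    have := congrArg (algebraMap ℝ A) (gegCoeff_succ_right hν 0 j)
    simp only [map_mul, map_add, map_natCast, map_one, map_neg] at this
    have e : (0 : ℤ) = ((0 : ℕ) : ℤ) := rfl
    rw [e, gegTerm_natCast, gegTerm_natCast]
    simp only [Derivation.leibniz, Derivation.leibniz_pow, Derivation.map_algebraMap, pow_zero,
      one_mul, zero_mul, smul_eq_mul, Algebra.smul_def, Nat.add_sub_cancel]
    push_cast
    linear_combination s ^ j * D s * this
  · obtain ⟨i, rfl⟩ : ∃ k : ℕ, i = ((k + 1 : ℕ) : ℤ) := ⟨(i - 1).toNat, by omega⟩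
    have e : ((i + 1 : ℕ) : ℤ) - 1 = (i : ℤ) := by push_cast; ring
    rw [e, gegTerm_natCast, gegTerm_natCast, gegTerm_natCast]
    have h3 := congrArg (algebraMap ℝ A) (gegCoeff_succ_left hν i (j + 1))
    have h4 := congrArg (algebraMap ℝ A) (gegCoeff_succ_right hν (i + 1) j)
    simp only [map_mul, map_add, map_natCast, map_one, map_neg] at h3 h4
    simp only [Derivation.leibniz, Derivation.leibniz_pow, Derivation.map_algebraMap, h2,
      smul_eq_mul, Algebra.smul_def, map_mul, map_ofNat, Nat.add_sub_cancel]
    push_cast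
    linear_combination (2 * y) ^ i * s ^ (j + 1) * 2 * D y * h3
      + s ^ j * (2 * y) ^ (i + 1) * D s * h4

/-- Termwise, m + 2ν = 2(ν + i + j) - i with i = m - 2j, so `gegTerm_raise` and `gegTerm_deg_left`
account for the two summands. -/
theorem geg_raise {ν : ℝ} (hν : 0 < ν) (m : ℤ) (y s : A) :
    (m + 2 * ν) • geg ν m y s = (2 * ν) • (geg (ν + 1) m y s - y * geg (ν + 1) (m - 1) y s) := by
  have hM : m < 2 * ((m.toNat + 1 : ℕ) : ℤ) := by omega
  rw [geg_eq_sum ν m y s _ hM, geg_eq_sum (ν + 1) m y s _ hM,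
    geg_eq_sum (ν + 1) (m - 1) y s (m.toNat + 1) (by omega), Finset.mul_sum,
    ← Finset.sum_sub_distrib, Finset.smul_sum, Finset.smul_sum]
  refine Finset.sum_congr rfl fun j _ => ?_
  have h1 := gegTerm_raise hν y s (m - 2 * j) j
  have h2 := gegTerm_deg_left hν y s (m - 2 * j) j
  rw [show m - 2 * (j : ℤ) - 1 = m - 1 - 2 * j by ring] at h2
  simp only [Algebra.smul_def] at *
  push_cast [map_mul, map_add, map_sub] at *
  simp only [map_intCast, map_ofNat] at *
  linear_combination 2 * h1 - h2

/-- Euler's identity for weighted homogeneity, y having weight 1 and s weight 2: m = (m - 2j) + 2j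
on each term. -/
theorem geg_euler {ν : ℝ} (hν : 0 < ν) (m : ℤ) (y s : A) :
    (m : ℝ) • geg ν m y s =
      (2 * ν) • (y * geg (ν + 1) (m - 1) y s - s * geg (ν + 1) (m - 2) y s) := by
  have hM : m < 2 * ((m.toNat + 1 : ℕ) : ℤ) := by omega
  have e2 : geg (ν + 1) (m - 2) y s = _ := geg_eq_sum (ν + 1) (m - 2) y s m.toNat (by omega)
  have h1 : ∑ j ∈ Finset.range (m.toNat + 1), ((m - 2 * j : ℤ) : ℝ) • gegTerm ν y s (m - 2 * j) j
      = (2 * ν) • (y * geg (ν + 1) (m - 1) y s) := by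
    rw [geg_eq_sum (ν + 1) (m - 1) y s (m.toNat + 1) (by omega), Finset.mul_sum, Finset.smul_sum]
    refine Finset.sum_congr rfl fun j _ => ?_
    rw [gegTerm_deg_left hν y s (m - 2 * j) j, show m - 2 * (j : ℤ) - 1 = m - 1 - 2 * j by ring]
  have h2 : ∑ j ∈ Finset.range (m.toNat + 1), (j : ℝ) • gegTerm ν y s (m - 2 * j) j
      = -(ν • (s * geg (ν + 1) (m - 2) y s)) := by
    rw [Finset.sum_range_succ', e2, Finset.mul_sum, Finset.smul_sum, ← Finset.sum_neg_distrib]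
    simp only [Nat.cast_zero, zero_smul, add_zero]
    refine Finset.sum_congr rfl fun j _ => ?_
    have := gegTerm_deg_right hν y s (m - 2 * ((j + 1 : ℕ) : ℤ)) j
    push_cast at this ⊢
    rw [this, show m - 2 * ((j : ℤ) + 1) = m - 2 - 2 * j by ring]
  rw [geg_eq_sum ν m y s _ hM, smul_sub, ← h1,
    show (2 * ν) • (s * geg (ν + 1) (m - 2) y s) = (2 : ℝ) • (ν • (s * geg (ν + 1) (m - 2) y s)) by
      rw [smul_smul], ← neg_neg (ν • _), ← h2, smul_neg, sub_neg_eq_add, Finset.smul_sum,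
    Finset.smul_sum, ← Finset.sum_add_distrib]
  refine Finset.sum_congr rfl fun j _ => ?_
  rw [smul_smul, ← add_smul]
  congr 1
  push_cast
  ring

/-- The chain rule with ∂_y and ∂_s written through parameter ν + 1. Stating it for an arbitrary
derivation covers both the infinitesimal rotations and the partial derivatives. -/
theorem derivation_geg (D : Derivation ℝ A A) {ν : ℝ} (hν : 0 < ν) (m : ℤ) (y s : A) :
    D (geg ν m y s) = (2 * ν) • (geg (ν + 1) (m - 1) y s * D y)
      - ν • (geg (ν + 1) (m - 2) y s * D s) := by
  have hM : m < 2 * ((m.toNat + 1 : ℕ) : ℤ) := by omega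
  rw [geg_eq_sum ν m y s _ hM, geg_eq_sum (ν + 1) (m - 2) y s m.toNat (by omega),
    geg_eq_sum (ν + 1) (m - 1) y s (m.toNat + 1) (by omega), Finset.sum_range_succ',
    Finset.sum_range_succ' (n := m.toNat), map_add, map_sum, Finset.sum_mul, add_mul,
    Finset.sum_mul, smul_add, Finset.smul_sum, Finset.smul_sum, add_sub_right_comm,
    ← Finset.sum_sub_distrib]
  congr 1
  · refine Finset.sum_congr rfl fun j _ => ?_
    rw [derivation_gegTerm D hν]
    push_cast
    rw [show m - 2 * ((j : ℤ) + 1) - 1 = m - 1 - 2 * (j + 1) by ring,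
      show m - 2 * ((j : ℤ) + 1) = m - 2 - 2 * j by ring]
  · rw [derivation_gegTerm_left D hν]
    simp

end DirSphere
end

noncomputable section
namespace DirSphere

/-! ### Recurrences and differential equations for Gegenbauer and Chebyshev polynomials -/

section Identities

variable {A : Type*} [CommRing A] [Algebra ℝ A]

/-- The polynomials of parameter ν + 1 are eliminated between `geg_euler` and `geg_raise` in
neighbouring degrees. -/
theorem geg_three_term {ν : ℝ} (hν : 0 < ν) (m : ℤ) (y s : A) :
    (2 * (m + ν)) • (y * geg ν m y s) =
      ((m : ℝ) + 1) • geg ν (m + 1) y s + (m + 2 * ν - 1) • (s * geg ν (m - 1) y s) := by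
  have h1 := geg_euler hν (m + 1) y s
  have h2 := geg_raise hν (m - 1) y s
  have h3 := geg_euler hν m y s
  have h4 := geg_raise hν m y s
  rw [show m + 1 - 1 = m by ring, show m + 1 - 2 = m - 1 by ring] at h1
  rw [show m - 1 - 1 = m - 2 by ring] at h2
  simp only [Algebra.smul_def] at *
  push_cast [map_mul, map_add, map_sub] at *
  simp only [map_intCast, map_ofNat] at *
  linear_combination y * h3 + y * h4 - h1 - s * h2

theorem geg_lower_deriv {ν : ℝ} (hν : 0 < ν) (m : ℤ) (y s : A) :
    (2 * ν) • ((s - y ^ 2) * geg (ν + 1) (m - 1) y s) =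
      (m - 1 + 2 * ν) • (s * geg ν (m - 1) y s) - (m : ℝ) • (y * geg ν m y s) := by
  have h2 := geg_raise hν (m - 1) y s
  have h3 := geg_euler hν m y s
  rw [show m - 1 - 1 = m - 2 by ring] at h2
  simp only [Algebra.smul_def] at *
  push_cast [map_mul, map_add, map_sub] at *
  simp only [map_intCast, map_ofNat] at *
  linear_combination y * h3 - s * h2

/-- This is the Gegenbauer equation for C_{m+1}^ν, with its first and second derivatives written
through the parameters ν + 1 and ν + 2. It is the form in which the product rule produces it in
`D_solid_succ`. -/
theorem geg_lower_parameter {ν : ℝ} (hν : 0 < ν) (m : ℤ) (x : A) :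
    (2 * ν + 1) • (x * geg (ν + 1) m x 1)
        - (2 * (ν + 1)) • ((1 - x ^ 2) * geg (ν + 1 + 1) (m - 1) x 1) =
      ((m + 1) * (m + 2 * ν + 1) / (2 * ν)) • geg ν (m + 1) x 1 := by
  have h1 := geg_lower_deriv (show 0 < ν + 1 by linarith) m x (1 : A)
  have h2 := geg_euler hν (m + 1) x (1 : A)
  rw [show m + 1 - 1 = m by ring, show m + 1 - 2 = m - 1 by ring] at h2
  have h3 : ((m + 1) * (m + 2 * ν + 1) / (2 * ν)) • geg ν (m + 1) x (1 : A) =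
      ((m + 2 * ν + 1) / (2 * ν)) • (((m + 1 : ℤ) : ℝ) • geg ν (m + 1) x (1 : A)) := by
    rw [smul_smul]; congr 1; push_cast; ring
  rw [h3, h2, smul_smul, div_mul_cancel₀ _ (by positivity), h1]
  simp only [Algebra.smul_def] at *
  push_cast [map_mul, map_add, map_sub] at *
  simp only [map_intCast, map_ofNat] at *
  ring

theorem geg_ode {ν : ℝ} (hν : 0 < ν) (m : ℤ) (y s : A) :
    (4 * ν * (ν + 1)) • ((s - y ^ 2) * geg (ν + 1 + 1) (m - 2) y s)
      - ((2 * ν + 1) * (2 * ν)) • (y * geg (ν + 1) (m - 1) y s)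
      + (m * (m + 2 * ν)) • geg ν m y s = 0 := by
  have h1 := geg_lower_deriv (show 0 < ν + 1 by linarith) (m - 1) y s
  have h2 := geg_euler hν m y s
  rw [show m - 1 - 1 = m - 2 by ring] at h1
  simp only [Algebra.smul_def] at *
  push_cast [map_mul, map_add, map_sub] at *
  simp only [map_intCast, map_ofNat] at *
  linear_combination 2 * algebraMap ℝ A ν * h1 + (m + 2 * algebraMap ℝ A ν) * h2

/-- The homogeneous Chebyshev polynomial `s^{k/2} T_k(y / √s)`. -/
def cheb (k : ℕ) (y s : A) : A :=
  if k = 0 then 1 else y * geg 1 ((k : ℤ) - 1) y s - s * geg 1 ((k : ℤ) - 2) y s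

theorem cheb_zero (y s : A) : cheb 0 y s = 1 := by simp [cheb]

theorem cheb_succ (k : ℕ) (y s : A) :
    cheb (k + 1) y s = y * geg 1 (k : ℤ) y s - s * geg 1 ((k : ℤ) - 1) y s := by
  simp only [cheb, Nat.succ_ne_zero, if_false]
  push_cast
  rw [show (k : ℤ) + 1 - 1 = k by ring, show (k : ℤ) + 1 - 2 = k - 1 by ring]

theorem cheb_one (y s : A) : cheb 1 y s = y := by
  rw [show 1 = 0 + 1 from rfl, cheb_succ]
  simp [geg_zero one_pos, geg_of_neg]

theorem geg_one_three_term (m : ℤ) (hm : m ≠ -1) (y s : A) :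
    geg 1 (m + 1) y s = 2 * (y * geg 1 m y s) - s * geg 1 (m - 1) y s := by
  have h := geg_three_term one_pos m y s
  have hm' : (m : ℝ) + 1 ≠ 0 := by exact_mod_cast (show m + 1 ≠ 0 by omega)
  have h2 : ((m : ℝ) + 1) • geg 1 (m + 1) y s =
      ((m : ℝ) + 1) • (2 * (y * geg 1 m y s) - s * geg 1 (m - 1) y s) := by
    simp only [Algebra.smul_def] at *
    push_cast [map_mul, map_add, map_sub] at *
    simp only [map_intCast, map_ofNat] at *
    linear_combination -h
  simpa [smul_smul, inv_mul_cancel₀ hm'] using congrArg (fun z => ((m : ℝ) + 1)⁻¹ • z) h2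

theorem cheb_add_two (k : ℕ) (y s : A) :
    cheb (k + 2) y s = 2 * (y * cheb (k + 1) y s) - s * cheb k y s := by
  rcases k with _ | k
  · have h := geg_one_three_term 0 (by norm_num) y s
    rw [cheb_zero, cheb_one, cheb_succ]
    simp only [geg_zero one_pos] at h
    rw [geg_of_neg 1 (m := 0 - 1) (by norm_num)] at h
    norm_num at h ⊢
    rw [h, geg_zero one_pos]; ring
  · have h1 := geg_one_three_term ((k : ℤ) + 1) (by omega) y s
    have h2 := geg_one_three_term (k : ℤ) (by omega) y s
    rw [cheb_succ, cheb_succ, cheb_succ]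
    push_cast
    rw [show (k : ℤ) + 1 - 1 = k by ring] at *
    rw [show (k : ℤ) + 2 - 1 = k + 1 by ring, show (k : ℤ) + 2 = k + 1 + 1 by ring]
    linear_combination y * h1 - s * h2

end Identities

/-! ### Ladder families -/

section Ladder

variable {A : Type*} [CommRing A] [Algebra ℝ A]

/-- An angular family: polynomials `H k` of degree `k` in `y` and `1 - x²` with a three-term
recurrence and a lowering rule for the infinitesimal rotation `D`. -/
structure AngularFamily (D : Derivation ℝ A A) (x y : A) (μ : ℝ) (H : ℕ → A) (a b : ℕ → ℝ) :
    Prop where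
  param_nonneg : 0 ≤ μ
  D_x : D x = -y
  H_zero : H 0 = 1
  y_mul_zero : y * H 0 = a 0 • H 1
  y_mul_succ : ∀ k, y * H (k + 1) = a (k + 1) • H (k + 2) + b k • ((1 - x ^ 2) * H k)
  D_succ : ∀ k : ℕ, D (H (k + 1)) = (2 * (k + 1 + μ) * b k) • (x * H k)
  a_pos : ∀ k, 0 < a k
  b_pos : ∀ k, 0 < b k

theorem angularFamily_geg (D : Derivation ℝ A A) {x y : A} {μ : ℝ} (hμ : 0 < μ)
    (hx : D x = -y) (hy : D y = x) :
    AngularFamily D x y μ (fun k => geg μ (k : ℤ) y (1 - x ^ 2))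
      (fun k => (k + 1) / (2 * (k + μ))) (fun k => (k + 2 * μ) / (2 * (k + 1 + μ))) where
  param_nonneg := hμ.le
  D_x := hx
  H_zero := by simpa using geg_zero hμ y (1 - x ^ 2)
  y_mul_zero := by
    have h := geg_three_term hμ 0 y (1 - x ^ 2)
    rw [geg_of_neg μ (m := 0 - 1) (by norm_num)] at h
    have h2 := congrArg (fun z => (2 * μ)⁻¹ • z) h
    simp only [smul_smul, Int.cast_zero, zero_add, mul_zero] at h2
    rw [inv_mul_cancel₀ (by positivity), one_smul] at h2
    simpa using h2
  y_mul_succ k := by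
    have h := geg_three_term hμ ((k : ℤ) + 1) y (1 - x ^ 2)
    have hp : (0 : ℝ) < 2 * (k + 1 + μ) := by positivity
    have h2 := congrArg (fun z => (2 * ((k : ℝ) + 1 + μ))⁻¹ • z) h
    push_cast at h2 ⊢
    simp only [smul_smul, smul_add] at h2
    rw [inv_mul_cancel₀ hp.ne', one_smul] at h2
    rw [h2, show (k : ℤ) + 1 + 1 = k + 2 by ring, show (k : ℤ) + 1 - 1 = k by ring]
    congr 2
    · ring
    · ring
  -- Since D(1 - x²) = 2xy, the chain rule gives 2μx (C_k^{μ+1} - y C_{k-1}^{μ+1}), which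
  -- `geg_raise` collapses to a multiple of x C_k^μ.
  D_succ k := by
    have h := geg_raise hμ (k : ℤ) y (1 - x ^ 2)
    have hp : (0 : ℝ) < 2 * (k + 1 + μ) := by positivity
    have hs : D (1 - x ^ 2) = 2 * x * y := by
      rw [map_sub, Derivation.leibniz_pow, Derivation.map_one_eq_zero, hx]
      simp; ring
    rw [derivation_geg D hμ, hs, hy, mul_div_cancel₀ _ hp.ne']
    push_cast at *
    rw [show (k : ℤ) + 1 - 1 = k by ring, show (k : ℤ) + 1 - 2 = k - 1 by ring]
    simp only [Algebra.smul_def] at *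
    push_cast [map_mul, map_add, map_sub] at *
    simp only [map_ofNat] at *
    linear_combination -x * h
  a_pos k := by positivity
  b_pos k := by positivity

/-- The limiting case μ = 0. The recurrence T_{k+2} = 2yT_{k+1} - sT_k starts with T_1 = y instead
of 2y, hence the exceptional raising coefficient at k = 0. The rule D T_{k+1} = (k+1) x T_k is
propagated by applying D to the recurrence. -/
theorem angularFamily_cheb (D : Derivation ℝ A A) {x y : A} (hx : D x = -y) (hy : D y = x) :
    AngularFamily D x y 0 (fun k => cheb k y (1 - x ^ 2))
      (fun k => if k = 0 then 1 else 1 / 2) (fun _ => 1 / 2) where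
  param_nonneg := le_rfl
  D_x := hx
  H_zero := cheb_zero _ _
  y_mul_zero := by simp [cheb_zero, cheb_one]
  y_mul_succ k := by
    have h := cheb_add_two k y (1 - x ^ 2)
    simp only [Nat.succ_ne_zero, if_false]
    rw [h, ← smul_add, sub_add_cancel, two_mul, smul_add, ← add_smul]
    norm_num
  D_succ k := by
    have hs : D (1 - x ^ 2) = 2 * x * y := by
      rw [map_sub, Derivation.leibniz_pow, Derivation.map_one_eq_zero, hx]
      simp; ring
    induction k using Nat.twoStepInduction with
    | zero => simp [cheb_zero, cheb_one, hy]
    | one =>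
      have h2 : D (2 : A) = 0 := by simpa using D.map_natCast 2
      simp only [Nat.reduceAdd, cheb_add_two 0, cheb_one, cheb_zero]
      rw [map_sub, Derivation.leibniz, Derivation.leibniz, Derivation.leibniz, hs, hy, h2,
        Derivation.map_one_eq_zero]
      rw [show 2 * (((1 : ℕ) : ℝ) + 1 + 0) * (1 / 2) = 2 by norm_num]
      simp only [smul_eq_mul]
      simp only [Algebra.smul_def, map_ofNat]
      ring
    | more k ih1 ih2 =>
      have h2 : D (2 : A) = 0 := by simpa using D.map_natCast 2
      have e2 := cheb_add_two k y (1 - x ^ 2)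
      have e := cheb_add_two (k + 1) y (1 - x ^ 2)
      rw [show k + 2 + 1 = k + 1 + 2 by ring, cheb_add_two (k + 1), map_sub, Derivation.leibniz,
        Derivation.leibniz, Derivation.leibniz, hs, hy, h2, ih1,
        show k + 1 + 1 = (k + 1) + 1 by ring, ih2]
      have r1 : (2 * ((k : ℝ) + 1 + 0) * (1 / 2)) = k + 1 := by ring
      have r2 : (2 * (((k + 1 : ℕ) : ℝ) + 1 + 0) * (1 / 2)) = k + 2 := by push_cast; ring
      have r3 : (2 * (((k + 2 : ℕ) : ℝ) + 1 + 0) * (1 / 2)) = k + 3 := by push_cast; ring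
      rw [r1, r2, r3]
      simp only [smul_eq_mul]
      simp only [Algebra.smul_def, map_add, map_natCast, map_ofNat, map_one]
      linear_combination (-(k : A) - 1) * x * e2
  a_pos k := by
    show (0 : ℝ) < if k = 0 then 1 else 1 / 2
    split_ifs <;> norm_num
  b_pos k := by norm_num

/-- The unnormalized harmonic of degree `l` and order `k`. -/
def solid (x : A) (μ : ℝ) (H : ℕ → A) (l k : ℕ) : A :=
  geg (μ + 1 / 2 + k) ((l : ℤ) - k) x 1 * H k

theorem solid_of_lt (x : A) (μ : ℝ) (H : ℕ → A) {l k : ℕ} (h : l < k) : solid x μ H l k = 0 := by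
  rw [solid, geg_of_neg _ (by omega), zero_mul]

namespace AngularFamily

variable {D : Derivation ℝ A A} {x y : A} {μ : ℝ} {H : ℕ → A} {a b : ℕ → ℝ}

theorem D_geg (h : AngularFamily D x y μ H a b) {ν : ℝ} (hν : 0 < ν) (m : ℤ) :
    D (geg ν m x 1) = -((2 * ν) • (geg (ν + 1) (m - 1) x 1 * y)) := by
  rw [derivation_geg D hν, Derivation.map_one_eq_zero, h.D_x]
  simp

theorem D_solid_zero (h : AngularFamily D x y μ H a b) (l : ℕ) :
    D (solid x μ H l 0) = -((2 * (μ + 1 / 2) * a 0) • solid x μ H l 1) := by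
  have := h.param_nonneg
  have h0 := h.y_mul_zero
  rw [h.H_zero] at h0
  simp only [solid, h.H_zero, mul_one, Nat.cast_zero, add_zero, Nat.cast_one]
  rw [h.D_geg (by positivity)]
  rw [mul_one] at h0
  rw [h0, mul_smul_comm, smul_smul, sub_zero]

/-- By the product rule, D hits the factor in x, producing y H_{k+1}, or the angular factor,
producing x H_k. The recurrence for y H_{k+1} splits off the part of order k + 2, and everything
multiplying H_k is the left side of `geg_lower_parameter`. -/
theorem D_solid_succ (h : AngularFamily D x y μ H a b) (l k : ℕ) :
    D (solid x μ H l (k + 1)) =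
      (b k * (l - k) * (l + k + 2 * (μ + 1 / 2)) / (2 * (μ + 1 / 2 + k))) • solid x μ H l k
      - (2 * (μ + 1 / 2 + (k + 1)) * a (k + 1)) • solid x μ H l (k + 2) := by
  have := h.param_nonneg
  have hν : 0 < μ + 1 / 2 + k := by positivity
  have h1 := geg_lower_parameter hν ((l : ℤ) - (k + 1)) x
  have h2 := h.y_mul_succ k
  simp only [solid]
  rw [Derivation.leibniz, h.D_geg (by positivity), h.D_succ]
  push_cast at *
  rw [show μ + 1 / 2 + (k + 2 : ℝ) = μ + 1 / 2 + (k + 1) + 1 by ring,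
    show (l : ℤ) - (k + 2) = l - (k + 1) - 1 by ring,
    show μ + 1 / 2 + ((k : ℝ) + 1) = μ + 1 / 2 + k + 1 by ring]
  rw [show (l : ℤ) - k = l - (k + 1) + 1 by ring]
  have e1 : (b k * ((l : ℝ) - k) * (l + k + 2 * (μ + 1 / 2)) / (2 * (μ + 1 / 2 + k))) •
        (geg (μ + 1 / 2 + k) ((l : ℤ) - (k + 1) + 1) x 1 * H k) =
      b k • (((2 * (μ + 1 / 2 + k) + 1) • (x * geg (μ + 1 / 2 + k + 1) ((l : ℤ) - (k + 1)) x 1) -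
        (2 * (μ + 1 / 2 + k + 1)) •
          ((1 - x ^ 2) * geg (μ + 1 / 2 + k + 1 + 1) ((l : ℤ) - (k + 1) - 1) x 1)) * H k) := by
    rw [h1, smul_mul_assoc, smul_smul]
    congr 1
    ring
  rw [e1]
  simp only [smul_eq_mul]
  simp only [Algebra.smul_def, map_mul, map_add, map_natCast, map_ofNat, map_one] at *
  have hh : (algebraMap ℝ A) (1 / 2) * 2 = 1 := by
    rw [← map_ofNat (algebraMap ℝ A) 2, ← map_mul]; norm_num
  linear_combination -(2 * (algebraMap ℝ A μ + algebraMap ℝ A (1 / 2) + k + 1) *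
    geg (μ + 1 / 2 + k + 1 + 1) ((l : ℤ) - (k + 1) - 1) x 1) * h2
    - algebraMap ℝ A (b k) * x * geg (μ + 1 / 2 + k + 1) ((l : ℤ) - (k + 1)) x 1 * H k * hh

end AngularFamily

end Ladder

end DirSphere
end

/-! ### Orthogonality, norms and span of a ladder family -/

noncomputable section
namespace DirSphere

open Polynomial (aeval) in
theorem geg_eq_aeval {A : Type*} [CommRing A] [Algebra ℝ A] (ν : ℝ) (m : ℤ) (x : A) :
    geg ν m x 1 = aeval x (geg ν m (Polynomial.X : Polynomial ℝ) 1) := by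
  rw [map_geg]; simp

namespace AngularFamily

variable {A : Type*} [CommRing A] [Algebra ℝ A]
variable {D : Derivation ℝ A A} {x y : A} {μ : ℝ} {H : ℕ → A} {a b : ℕ → ℝ}

theorem H_succ (h : AngularFamily D x y μ H a b) (k : ℕ) :
    H (k + 2) = (a (k + 1))⁻¹ • (y * H (k + 1) - b k • ((1 - x ^ 2) * H k)) := by
  rw [h.y_mul_succ, add_sub_cancel_right, smul_smul, inv_mul_cancel₀ (h.a_pos _).ne', one_smul]

theorem H_one (h : AngularFamily D x y μ H a b) : H 1 = (a 0)⁻¹ • y := by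
  have := h.y_mul_zero
  rw [h.H_zero, mul_one] at this
  rw [this, smul_smul, inv_mul_cancel₀ (h.a_pos _).ne', one_smul]

section Orthogonality

variable (E : A →ₗ[ℝ] ℝ)

/-- The recurrence peels a factor y off the lower-order H_j and moves it onto H_k. This changes k by
at most one while lowering j, so the inequality j < k survives until j = 0, where the hypothesis on
`E` applies. -/
theorem orthogonal_order (h : AngularFamily D x y μ H a b)
    (hE : ∀ (p : Polynomial ℝ) (k : ℕ), E (Polynomial.aeval x p * H (k + 1)) = 0) (j : ℕ) :
    ∀ (p : Polynomial ℝ) (k : ℕ), j < k → E (Polynomial.aeval x p * (H j * H k)) = 0 := by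
  have hs : ∀ p : Polynomial ℝ, Polynomial.aeval x p * (1 - x ^ 2) =
      Polynomial.aeval x (p * (1 - Polynomial.X ^ 2)) := fun p => by simp
  have hy : ∀ (p : Polynomial ℝ) (q : A) (k : ℕ), E (Polynomial.aeval x p * (y * q * H (k + 1))) =
      a (k + 1) * E (Polynomial.aeval x p * (q * H (k + 2)))
      + b k * E (Polynomial.aeval x (p * (1 - Polynomial.X ^ 2)) * (q * H k)) := by
    intro p q k
    rw [← hs, ← smul_eq_mul (a (k + 1)), ← smul_eq_mul (b k), ← map_smul, ← map_smul, ← map_add]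
    congr 1
    have := h.y_mul_succ k
    simp only [Algebra.smul_def] at *
    linear_combination (Polynomial.aeval x p * q) * this
  induction j using Nat.twoStepInduction with
  | zero =>
    intro p k hk
    obtain ⟨k, rfl⟩ := Nat.exists_eq_succ_of_ne_zero hk.ne'
    rw [h.H_zero, one_mul]
    exact hE p k
  | one =>
    intro p k hk
    obtain ⟨k, rfl⟩ : ∃ i, k = i + 2 := ⟨k - 2, by omega⟩
    rw [h.H_one, smul_mul_assoc, mul_smul_comm, map_smul]
    have := hy p 1 (k + 1)
    simp only [mul_one, one_mul] at this
    rw [this, hE, hE]; simp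
  | more j ih1 ih2 =>
    intro p k hk
    obtain ⟨k, rfl⟩ : ∃ i, k = i + 3 := ⟨k - 3, by omega⟩
    have e : Polynomial.aeval x p * (H (j + 2) * H (k + 3)) = (a (j + 1))⁻¹ •
        (Polynomial.aeval x p * (y * H (j + 1) * H (k + 2 + 1)) -
          b j • (Polynomial.aeval x (p * (1 - Polynomial.X ^ 2)) * (H j * H (k + 3)))) := by
      rw [h.H_succ, ← hs]
      simp only [Algebra.smul_def]
      ring
    rw [e, map_smul, map_sub, map_smul, ih1 _ _ (by omega), hy, ih2 _ _ (by omega),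
      ih2 _ _ (by omega)]
    simp

theorem solid_orthogonal_order (h : AngularFamily D x y μ H a b)
    (hE : ∀ (p : Polynomial ℝ) (k : ℕ), E (Polynomial.aeval x p * H (k + 1)) = 0)
    (l m : ℕ) {j k : ℕ} (hjk : j ≠ k) : E (solid x μ H l j * solid x μ H m k) = 0 := by
  wlog hlt : j < k generalizing l m j k
  · rw [mul_comm]
    exact this m l hjk.symm (by omega)
  rw [solid, solid, geg_eq_aeval _ _ x, geg_eq_aeval _ ((m : ℤ) - k) x, mul_mul_mul_comm, ← map_mul]
  exact h.orthogonal_order E hE j _ k hlt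

/-- `E` annihilates D of the product of order k in degree l and order k + 1 in degree m. After
expansion by the ladder formula, orthogonality of distinct orders leaves exactly one term from each
factor. -/
theorem norm_ladder (h : AngularFamily D x y μ H a b) (hD : ∀ p, E (D p) = 0)
    (hE : ∀ (p : Polynomial ℝ) (k : ℕ), E (Polynomial.aeval x p * H (k + 1)) = 0) (l m k : ℕ) :
    (2 * (μ + 1 / 2 + k) * a k) * E (solid x μ H l (k + 1) * solid x μ H m (k + 1)) =
      (b k * (m - k) * (m + k + 2 * (μ + 1 / 2)) / (2 * (μ + 1 / 2 + k))) *
        E (solid x μ H l k * solid x μ H m k) := by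
  have h1 := hD (solid x μ H l k * solid x μ H m (k + 1))
  rw [Derivation.leibniz, h.D_solid_succ, smul_eq_mul, smul_eq_mul, mul_sub, map_add, map_sub,
    mul_smul_comm, mul_smul_comm, map_smul, map_smul,
    h.solid_orthogonal_order E hE l m (show k ≠ k + 2 by omega)] at h1
  have h2 : E (solid x μ H m (k + 1) * D (solid x μ H l k)) =
      -((2 * (μ + 1 / 2 + k) * a k) * E (solid x μ H l (k + 1) * solid x μ H m (k + 1))) := by
    rcases k with _ | k
    · rw [h.D_solid_zero, mul_neg, map_neg, mul_smul_comm, map_smul, smul_eq_mul, mul_comm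
        (solid x μ H m (0 + 1))]
      simp
    · rw [h.D_solid_succ, mul_sub, map_sub, mul_smul_comm, mul_smul_comm, map_smul, map_smul,
        h.solid_orthogonal_order E hE m l (show k + 1 + 1 ≠ k by omega),
        mul_comm (solid x μ H m (k + 1 + 1))]
      push_cast
      simp
  rw [h2] at h1
  simp only [smul_eq_mul] at h1
  linarith

/-- The left side of `norm_ladder` is symmetric in l and m. The coefficients on the right differ by
a nonzero multiple of (l - m)(l + m + 2μ + 1), which forces the pairing to vanish. -/
theorem solid_orthogonal_degree (h : AngularFamily D x y μ H a b) (hD : ∀ p, E (D p) = 0)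
    (hE : ∀ (p : Polynomial ℝ) (k : ℕ), E (Polynomial.aeval x p * H (k + 1)) = 0)
    {l m : ℕ} (hlm : l ≠ m) (k : ℕ) : E (solid x μ H l k * solid x μ H m k) = 0 := by
  have h1 := h.norm_ladder E hD hE l m k
  have h2 := h.norm_ladder E hD hE m l k
  have hμ := h.param_nonneg
  have hb := h.b_pos k
  rw [mul_comm (solid x μ H m (k + 1)), h1, mul_comm (solid x μ H m k)] at h2
  have hp : (0 : ℝ) < μ + 1 / 2 + k := by positivity
  have hne : (l : ℝ) - m ≠ 0 := sub_ne_zero.2 (by exact_mod_cast hlm)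
  have hp2 : (0 : ℝ) < l + m + 2 * (μ + 1 / 2) := by positivity
  have h3 : (b k * ((l : ℝ) - m) * (l + m + 2 * (μ + 1 / 2)) / (2 * (μ + 1 / 2 + k))) *
        E (solid x μ H l k * solid x μ H m k) = 0 := by
    linear_combination -h2
  exact (mul_eq_zero.1 h3).resolve_left (by positivity)

/-- Pairing x C_l with C_{l+1} can be expanded by the three-term recurrence of either factor;
orthogonality of degrees leaves one norm on each side. -/
theorem norm_degree (h : AngularFamily D x y μ H a b) (hD : ∀ p, E (D p) = 0)
    (hE : ∀ (p : Polynomial ℝ) (k : ℕ), E (Polynomial.aeval x p * H (k + 1)) = 0) (l : ℕ) :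
    (l + 1) * (l + 1 + (μ + 1 / 2)) * E (solid x μ H (l + 1) 0 ^ 2) =
      (l + (μ + 1 / 2)) * (l + 2 * (μ + 1 / 2)) * E (solid x μ H l 0 ^ 2) := by
  have hν : 0 < μ + 1 / 2 := by have := h.param_nonneg; positivity
  have e : ∀ l : ℕ, geg (μ + 1 / 2) (l : ℤ) x 1 = solid x μ H l 0 := fun l => by
    simp [solid, h.H_zero]
  have o : ∀ l : ℕ, E (geg (μ + 1 / 2) ((l : ℤ) - 1) x 1 * geg (μ + 1 / 2) ((l : ℤ) + 1) x 1)
      = 0 := by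
    intro l
    rcases l with _ | l
    · rw [geg_of_neg _ (by simp)]; simp
    · have := h.solid_orthogonal_degree E hD hE (show l ≠ l + 2 by omega) 0
      rw [← e, ← e] at this
      push_cast at this ⊢
      rwa [show (l : ℤ) + 1 - 1 = l by ring, show (l : ℤ) + 1 + 1 = l + 2 by ring]
  have t1 := geg_three_term hν (l : ℤ) x (1 : A)
  have t2 := geg_three_term hν ((l : ℤ) + 1) x (1 : A)
  have s1 := congrArg E (congrArg (· * geg (μ + 1 / 2) ((l : ℤ) + 1) x 1) t1)
  have s2 := congrArg E (congrArg (· * geg (μ + 1 / 2) (l : ℤ) x 1) t2)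
  have o2 := o (l + 1)
  push_cast at o2
  rw [show (l : ℤ) + 1 - 1 = l by ring] at o2 s2
  simp only [add_mul, smul_mul_assoc, map_add, map_smul, one_mul, smul_eq_mul, o] at s1 s2
  rw [mul_comm (geg (μ + 1 / 2) ((l : ℤ) + 1 + 1) x 1), o2] at s2
  have c1 : x * geg (μ + 1 / 2) ((l : ℤ) + 1) x 1 * geg (μ + 1 / 2) (l : ℤ) x 1 =
    x * geg (μ + 1 / 2) (l : ℤ) x 1 * geg (μ + 1 / 2) ((l : ℤ) + 1) x 1 := by ring
  rw [c1] at s2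
  rw [← e, ← e, pow_two, pow_two]
  push_cast at *
  linear_combination -((l : ℝ) + 1 + (μ + 1 / 2)) * s1 + ((l : ℝ) + (μ + 1 / 2)) * s2

end Orthogonality

/-- For fixed k the span over all degrees contains H_k, as the case l = k, and is stable under
multiplication by x through the three-term recurrence. -/
theorem aeval_mul_mem_span (h : AngularFamily D x y μ H a b) (p : Polynomial ℝ) (k : ℕ) :
    Polynomial.aeval x p * H k ∈
      Submodule.span ℝ (Set.range fun q : ℕ × ℕ => solid x μ H q.1 q.2) := by
  set W := Submodule.span ℝ (Set.range fun q : ℕ × ℕ => solid x μ H q.1 q.2)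
  set V := Submodule.span ℝ (Set.range fun l : ℕ => solid x μ H l k)
  have hVW : V ≤ W := by
    refine Submodule.span_le.2 ?_
    rintro _ ⟨l, rfl⟩
    exact Submodule.subset_span ⟨(l, k), rfl⟩
  have hsol : ∀ l, solid x μ H l k ∈ V := fun l => Submodule.subset_span ⟨l, rfl⟩
  have hgen : ∀ l, x * solid x μ H l k ∈ V := by
    intro l
    rcases lt_or_ge l k with hlk | hlk
    · rw [solid_of_lt _ _ _ hlk, mul_zero]; exact V.zero_mem
    have hν : 0 < μ + 1 / 2 + k := by have := h.param_nonneg; positivity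
    have hc : (0 : ℝ) < 2 * (((l : ℤ) - k : ℤ) + (μ + 1 / 2 + k)) := by
      have := h.param_nonneg
      push_cast
      have : (0 : ℝ) ≤ l := Nat.cast_nonneg l
      linarith
    have t := geg_three_term hν ((l : ℤ) - k) x (1 : A)
    have t2 : x * solid x μ H l k = (2 * (((l : ℤ) - k : ℤ) + (μ + 1 / 2 + k)))⁻¹ •
        ((2 * (((l : ℤ) - k : ℤ) + (μ + 1 / 2 + k))) • (x * geg (μ + 1 / 2 + k) ((l : ℤ) - k) x 1)
          * H k) := by
      rw [smul_mul_assoc, smul_smul, inv_mul_cancel₀ hc.ne', one_smul, solid, mul_assoc]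
    rw [t2, t]
    refine V.smul_mem _ ?_
    rw [add_mul, smul_mul_assoc, smul_mul_assoc, one_mul]
    refine V.add_mem (V.smul_mem _ ?_) (V.smul_mem _ ?_)
    · have := hsol (l + 1)
      rw [solid] at this
      push_cast at this
      rwa [show (l : ℤ) + 1 - k = l - k + 1 by ring] at this
    · rcases Nat.eq_zero_or_pos l with rfl | hl
      · rw [geg_of_neg _ (by simp; omega), zero_mul]; exact V.zero_mem
      · obtain ⟨l, rfl⟩ := Nat.exists_eq_succ_of_ne_zero hl.ne'
        have := hsol l
        rw [solid] at this
        push_cast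
        rwa [show (l : ℤ) + 1 - k - 1 = l - k by ring]
  have hx : ∀ w ∈ V, x * w ∈ V := by
    intro w hw
    induction hw using Submodule.span_induction with
    | mem w hw => obtain ⟨l, rfl⟩ := hw; exact hgen l
    | zero => rw [mul_zero]; exact V.zero_mem
    | add u v _ _ hu hv => rw [mul_add]; exact V.add_mem hu hv
    | smul c u _ hu => rw [mul_smul_comm]; exact V.smul_mem _ hu
  have hpow : ∀ i : ℕ, x ^ i * H k ∈ V := by
    intro i
    induction i with
    | zero =>
      have := hsol k
      rw [solid, sub_self, geg_zero (by have := h.param_nonneg; positivity)] at this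
      simpa using this
    | succ i ih => rw [pow_succ', mul_assoc]; exact hx _ ih
  apply hVW
  induction p using Polynomial.induction_on' with
  | add p q hp hq => rw [map_add, add_mul]; exact V.add_mem hp hq
  | monomial i c =>
    rw [Polynomial.aeval_monomial, mul_assoc, ← Algebra.smul_def]
    exact V.smul_mem _ (hpow i)

/-- The span contains 1 and is stable under multiplication by x and by y; the factor 1 - x² in the
recurrence for y H_k is absorbed into the polynomial in x. -/
theorem adjoin_le_span (h : AngularFamily D x y μ H a b) {q : A}
    (hq : q ∈ Algebra.adjoin ℝ ({x, y} : Set A)) :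
    q ∈ Submodule.span ℝ (Set.range fun q : ℕ × ℕ => solid x μ H q.1 q.2) := by
  have hmem := h.aeval_mul_mem_span
  set W := Submodule.span ℝ (Set.range fun q : ℕ × ℕ => solid x μ H q.1 q.2)
  have key : ∀ r : A, (∀ l k, r * solid x μ H l k ∈ W) → ∀ w ∈ W, r * w ∈ W := by
    intro r hr w hw
    induction hw using Submodule.span_induction with
    | mem w hw => obtain ⟨⟨l, k⟩, rfl⟩ := hw; exact hr l k
    | zero => rw [mul_zero]; exact W.zero_mem
    | add u v _ _ hu hv => rw [mul_add]; exact W.add_mem hu hv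
    | smul c u _ hu => rw [mul_smul_comm]; exact W.smul_mem _ hu
  have hq' : ∀ w ∈ W, q * w ∈ W := by
    induction hq using Algebra.adjoin_induction with
    | mem r hr =>
      refine key r fun l k => ?_
      rcases hr with rfl | hr
      · rw [solid, geg_eq_aeval, ← mul_assoc]
        have := hmem (Polynomial.X * geg (μ + 1 / 2 + k) ((l : ℤ) - k) (Polynomial.X : Polynomial ℝ) 1) k
        rw [map_mul, Polynomial.aeval_X] at this
        exact this
      · rw [Set.mem_singleton_iff.1 hr, solid, geg_eq_aeval, mul_left_comm]
        rcases k with _ | k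
        · rw [h.y_mul_zero, mul_smul_comm]
          exact W.smul_mem _ (hmem _ _)
        · rw [h.y_mul_succ, mul_add, mul_smul_comm, mul_smul_comm, ← mul_assoc _ (1 - x ^ 2)]
          refine W.add_mem (W.smul_mem _ (hmem _ _)) (W.smul_mem _ ?_)
          have := hmem (geg (μ + 1 / 2 + (k + 1 : ℕ)) ((l : ℤ) - (k + 1 : ℕ)) Polynomial.X 1
            * (1 - Polynomial.X ^ 2)) k
          simpa using this
    | algebraMap c =>
      intro w hw
      rw [← Algebra.smul_def]
      exact W.smul_mem _ hw
    | add u v _ _ hu hv => intro w hw; rw [add_mul]; exact W.add_mem (hu w hw) (hv w hw)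
    | mul u v _ _ hu hv => intro w hw; rw [mul_assoc]; exact hu _ (hv w hw)
  have h1 : (1 : A) ∈ W := by
    have := hmem 1 0
    rwa [h.H_zero, map_one, mul_one] at this
  simpa using hq' 1 h1

end AngularFamily

end DirSphere
end

noncomputable section
namespace DirSphere

/-! ### Rotation invariance of the surface measure -/

variable {n : ℕ}

instance : IsFiniteMeasure (surfaceMeasure n) := by unfold surfaceMeasure; infer_instance

/-- The action of a linear isometry on the sphere. -/
def isometrySph (U : Amb n ≃ₗᵢ[ℝ] Amb n) (x : Sph n) : Sph n :=
  ⟨U x.1, by simp⟩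

theorem continuous_isometrySph (U : Amb n ≃ₗᵢ[ℝ] Amb n) : Continuous (isometrySph U) :=
  (U.continuous.comp continuous_subtype_val).subtype_mk _

-- The surface measure of a set is a multiple of the volume of the cone over it, and a linear
-- isometry carries cones to cones and preserves volume.
open scoped Pointwise in
theorem measurePreserving_isometrySph (U : Amb n ≃ₗᵢ[ℝ] Amb n) :
    MeasurePreserving (isometrySph U) (surfaceMeasure n) (surfaceMeasure n) := by
  have hm := (continuous_isometrySph U).measurable
  refine ⟨hm, Measure.ext fun s hs => ?_⟩
  rw [Measure.map_apply hm hs, surfaceMeasure, Measure.toSphere_apply' _ hs,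
    Measure.toSphere_apply' _ (hm hs)]
  congr 1
  have e : Set.Ioo (0 : ℝ) 1 • (Subtype.val '' (isometrySph U ⁻¹' s) : Set (Amb n)) =
      U ⁻¹' (Set.Ioo (0 : ℝ) 1 • (Subtype.val '' s : Set (Amb n))) := by
    ext v
    simp only [Set.mem_smul, Set.mem_preimage, Set.mem_image]
    constructor
    · rintro ⟨r, hr, _, ⟨x, hx, rfl⟩, rfl⟩
      exact ⟨r, hr, _, ⟨_, hx, rfl⟩, by simp [isometrySph]⟩
    · rintro ⟨r, hr, _, ⟨x, hx, rfl⟩, hv⟩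
      refine ⟨r, hr, U.symm x.1, ⟨isometrySph U.symm x, ?_, rfl⟩, ?_⟩
      · have : isometrySph U (isometrySph U.symm x) = x := Subtype.ext (by simp [isometrySph])
        rwa [this]
      · apply U.injective
        rw [map_smul, U.apply_symm_apply, hv]
  rw [e]
  exact U.measurePreserving.measure_preimage_equiv (f := U.toMeasurableEquiv) _

/-! ### Planar rotations -/

/-- The rotation by the angle `t` in the plane of the coordinates `i` and `j`. -/
def planarFun (i j : Fin (n + 1)) (t : ℝ) (x : Amb n) : Amb n :=
  WithLp.toLp 2 fun k =>
    if k = i then Real.cos t * x i - Real.sin t * x j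
    else if k = j then Real.sin t * x i + Real.cos t * x j else x k

theorem planarFun_apply (i j : Fin (n + 1)) (t : ℝ) (x : Amb n) (k : Fin (n + 1)) :
    planarFun i j t x k = if k = i then Real.cos t * x i - Real.sin t * x j
    else if k = j then Real.sin t * x i + Real.cos t * x j else x k := rfl

theorem norm_planarFun {i j : Fin (n + 1)} (hij : i ≠ j) (t : ℝ) (x : Amb n) :
    ‖planarFun i j t x‖ = ‖x‖ := by
  rw [EuclideanSpace.norm_eq, EuclideanSpace.norm_eq]
  congr 1
  simp only [Real.norm_eq_abs, sq_abs]
  have hj : j ∈ Finset.univ.erase i := by simp [hij.symm]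
  rw [← Finset.add_sum_erase _ _ (Finset.mem_univ i), ← Finset.add_sum_erase _ _ hj,
    ← Finset.add_sum_erase _ (fun k => x k ^ 2) (Finset.mem_univ i),
    ← Finset.add_sum_erase _ (fun k => x k ^ 2) hj]
  have hrest : ∑ k ∈ (Finset.univ.erase i).erase j, planarFun i j t x k ^ 2 =
      ∑ k ∈ (Finset.univ.erase i).erase j, x k ^ 2 := by
    refine Finset.sum_congr rfl fun k hk => ?_
    simp only [Finset.mem_erase, Finset.mem_univ, and_true] at hk
    rw [planarFun_apply, if_neg hk.2, if_neg hk.1]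
  rw [hrest, planarFun_apply, planarFun_apply, if_pos rfl, if_neg hij.symm, if_pos rfl]
  linear_combination (x i ^ 2 + x j ^ 2) * Real.sin_sq_add_cos_sq t

/-- A planar rotation as a linear isometry. -/
def planarIsometry {i j : Fin (n + 1)} (hij : i ≠ j) (t : ℝ) : Amb n ≃ₗᵢ[ℝ] Amb n :=
  LinearIsometry.toLinearIsometryEquiv
    { toFun := planarFun i j t
      map_add' := fun x y => by
        ext k
        simp only [planarFun_apply, PiLp.add_apply]
        split_ifs <;> ring
      map_smul' := fun c x => by
        ext k
        simp only [planarFun_apply, PiLp.smul_apply, smul_eq_mul, RingHom.id_apply]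
        split_ifs <;> ring
      norm_map' := norm_planarFun hij t } rfl

/-- A planar rotation of the sphere. -/
def planar {i j : Fin (n + 1)} (hij : i ≠ j) (t : ℝ) : Sph n → Sph n :=
  isometrySph (planarIsometry hij t)

theorem planar_apply {i j : Fin (n + 1)} (hij : i ≠ j) (t : ℝ) (x : Sph n) (k : Fin (n + 1)) :
    (planar hij t x).1 k = if k = i then Real.cos t * x.1 i - Real.sin t * x.1 j
    else if k = j then Real.sin t * x.1 i + Real.cos t * x.1 j else x.1 k := rfl

theorem continuous_planar {i j : Fin (n + 1)} (hij : i ≠ j) :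
    Continuous fun q : ℝ × Sph n => planar hij q.1 q.2 := by
  refine Continuous.subtype_mk ?_ _
  refine (PiLp.continuous_toLp 2 _).comp (continuous_pi fun k => ?_)
  have hc : ∀ k : Fin (n + 1), Continuous fun q : ℝ × Sph n => q.2.1 k := fun k => by fun_prop
  have h1 := hc i
  have h2 := hc j
  have h3 := hc k
  simp only
  split_ifs <;> fun_prop

theorem planar_two_pi {i j : Fin (n + 1)} (hij : i ≠ j) (x : Sph n) :
    planar hij (2 * Real.pi) x = planar hij 0 x := by
  ext k
  simp [planar_apply]

theorem planar_zero {i j : Fin (n + 1)} (hij : i ≠ j) (x : Sph n) : planar hij 0 x = x := by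
  ext k
  rw [planar_apply]
  split_ifs with h1 h2
  · subst h1; simp
  · subst h2; simp
  · rfl

theorem planar_add {i j : Fin (n + 1)} (hij : i ≠ j) (s t : ℝ) (x : Sph n) :
    planar hij s (planar hij t x) = planar hij (s + t) x := by
  ext k
  simp only [planar_apply, if_pos, if_neg hij.symm, Real.cos_add, Real.sin_add]
  split_ifs <;> ring

theorem rot_eq_planar (hn : 2 ≤ n) (h01 : (0 : Fin (n + 1)) ≠ 1) (t : ℝ) (x : Sph n) :
    rot hn t x = planar h01 t x := by
  obtain ⟨m, rfl⟩ : ∃ m, n = m + 1 := ⟨n - 1, by omega⟩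
  ext k
  rw [planar_apply]
  show (rotMatrix (m + 1) t).mulVec x.1 k = _
  have e0 : ∀ i : Fin m, (0 : Fin (m + 1 + 1)) ≠ i.succ.succ := fun i => (Fin.succ_ne_zero _).symm
  have e1 : ∀ i : Fin m, (1 : Fin (m + 1 + 1)) ≠ i.succ.succ := fun i h => by
    simpa using congrArg Fin.val h
  refine Fin.cases ?_ (fun k => Fin.cases ?_ (fun k => ?_) k) k
  · simp [Matrix.mulVec, dotProduct, rotMatrix, Fin.sum_univ_succ, e0]
    ring
  · simp [Matrix.mulVec, dotProduct, rotMatrix, Fin.sum_univ_succ, e1]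
  · rw [if_neg (e0 k).symm, if_neg (e1 k).symm]
    simp [Matrix.mulVec, dotProduct, rotMatrix]

/-! ### Integration by parts along rotations -/

/-- Integrate g' along the orbits over [0, 2π] × sphere. In one order of integration, invariance
gives 2π ∫ g'; in the other, the fundamental theorem of calculus gives 0 on almost every orbit,
because orbits close up. No continuity of g' is needed: an everywhere existing derivative that is
integrable along the orbit suffices. -/
theorem integral_deriv_planar {i j : Fin (n + 1)} (hij : i ≠ j) {g g' : Sph n → ℂ}
    (hg' : Integrable g' (surfaceMeasure n))
    (hd : ∀ x t, HasDerivAt (fun t => g (planar hij t x)) (g' (planar hij t x)) t) :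
    ∫ x, g' x ∂(surfaceMeasure n) = 0 := by
  set ν : Measure ℝ := volume.restrict (Set.uIoc 0 (2 * Real.pi))
  have hpi : (0 : ℝ) ≤ 2 * Real.pi := by positivity
  have : IsFiniteMeasure ν := by
    refine ⟨?_⟩
    simp only [ν, Measure.restrict_apply_univ, Set.uIoc_of_le hpi, Real.volume_Ioc]
    exact ENNReal.ofReal_lt_top
  have hmp : MeasurePreserving (fun q : ℝ × Sph n => (q.1, planar hij q.1 q.2))
      (ν.prod (surfaceMeasure n)) (ν.prod (surfaceMeasure n)) :=
    (MeasurePreserving.id ν).skew_product (continuous_planar hij).measurable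
      (Eventually.of_forall fun t => (measurePreserving_isometrySph _).map_eq)
  have hint : Integrable (fun q : ℝ × Sph n => g' (planar hij q.1 q.2))
      (ν.prod (surfaceMeasure n)) :=
    hmp.integrable_comp_of_integrable (g := fun q : ℝ × Sph n => g' q.2) (hg'.comp_snd ν)
  have h1 : ∫ q, g' (planar hij q.1 q.2) ∂(ν.prod (surfaceMeasure n)) =
      (2 * Real.pi) • ∫ x, g' x ∂(surfaceMeasure n) := by
    rw [integral_prod _ hint]
    have hinv : ∀ t, ∫ x, g' (planar hij t x) ∂(surfaceMeasure n) =
        ∫ x, g' x ∂(surfaceMeasure n) := by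
      intro t
      have hp : MeasurePreserving (planar hij t) (surfaceMeasure n) (surfaceMeasure n) :=
        measurePreserving_isometrySph (planarIsometry hij t)
      have ha : AEStronglyMeasurable g' (Measure.map (planar hij t) (surfaceMeasure n)) := by
        rw [hp.map_eq]; exact hg'.aestronglyMeasurable
      rw [← integral_map hp.measurable.aemeasurable ha, hp.map_eq]
    simp only [hinv]
    rw [integral_const]
    congr 1
    simp [ν, measureReal_def, hpi, Real.pi_pos.le]
  have h2 : ∫ q, g' (planar hij q.1 q.2) ∂(ν.prod (surfaceMeasure n)) = 0 := by
    rw [integral_prod_symm _ hint]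
    refine integral_eq_zero_of_ae ?_
    filter_upwards [hint.prod_left_ae] with x hx
    have hI : IntervalIntegrable (fun t => g' (planar hij t x)) volume 0 (2 * Real.pi) :=
      intervalIntegrable_iff.2 hx
    have := intervalIntegral.integral_eq_sub_of_hasDerivAt (fun t _ => hd x t) hI
    rw [intervalIntegral.integral_of_le hpi, ← Set.uIoc_of_le hpi, planar_two_pi, sub_self] at this
    exact this
  rw [h1] at h2
  exact (smul_eq_zero.1 h2).resolve_left (by positivity)

/-- Evaluation of a polynomial on the sphere. -/
def evalSph (p : MvPolynomial (Fin (n + 1)) ℝ) (x : Sph n) : ℝ := MvPolynomial.eval (fun k => x.1 k) p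

theorem continuous_evalSph (p : MvPolynomial (Fin (n + 1)) ℝ) : Continuous (evalSph p) := by
  have : Continuous fun x : Sph n => fun k => x.1 k :=
    continuous_pi fun k => by fun_prop
  exact (MvPolynomial.continuous_eval p).comp this

/-- The infinitesimal rotation in the plane of the coordinates `i` and `j`. -/
def rotD (i j : Fin (n + 1)) :
    Derivation ℝ (MvPolynomial (Fin (n + 1)) ℝ) (MvPolynomial (Fin (n + 1)) ℝ) :=
  (MvPolynomial.X i : MvPolynomial (Fin (n + 1)) ℝ) • MvPolynomial.pderiv j
    - (MvPolynomial.X j : MvPolynomial (Fin (n + 1)) ℝ) • MvPolynomial.pderiv i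

theorem rotD_apply (i j : Fin (n + 1)) (p : MvPolynomial (Fin (n + 1)) ℝ) :
    rotD i j p = MvPolynomial.X i * MvPolynomial.pderiv j p
      - MvPolynomial.X j * MvPolynomial.pderiv i p := rfl

theorem evalSph_rotD_X (i j k : Fin (n + 1)) (z : Sph n) :
    evalSph (rotD i j (MvPolynomial.X k)) z =
      (if k = j then z.1 i else 0) - (if k = i then z.1 j else 0) := by
  simp only [evalSph, rotD_apply, MvPolynomial.pderiv_X, map_sub, map_mul, MvPolynomial.eval_X,
    Pi.single_apply]
  split_ifs <;> simp

theorem hasDerivAt_evalSph_planar {i j : Fin (n + 1)} (hij : i ≠ j)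
    (p : MvPolynomial (Fin (n + 1)) ℝ) (x : Sph n) (t : ℝ) :
    HasDerivAt (fun t => evalSph p (planar hij t x)) (evalSph (rotD i j p) (planar hij t x)) t := by
  induction p using MvPolynomial.induction_on with
  | C a => simpa [evalSph, rotD_apply] using hasDerivAt_const t a
  | add p q hp hq =>
    simp only [evalSph, map_add] at *
    exact hp.add hq
  | mul_X p k hp =>
    have hX : HasDerivAt (fun t => (planar hij t x).1 k)
        (evalSph (rotD i j (MvPolynomial.X k)) (planar hij t x)) t := by
      rw [evalSph_rotD_X]
      have hc := Real.hasDerivAt_cos t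
      have hs := Real.hasDerivAt_sin t
      by_cases hki : k = i
      · subst hki
        simp only [planar_apply, if_true, if_neg hij, if_neg hij.symm]
        refine ((hc.mul_const (x.1 k)).sub (hs.mul_const (x.1 j))).congr_deriv ?_
        ring
      · by_cases hkj : k = j
        · subst hkj
          simp only [planar_apply, if_true, if_neg hki]
          refine ((hs.mul_const (x.1 i)).add (hc.mul_const (x.1 k))).congr_deriv ?_
          ring
        · simp only [planar_apply, if_neg hki, if_neg hkj]
          refine (hasDerivAt_const t (x.1 k)).congr_deriv ?_
          ring
    simp only [evalSph] at *
    simp only [Derivation.leibniz, smul_eq_mul, map_mul, map_add, MvPolynomial.eval_X]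
    refine (hp.mul hX).congr_deriv ?_
    ring

theorem integrable_evalSph_mul (p : MvPolynomial (Fin (n + 1)) ℝ) {h : Sph n → ℂ}
    (hh : Integrable h (surfaceMeasure n)) :
    Integrable (fun x => (evalSph p x : ℂ) * h x) (surfaceMeasure n) := by
  have hc : Continuous fun x : Sph n => (evalSph p x : ℂ) :=
    Complex.continuous_ofReal.comp (continuous_evalSph p)
  obtain ⟨C, hC⟩ := isCompact_univ.exists_bound_of_continuousOn hc.continuousOn
  exact hh.bdd_mul hc.aestronglyMeasurable (Eventually.of_forall fun x => hC x (Set.mem_univ x))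

theorem integral_rotD_mul {i j : Fin (n + 1)} (hij : i ≠ j) (p : MvPolynomial (Fin (n + 1)) ℝ)
    {h h' : Sph n → ℂ} (hh : Integrable h (surfaceMeasure n))
    (hh' : Integrable h' (surfaceMeasure n))
    (hd : ∀ x t, HasDerivAt (fun t => h (planar hij t x)) (h' (planar hij t x)) t) :
    ∫ x, (evalSph p x : ℂ) * h' x ∂(surfaceMeasure n) =
      -∫ x, (evalSph (rotD i j p) x : ℂ) * h x ∂(surfaceMeasure n) := by
  have h1 := integrable_evalSph_mul (rotD i j p) hh
  have h2 := integrable_evalSph_mul p hh'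
  have := integral_deriv_planar hij (g := fun x => (evalSph p x : ℂ) * h x) (h1.add h2)
    (fun x t => ((hasDerivAt_evalSph_planar hij p x t).ofReal_comp).mul (hd x t))
  simp only [Pi.add_apply] at this
  rw [integral_add h1 h2] at this
  linear_combination this

theorem integral_rotD_of_invariant {i j : Fin (n + 1)} (hij : i ≠ j)
    (p : MvPolynomial (Fin (n + 1)) ℝ) {h : Sph n → ℂ} (hh : Integrable h (surfaceMeasure n))
    (hinv : ∀ x t, h (planar hij t x) = h x) :
    ∫ x, (evalSph (rotD i j p) x : ℂ) * h x ∂(surfaceMeasure n) = 0 := by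
  have := integral_rotD_mul hij p (h' := fun _ => 0) hh (integrable_zero _ _ _)
    (fun x t => by simpa only [hinv] using hasDerivAt_const t (h x))
  simpa using this

theorem surfaceMeasure_real_univ : (surfaceMeasure n).real Set.univ = sphereArea n := by
  rw [surfaceMeasure, Measure.toSphere_real_apply_univ, measureReal_def,
    EuclideanSpace.volume_ball]
  have hn : (0 : ℝ) < ((n : ℝ) + 1) / 2 := by positivity
  simp only [finrank_euclideanSpace, Fintype.card_fin, ENNReal.ofReal_one, one_pow, one_mul,
    sphereArea]
  rw [ENNReal.toReal_ofReal (by positivity)]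
  push_cast
  rw [Real.Gamma_add_one hn.ne', Real.sqrt_eq_rpow, ← Real.rpow_natCast, ← Real.rpow_mul
    Real.pi_pos.le]
  have := (Real.Gamma_pos_of_pos hn).ne'
  rw [show 1 / 2 * ((n + 1 : ℕ) : ℝ) = ((n : ℝ) + 1) / 2 by push_cast; ring]
  field_simp

theorem sphereArea_pos : 0 < sphereArea n := by
  have : (0 : ℝ) < ((n : ℝ) + 1) / 2 := by positivity
  have := Real.Gamma_pos_of_pos this
  unfold sphereArea
  positivity

end DirSphere
end

noncomputable section
namespace DirSphere

open MvPolynomial (X pderiv)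

/-! ### Chebyshev polynomials under derivations -/

section Derivations

variable {A : Type*} [CommRing A] [Algebra ℝ A]

theorem derivation_cheb (D : Derivation ℝ A A) {y s : A} (hs : D s = 0) (k : ℕ) :
    D (cheb k y s) = (k : ℝ) • (geg 1 ((k : ℤ) - 1) y s * D y) := by
  rcases k with _ | k
  · simp [cheb_zero]
  · have h1 := geg_euler one_pos (k : ℤ) y s
    rw [cheb_succ, map_sub, Derivation.leibniz, Derivation.leibniz, derivation_geg D one_pos,
      derivation_geg D one_pos, hs]
    push_cast at *
    rw [show (k : ℤ) + 1 - 1 = k by ring, show (k : ℤ) - 1 - 1 = k - 2 by ring]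
    simp only [smul_eq_mul]
    simp only [Algebra.smul_def, map_mul, map_add, map_natCast, map_ofNat, map_one] at *
    linear_combination -h1 * D y

theorem cheb_ode (k : ℕ) (y s : A) :
    (2 * k : ℝ) • ((s - y ^ 2) * geg 2 ((k : ℤ) - 2) y s) - (k : ℝ) • (y * geg 1 ((k : ℤ) - 1) y s)
      + ((k : ℝ) * k) • cheb k y s = 0 := by
  rcases k with _ | k
  · simp
  · have h1 := geg_lower_deriv one_pos (k : ℤ) y s
    rw [cheb_succ]
    push_cast at *
    rw [show (k : ℤ) + 1 - 1 = k by ring, show (k : ℤ) + 1 - 2 = k - 1 by ring]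
    rw [show (1 : ℝ) + 1 = 2 by norm_num] at h1
    simp only [Algebra.smul_def, map_mul, map_add, map_sub, map_natCast, map_ofNat, map_one] at *
    linear_combination ((k : A) + 1) * h1

end Derivations

variable {n : ℕ}

/-! ### The angular polynomials -/

/-- The angular polynomial of degree `k` in `x_2` and `1 - x_1²`. -/
def angPoly (n k : ℕ) : MvPolynomial (Fin (n + 1)) ℝ :=
  if n = 2 then cheb k (X 1) (1 - X 0 ^ 2) else geg (((n : ℝ) - 2) / 2) (k : ℤ) (X 1) (1 - X 0 ^ 2)

/-- The raising coefficient in the recurrence for the angular polynomials. -/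
def angUp (n k : ℕ) : ℝ :=
  if n = 2 then (if k = 0 then 1 else 1 / 2) else (k + 1) / (2 * (k + ((n : ℝ) - 2) / 2))

/-- The lowering coefficient in the recurrence for the angular polynomials. -/
def angDown (n k : ℕ) : ℝ :=
  if n = 2 then 1 / 2 else (k + 2 * (((n : ℝ) - 2) / 2)) / (2 * (k + 1 + ((n : ℝ) - 2) / 2))

theorem zero_ne_one_fin (hn : 2 ≤ n) : (0 : Fin (n + 1)) ≠ 1 := by
  obtain ⟨m, rfl⟩ : ∃ m, n = m + 1 := ⟨n - 1, by omega⟩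
  exact Fin.zero_ne_one

theorem rotD_X_left {i j : Fin (n + 1)} (hij : i ≠ j) : rotD i j (X i) = -X j := by
  simp [rotD_apply, MvPolynomial.pderiv_X, Pi.single_eq_of_ne hij]

theorem rotD_X_right {i j : Fin (n + 1)} (hij : i ≠ j) : rotD i j (X j) = X i := by
  simp [rotD_apply, MvPolynomial.pderiv_X, Pi.single_eq_of_ne hij.symm]

theorem angularFamily_angPoly (hn : 2 ≤ n) :
    AngularFamily (rotD (n := n) 0 1) (X 0) (X 1) (((n : ℝ) - 2) / 2) (angPoly n)
      (angUp n) (angDown n) := by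
  have h01 := zero_ne_one_fin hn
  by_cases h2 : n = 2
  · subst h2
    have := angularFamily_cheb (rotD (n := 2) 0 1) (rotD_X_left h01) (rotD_X_right h01)
    have e : (((2 : ℕ) : ℝ) - 2) / 2 = 0 := by norm_num
    rw [e]
    convert this using 1
    · funext k; simp [angPoly]
    · funext k; simp [angUp]
    · funext k; simp [angDown]
  · have hμ : (0 : ℝ) < ((n : ℝ) - 2) / 2 := by
      have : (2 : ℝ) < n := by exact_mod_cast lt_of_le_of_ne hn (Ne.symm h2)
      linarith
    convert angularFamily_geg (rotD (n := n) 0 1) hμ (rotD_X_left h01) (rotD_X_right h01) using 1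
    · funext k; simp [angPoly, h2]
    · funext k; simp [angUp, h2]
    · funext k; simp [angDown, h2]

theorem pderiv_one_sub_sq {j : Fin (n + 1)} (hj : j ≠ 0) :
    pderiv j (1 - X 0 ^ 2 : MvPolynomial (Fin (n + 1)) ℝ) = 0 := by
  rw [map_sub, Derivation.leibniz_pow, Derivation.map_one_eq_zero, MvPolynomial.pderiv_X_of_ne hj.symm]
  simp

theorem pderiv_pderiv_angPoly (hn : 2 ≤ n) {j : Fin (n + 1)} (hj0 : j ≠ 0) (hj1 : j ≠ 1) (k : ℕ) :
    pderiv j (pderiv 1 (angPoly n k)) = 0 := by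
  have h01 := zero_ne_one_fin hn
  have hs := pderiv_one_sub_sq h01.symm
  have hsj := pderiv_one_sub_sq hj0
  have hy : pderiv j (X 1 : MvPolynomial (Fin (n + 1)) ℝ) = 0 :=
    MvPolynomial.pderiv_X_of_ne hj1.symm
  by_cases h2 : n = 2
  · rw [angPoly, if_pos h2, derivation_cheb _ hs, MvPolynomial.pderiv_X_self, mul_one,
      Derivation.map_smul, derivation_geg _ one_pos, hsj, hy]
    simp
  · have hμ : (0 : ℝ) < ((n : ℝ) - 2) / 2 := by
      have : (2 : ℝ) < n := by exact_mod_cast lt_of_le_of_ne hn (Ne.symm h2)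
      linarith
    rw [angPoly, if_neg h2, derivation_geg _ hμ, hs, MvPolynomial.pderiv_X_self, mul_one, mul_zero,
      smul_zero, sub_zero, Derivation.map_smul, derivation_geg _ (by linarith), hsj, hy]
    simp

/-- The eigenvalue equation in x_2 with x_1 held fixed. It is what makes the sum of rotational
derivatives in `pairing_zonal` a multiple of the angular polynomial. -/
theorem angPoly_ode (hn : 2 ≤ n) (k : ℕ) :
    (1 - X 0 ^ 2 - X 1 ^ 2) * pderiv 1 (pderiv 1 (angPoly n k))
      - ((n : ℝ) - 1) • (X 1 * pderiv 1 (angPoly n k))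
      + ((k : ℝ) * (k + n - 2)) • angPoly n k = 0 := by
  have h01 := zero_ne_one_fin hn
  have hs := pderiv_one_sub_sq h01.symm
  by_cases h2 : n = 2
  · have h := cheb_ode k (X 1) (1 - X 0 ^ 2 : MvPolynomial (Fin (n + 1)) ℝ)
    rw [angPoly, if_pos h2, derivation_cheb _ hs, MvPolynomial.pderiv_X_self, mul_one,
      Derivation.map_smul, derivation_geg _ one_pos, hs, MvPolynomial.pderiv_X_self]
    have e : (n : ℝ) = 2 := by exact_mod_cast h2
    rw [e, show (k : ℤ) - 1 - 1 = k - 2 by ring, show (1 : ℝ) + 1 = 2 by norm_num]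
    simp only [Algebra.smul_def, map_mul, map_add, map_sub, map_natCast, map_ofNat, map_one] at *
    linear_combination h
  · have hμ : (0 : ℝ) < ((n : ℝ) - 2) / 2 := by
      have : (2 : ℝ) < n := by exact_mod_cast lt_of_le_of_ne hn (Ne.symm h2)
      linarith
    have h := geg_ode hμ (k : ℤ) (X 1) (1 - X 0 ^ 2 : MvPolynomial (Fin (n + 1)) ℝ)
    rw [angPoly, if_neg h2, derivation_geg _ hμ, hs, MvPolynomial.pderiv_X_self, mul_one, mul_zero,
      smul_zero, sub_zero, Derivation.map_smul, derivation_geg _ (by linarith), hs,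
      MvPolynomial.pderiv_X_self]
    obtain ⟨μ, hn'⟩ : ∃ μ, ((n : ℝ) - 2) / 2 = μ := ⟨_, rfl⟩
    have hn'' : (n : ℝ) = 2 * μ + 2 := by rw [← hn']; ring
    rw [hn'] at h
    rw [hn', hn'', show (k : ℤ) - 1 - 1 = k - 2 by ring]
    simp only [Algebra.smul_def, map_mul, map_add, map_sub, map_natCast, map_ofNat, map_one,
      Int.cast_natCast] at *
    linear_combination h

/-! ### Integration functionals on polynomials -/

/-- Integration of polynomials on the sphere against an integrable function. -/
def pairing {h : Sph n → ℂ} (hh : Integrable h (surfaceMeasure n)) :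
    MvPolynomial (Fin (n + 1)) ℝ →ₗ[ℝ] ℂ where
  toFun p := ∫ x, (evalSph p x : ℂ) * h x ∂(surfaceMeasure n)
  map_add' p q := by
    rw [← integral_add (integrable_evalSph_mul p hh) (integrable_evalSph_mul q hh)]
    refine integral_congr_ae (Eventually.of_forall fun x => ?_)
    simp only [evalSph, map_add]
    push_cast
    ring
  map_smul' c p := by
    rw [← integral_smul]
    refine integral_congr_ae (Eventually.of_forall fun x => ?_)
    simp only [evalSph, MvPolynomial.smul_eval, RingHom.id_apply, Complex.real_smul]
    push_cast
    ring

theorem pairing_apply {h : Sph n → ℂ} (hh : Integrable h (surfaceMeasure n))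
    (p : MvPolynomial (Fin (n + 1)) ℝ) :
    pairing hh p = ∫ x, (evalSph p x : ℂ) * h x ∂(surfaceMeasure n) := rfl

theorem pairing_congr {h : Sph n → ℂ} (hh : Integrable h (surfaceMeasure n))
    {p q : MvPolynomial (Fin (n + 1)) ℝ} (hpq : ∀ x : Sph n, evalSph p x = evalSph q x) :
    pairing hh p = pairing hh q := by
  simp only [pairing_apply, hpq]

theorem sum_sq_sph (x : Sph n) : ∑ k, x.1 k ^ 2 = 1 := by
  have h := x.2
  rw [mem_sphere_zero_iff_norm] at h
  have := EuclideanSpace.norm_sq_eq x.1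
  rw [h] at this
  simpa using this.symm

theorem coord_one (x : Sph n) : coord x 1 = x.1 0 := rfl

theorem coord_two (x : Sph n) : coord x 2 = x.1 1 := rfl

/-- Rotations in the planes of x_2 and x_j, j ≥ 3, fix x_1 and hence F, so their infinitesimal
generators integrate to 0 against F. A suitable sum of such derivatives equals, on the sphere, a
nonzero multiple of p(x_1) H_{k+1}. -/
theorem pairing_zonal (hn : 2 ≤ n) {F : Sph n → ℂ} (hF : Integrable F (surfaceMeasure n))
    (hz : IsZonal F) (p : Polynomial ℝ) (k : ℕ) :
    pairing hF (Polynomial.aeval (X 0) p * angPoly n (k + 1)) = 0 := by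
  have h01 := zero_ne_one_fin hn
  set P : MvPolynomial (Fin (n + 1)) ℝ := Polynomial.aeval (X 0) p
  set S : Finset (Fin (n + 1)) := (Finset.univ.erase 0).erase 1
  have hS : ∀ j ∈ S, j ≠ 0 ∧ j ≠ 1 := fun j hj => by
    simp only [S, Finset.mem_erase, Finset.mem_univ, and_true] at hj
    exact ⟨hj.2, hj.1⟩
  have hcard : (S.card : ℝ) = n - 1 := by
    have h1 : (1 : Fin (n + 1)) ∈ Finset.univ.erase (0 : Fin (n + 1)) := by simp [h01.symm]
    rw [Finset.card_erase_of_mem h1, Finset.card_erase_of_mem (Finset.mem_univ _),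
      Finset.card_univ, Fintype.card_fin]
    rw [show n + 1 - 1 - 1 = n - 1 by omega, Nat.cast_sub (by omega), Nat.cast_one]
  have hP : ∀ j : Fin (n + 1), j ≠ 0 → pderiv j P = 0 := fun j hj => by
    rw [Derivation.map_aeval, MvPolynomial.pderiv_X_of_ne hj.symm, smul_zero]
  set H := angPoly n (k + 1)
  -- Rotating x_j w and summing over j gives (n-1) x_2 w - (Σ x_j²) ∂_2 w. With w = P ∂_2 H this is
  -- the first and second order part of the differential equation of H, up to sign.
  obtain ⟨w, hw⟩ : ∃ w, w = P * pderiv 1 H := ⟨_, rfl⟩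
  have hw1 : pderiv 1 w = P * pderiv 1 (pderiv 1 H) := by
    rw [hw, Derivation.leibniz, hP 1 h01.symm]; simp
  have hrot : ∀ j ∈ S, rotD 1 j (X j * w) = X 1 * w - X j ^ 2 * pderiv 1 w := by
    intro j hj
    obtain ⟨hj0, hj1⟩ := hS j hj
    have hwj : pderiv j w = 0 := by
      rw [hw, Derivation.leibniz, hP j hj0, pderiv_pderiv_angPoly hn hj0 hj1]; simp
    rw [rotD_apply, Derivation.leibniz, Derivation.leibniz, hwj, MvPolynomial.pderiv_X_self,
      MvPolynomial.pderiv_X_of_ne hj1]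
    simp only [smul_eq_mul]
    ring
  have hzero : ∀ j ∈ S, pairing hF (X 1 * w - X j ^ 2 * pderiv 1 w) = 0 := by
    intro j hj
    obtain ⟨hj0, hj1⟩ := hS j hj
    rw [← hrot j hj, pairing_apply]
    refine integral_rotD_of_invariant hj1.symm _ hF fun x t => hz _ _ ?_
    rw [coord_one, coord_one, planar_apply, if_neg h01, if_neg hj0.symm]
  have hsum := Finset.sum_eq_zero hzero
  rw [← map_sum, Finset.sum_sub_distrib, Finset.sum_const, ← Finset.sum_mul] at hsum
  have hsq : pairing hF ((∑ j ∈ S, X j ^ 2) * pderiv 1 w) =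
      pairing hF ((1 - X 0 ^ 2 - X 1 ^ 2) * pderiv 1 w) := by
    refine pairing_congr hF fun x => ?_
    simp only [evalSph, map_mul, map_sum, map_sub, map_pow, MvPolynomial.eval_X, map_one]
    congr 1
    have h1 : (1 : Fin (n + 1)) ∈ Finset.univ.erase (0 : Fin (n + 1)) := by simp [h01.symm]
    have := sum_sq_sph x
    rw [← Finset.add_sum_erase _ _ (Finset.mem_univ 0), ← Finset.add_sum_erase _ _ h1] at this
    linarith
  rw [map_sub, hsq, ← Nat.cast_smul_eq_nsmul ℝ, hcard, ← map_sub] at hsum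
  have hode := angPoly_ode hn (k + 1)
  have e : ((n : ℝ) - 1) • (X 1 * w) - (1 - X 0 ^ 2 - X 1 ^ 2) * pderiv 1 w =
      (((k + 1 : ℕ) : ℝ) * ((k + 1 : ℕ) + n - 2)) • (P * H) := by
    rw [hw1, hw]
    simp only [Algebra.smul_def] at *
    linear_combination -P * hode
  rw [e, map_smul] at hsum
  refine (smul_eq_zero.1 hsum).resolve_left ?_
  have : (2 : ℝ) ≤ n := by exact_mod_cast hn
  have hk : (0 : ℝ) ≤ k := Nat.cast_nonneg k
  push_cast
  have h1 : (0 : ℝ) < k + 1 := by positivity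
  have h2 : (0 : ℝ) < k + 1 + n - 2 := by linarith
  positivity

/-- The mean value of a polynomial on the sphere. -/
def mean (n : ℕ) : MvPolynomial (Fin (n + 1)) ℝ →ₗ[ℝ] ℝ where
  toFun p := (sphereArea n)⁻¹ * ∫ x, evalSph p x ∂(surfaceMeasure n)
  map_add' p q := by
    have hi : ∀ p : MvPolynomial (Fin (n + 1)) ℝ, Integrable (evalSph p) (surfaceMeasure n) :=
      fun p => (continuous_evalSph p).integrable_of_hasCompactSupport
        (HasCompactSupport.of_compactSpace _)
    rw [← mul_add, ← integral_add (hi p) (hi q)]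
    simp only [evalSph, map_add]
  map_smul' c p := by
    simp only [evalSph, MvPolynomial.smul_eval, RingHom.id_apply, integral_const_mul, smul_eq_mul]
    ring

theorem ofReal_mean (p : MvPolynomial (Fin (n + 1)) ℝ) :
    ((mean n p : ℝ) : ℂ) = (sphereArea n : ℂ)⁻¹ * pairing (integrable_const (1 : ℂ)) p := by
  rw [pairing_apply]
  simp only [mul_one]
  rw [integral_complex_ofReal]
  simp [mean]

theorem mean_one : mean n 1 = 1 := by
  have := (sphereArea_pos (n := n)).ne'
  simp [mean, evalSph, surfaceMeasure_real_univ, this]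

theorem mean_rotD {i j : Fin (n + 1)} (hij : i ≠ j) (p : MvPolynomial (Fin (n + 1)) ℝ) :
    mean n (rotD i j p) = 0 := by
  have h := ofReal_mean (rotD i j p)
  rw [pairing_apply, integral_rotD_of_invariant hij _ (integrable_const (1 : ℂ))
    (fun _ _ => rfl), mul_zero] at h
  exact_mod_cast h

theorem mean_angPoly (hn : 2 ≤ n) (p : Polynomial ℝ) (k : ℕ) :
    mean n (Polynomial.aeval (X 0) p * angPoly n (k + 1)) = 0 := by
  have h := ofReal_mean (n := n) (Polynomial.aeval (X 0) p * angPoly n (k + 1))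
  rw [pairing_zonal hn _ (fun _ _ _ => rfl), mul_zero] at h
  exact_mod_cast h

end DirSphere
end

noncomputable section
namespace DirSphere

/-! ### The normalization constants -/

/-- The factor with index `τ` in the square of the normalization constant. -/
def constFactor (n : ℕ) (k : ℕ → ℕ) (τ : ℕ) : ℝ :=
  (2 : ℝ) ^ ((n : ℤ) - τ + 2 * k τ - 2) * (k (τ - 1) - k τ)! * ((n : ℝ) - τ + 2 * k (τ - 1))
    * Real.Gamma (((n : ℝ) - τ) / 2 + k τ) ^ 2 / (√Real.pi * (n - τ + k (τ - 1) + k τ - 1)!)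

theorem constFactor_nonneg {n : ℕ} (k : ℕ → ℕ) {τ : ℕ} (hτ : τ ≤ n) : 0 ≤ constFactor n k τ := by
  have h : (0 : ℝ) ≤ (n : ℝ) - τ := sub_nonneg.2 (by exact_mod_cast hτ)
  unfold constFactor
  positivity

theorem constFactor_pos {n : ℕ} (k : ℕ → ℕ) {τ : ℕ} (hτ : τ < n) : 0 < constFactor n k τ := by
  have h : (0 : ℝ) < (n : ℝ) - τ := sub_pos.2 (by exact_mod_cast hτ)
  have h2 : 0 < Real.Gamma (((n : ℝ) - τ) / 2 + k τ) := Real.Gamma_pos_of_pos (by positivity)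
  unfold constFactor
  positivity

theorem harmonicConst_sq (n : ℕ) (k : ℕ → ℕ) :
    harmonicConst n k ^ 2 =
      1 / Real.Gamma (((n : ℝ) + 1) / 2) * ∏ τ ∈ Finset.Icc 1 (n - 1), constFactor n k τ := by
  have hG : 0 < Real.Gamma (((n : ℝ) + 1) / 2) := Real.Gamma_pos_of_pos (by positivity)
  have hP : 0 ≤ ∏ τ ∈ Finset.Icc 1 (n - 1), constFactor n k τ :=
    Finset.prod_nonneg fun τ hτ => constFactor_nonneg k (by
      have := Finset.mem_Icc.1 hτ; omega)
  exact Real.sq_sqrt (by positivity)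

/-- The normalization constant of the harmonic of degree `l` and order `k`. -/
def orderConst (n l k : ℕ) : ℝ := harmonicConst n (multiIndex l k)

theorem orderConst_pos (n l k : ℕ) : 0 < orderConst n l k := by
  have h : 0 ≤ orderConst n l k := Real.sqrt_nonneg _
  refine lt_of_le_of_ne h fun h0 => ?_
  have h2 := harmonicConst_sq n (multiIndex l k)
  rw [← orderConst, ← h0] at h2
  have hG : 0 < Real.Gamma (((n : ℝ) + 1) / 2) := Real.Gamma_pos_of_pos (by positivity)
  have hP : 0 < ∏ τ ∈ Finset.Icc 1 (n - 1), constFactor n (multiIndex l k) τ :=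
    Finset.prod_pos fun τ hτ => constFactor_pos _ (by
      have := Finset.mem_Icc.1 hτ; omega)
  have : 0 < 1 / Real.Gamma (((n : ℝ) + 1) / 2) *
    ∏ τ ∈ Finset.Icc 1 (n - 1), constFactor n (multiIndex l k) τ := by positivity
  rw [← h2] at this
  simp at this

/-- Legendre's duplication formula rewrites the factorial; the resulting quotients telescope in
`orderConst_zero_zero`. -/
theorem constFactor_zero {n τ : ℕ} (hτ : τ < n) :
    constFactor n (multiIndex 0 0) τ =
      Real.Gamma (((n - τ : ℕ) : ℝ) / 2 + 1) / Real.Gamma ((((n - τ : ℕ) : ℝ) + 1) / 2) := by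
  have hz : ∀ i, multiIndex 0 0 i = 0 := by
    intro i; rcases i with _ | _ | i <;> rfl
  obtain ⟨m, rfl⟩ : ∃ m, n = τ + m + 1 := ⟨n - τ - 1, by omega⟩
  simp only [constFactor, hz]
  have e1 : τ + m + 1 - τ = m + 1 := by omega
  have e2 : ((τ + m + 1 : ℕ) : ℝ) - τ = m + 1 := by push_cast; ring
  have e3 : ((τ + m + 1 : ℕ) : ℤ) - τ + 2 * ((0 : ℕ) : ℤ) - 2 = (m : ℤ) - 1 := by push_cast; ring
  rw [e1, e2, e3]
  have hs : (0 : ℝ) < ((m : ℝ) + 1) / 2 := by positivity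
  have hd := Real.Gamma_mul_Gamma_add_half (((m : ℝ) + 1) / 2)
  rw [show 2 * (((m : ℝ) + 1) / 2) = m + 1 by ring, Real.Gamma_nat_eq_factorial,
    show 1 - ((m : ℝ) + 1) = -(m : ℝ) by ring, Real.rpow_neg (by norm_num), Real.rpow_natCast] at hd
  have hg := Real.Gamma_pos_of_pos hs
  have hg2 : 0 < Real.Gamma (((m : ℝ) + 1) / 2 + 1 / 2) := Real.Gamma_pos_of_pos (by positivity)
  have hpi : 0 < √Real.pi := Real.sqrt_pos.2 Real.pi_pos
  push_cast
  rw [Real.Gamma_add_one hs.ne', show ((m : ℝ) + 1 + 1) / 2 = ((m : ℝ) + 1) / 2 + 1 / 2 by ring,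
    zpow_sub₀ two_ne_zero, zpow_natCast]
  have hf : (0 : ℝ) < (m ! : ℝ) := by positivity
  have hd2 : (2 : ℝ) ^ m * (Real.Gamma (((m : ℝ) + 1) / 2) *
      Real.Gamma (((m : ℝ) + 1) / 2 + 1 / 2)) = m ! * √Real.pi := by
    rw [hd]; field_simp
  rw [div_eq_div_iff (by positivity) hg2.ne']
  simp only [Nat.factorial_zero, Nat.cast_one, mul_one, mul_zero, add_zero, zpow_one]
  linear_combination (((m : ℝ) + 1) * Real.Gamma (((m : ℝ) + 1) / 2) / 2) * hd2

theorem orderConst_zero_zero {n : ℕ} (hn : 2 ≤ n) : orderConst n 0 0 ^ 2 = 1 := by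
  rw [orderConst, harmonicConst_sq]
  have hG : 0 < Real.Gamma (((n : ℝ) + 1) / 2) := Real.Gamma_pos_of_pos (by positivity)
  set G : ℕ → ℝ := fun m => Real.Gamma (((m : ℝ) + 2) / 2)
  have hGpos : ∀ m, G m ≠ 0 := fun m => (Real.Gamma_pos_of_pos (by positivity)).ne'
  have h1 : ∏ τ ∈ Finset.Icc 1 (n - 1), constFactor n (multiIndex 0 0) τ =
      ∏ m ∈ Finset.range (n - 1), G (m + 1) / G m := by
    refine Finset.prod_bij' (fun τ _ => n - 1 - τ) (fun m _ => n - 1 - m) ?_ ?_ ?_ ?_ ?_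
    · intro τ hτ
      simp only [Finset.mem_Icc, Finset.mem_range] at *
      omega
    · intro m hm
      simp only [Finset.mem_Icc, Finset.mem_range] at *
      omega
    · intro τ hτ
      simp only [Finset.mem_Icc] at hτ
      omega
    · intro m hm
      simp only [Finset.mem_range] at hm
      omega
    · intro τ hτ
      simp only [Finset.mem_Icc] at hτ
      rw [constFactor_zero (by omega)]
      obtain ⟨m, hm⟩ : ∃ m, n - τ = m + 1 := ⟨n - τ - 1, by omega⟩
      rw [show n - 1 - τ = m by omega, hm]
      simp only [G]
      push_cast
      congr 2 <;> ring
  have h2 : ∀ N, ∏ m ∈ Finset.range N, G (m + 1) / G m = G N / G 0 := by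
    intro N
    induction N with
    | zero => simp [div_self (hGpos 0)]
    | succ N ih =>
      rw [Finset.prod_range_succ, ih]
      have := hGpos N
      field_simp
  rw [h1, h2]
  have e1 : G (n - 1) = Real.Gamma (((n : ℝ) + 1) / 2) := by
    simp only [G]
    rw [Nat.cast_sub (by omega)]
    congr 1
    push_cast
    ring
  have e0 : G 0 = 1 := by simp [G]
  rw [e1, e0]
  field_simp

theorem constFactor_one_order {n l k : ℕ} (hn : 2 ≤ n) (hk : k < l) :
    constFactor n (multiIndex l (k + 1)) 1 * (((l : ℝ) - k) * (l + k + n - 1)) =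
      4 * (((n : ℝ) - 1) / 2 + k) ^ 2 * constFactor n (multiIndex l k) 1 := by
  obtain ⟨m, rfl⟩ : ∃ m, l = k + m + 1 := ⟨l - k - 1, by omega⟩
  obtain ⟨p, rfl⟩ : ∃ p, n = p + 2 := ⟨n - 2, by omega⟩
  simp only [constFactor, multiIndex]
  rw [show k + m + 1 - (k + 1) = m by omega, show k + m + 1 - k = m + 1 by omega,
    show p + 2 - 1 + (k + m + 1) + (k + 1) - 1 = (p + 2 * k + m + 1) + 1 by omega,
    show p + 2 - 1 + (k + m + 1) + k - 1 = p + 2 * k + m + 1 by omega,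
    show ((p + 2 : ℕ) : ℤ) - (1 : ℕ) + 2 * ((k + 1 : ℕ) : ℤ) - 2 =
      (((p + 2 : ℕ) : ℤ) - (1 : ℕ) + 2 * (k : ℤ) - 2) + 2 by push_cast; ring,
    zpow_add₀ two_ne_zero, Nat.factorial_succ (p + 2 * k + m + 1), Nat.factorial_succ m]
  have hg : ((((p + 2 : ℕ) : ℝ) - (1 : ℕ)) / 2 + ((k + 1 : ℕ) : ℝ)) =
    ((((p + 2 : ℕ) : ℝ) - (1 : ℕ)) / 2 + k) + 1 := by push_cast; ring
  have hpos : (0 : ℝ) < (((p + 2 : ℕ) : ℝ) - (1 : ℕ)) / 2 + k := by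
    push_cast
    have : (0 : ℝ) ≤ p := Nat.cast_nonneg p
    have : (0 : ℝ) ≤ k := Nat.cast_nonneg k
    linarith
  rw [hg, Real.Gamma_add_one hpos.ne']
  have hpi : √Real.pi ≠ 0 := (Real.sqrt_pos.2 Real.pi_pos).ne'
  have hf : ((p + 2 * k + m + 1)! : ℝ) ≠ 0 := by positivity
  have hf2 : (p : ℝ) + 2 * k + m + 1 + 1 ≠ 0 := by positivity
  push_cast
  field_simp
  ring

theorem constFactor_one_degree {n : ℕ} (hn : 2 ≤ n) (l : ℕ) :
    constFactor n (multiIndex (l + 1) 0) 1 * (((n : ℝ) - 1 + 2 * l) * (n - 1 + l)) =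
      (l + 1) * (n + 1 + 2 * l) * constFactor n (multiIndex l 0) 1 := by
  obtain ⟨p, rfl⟩ : ∃ p, n = p + 2 := ⟨n - 2, by omega⟩
  simp only [constFactor, multiIndex]
  rw [show p + 2 - 1 + (l + 1) + 0 - 1 = (p + l) + 1 by omega,
    show p + 2 - 1 + l + 0 - 1 = p + l by omega, Nat.sub_zero, Nat.sub_zero, Nat.factorial_succ,
    Nat.factorial_succ]
  have hpi : √Real.pi ≠ 0 := (Real.sqrt_pos.2 Real.pi_pos).ne'
  have hf : ((p + l)! : ℝ) ≠ 0 := by positivity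
  have hf2 : (p : ℝ) + l + 1 ≠ 0 := by positivity
  push_cast
  field_simp
  ring

theorem constFactor_two_order {n : ℕ} (hn : 3 ≤ n) (l k : ℕ) :
    constFactor n (multiIndex l (k + 1)) 2 * (((n : ℝ) - 2 + 2 * k) * (n - 2 + k)) =
      (k + 1) * (n + 2 * k) * constFactor n (multiIndex l k) 2 := by
  obtain ⟨p, rfl⟩ : ∃ p, n = p + 3 := ⟨n - 3, by omega⟩
  simp only [constFactor, multiIndex]
  rw [show p + 3 - 2 + (k + 1) + 0 - 1 = (p + k) + 1 by omega,
    show p + 3 - 2 + k + 0 - 1 = p + k by omega, Nat.sub_zero, Nat.sub_zero, Nat.factorial_succ,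
    Nat.factorial_succ]
  have hpi : √Real.pi ≠ 0 := (Real.sqrt_pos.2 Real.pi_pos).ne'
  have hf : ((p + k)! : ℝ) ≠ 0 := by positivity
  have hf2 : (p : ℝ) + k + 1 ≠ 0 := by positivity
  push_cast
  field_simp
  ring

theorem constFactor_high (n l k : ℕ) {τ : ℕ} (hτ : 3 ≤ τ) :
    constFactor n (multiIndex l k) τ = constFactor n (multiIndex 0 0) τ := by
  obtain ⟨p, rfl⟩ : ∃ p, τ = p + 3 := ⟨τ - 3, by omega⟩
  rfl

theorem orderConst_sq_two (l k : ℕ) : orderConst 2 l k ^ 2 =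
    1 / Real.Gamma (((2 : ℕ) + 1 : ℝ) / 2) * constFactor 2 (multiIndex l k) 1 := by
  rw [orderConst, harmonicConst_sq]
  simp

theorem orderConst_sq {n : ℕ} (hn : 3 ≤ n) (l k : ℕ) : orderConst n l k ^ 2 =
    1 / Real.Gamma (((n : ℝ) + 1) / 2) * (constFactor n (multiIndex l k) 1 *
      (constFactor n (multiIndex l k) 2 *
        ∏ τ ∈ Finset.Icc 3 (n - 1), constFactor n (multiIndex 0 0) τ)) := by
  rw [orderConst, harmonicConst_sq, ← Finset.insert_Icc_add_one_left_eq_Icc (by omega),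
    Finset.prod_insert (by simp), ← Finset.insert_Icc_add_one_left_eq_Icc (by omega),
    Finset.prod_insert (by simp)]
  congr 3
  exact Finset.prod_congr rfl fun τ hτ => constFactor_high n l k (by
    have := Finset.mem_Icc.1 hτ; omega)

/-- The number of harmonics that are merged into `symY`. -/
def symWeight (n k : ℕ) : ℝ := if n = 2 ∧ k ≠ 0 then 2 else 1

theorem symWeight_pos (n k : ℕ) : 0 < symWeight n k := by
  unfold symWeight; split_ifs <;> norm_num

/-- The coefficient of `Y_l^{k+1}` in the infinitesimal rotation of `Y_l^k`, up to sign. -/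
def ladderUp (n k : ℕ) : ℝ := 2 * (((n : ℝ) - 2) / 2 + 1 / 2 + k) * angUp n k

/-- The coefficient of `Y_l^k` in the infinitesimal rotation of `Y_l^{k+1}`. -/
def ladderDown (n l k : ℕ) : ℝ :=
  angDown n k * (l - k) * (l + k + 2 * (((n : ℝ) - 2) / 2 + 1 / 2)) /
    (2 * (((n : ℝ) - 2) / 2 + 1 / 2 + k))

/-- This is the norm ratio of `norm_ladder` seen from the constants. Only the factors τ = 1 and, for
n ≥ 3, τ = 2 depend on the order. -/
theorem orderConst_sq_order {n l k : ℕ} (hn : 2 ≤ n) (hk : k < l) :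
    orderConst n l (k + 1) ^ 2 * ladderDown n l k * symWeight n (k + 1) =
      orderConst n l k ^ 2 * ladderUp n k * symWeight n k := by
  have h1 := constFactor_one_order hn hk
  have hk0 : (0 : ℝ) ≤ k := Nat.cast_nonneg k
  rcases hn.eq_or_lt with rfl | hn
  · rw [orderConst_sq_two, orderConst_sq_two]
    simp only [ladderDown, ladderUp, angDown, angUp, symWeight]
    have h1' : constFactor 2 (multiIndex l (k + 1)) 1 * (((l : ℝ) - k) * (l + k + 1)) =
        4 * (2⁻¹ + (k : ℝ)) ^ 2 * constFactor 2 (multiIndex l k) 1 := by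
      push_cast at h1
      linear_combination h1
    -- For n = 2 both the weight and the raising coefficient change at k = 0; their product is 1 for
    -- every k.
    by_cases hk1 : k = 0
    · subst hk1
      simp at h1' ⊢
      linear_combination (Real.Gamma ((2 + 1) / 2))⁻¹ * h1'
    · simp [hk1]
      have hq : (0 : ℝ) < 2⁻¹ + k := by positivity
      generalize (2⁻¹ + (k : ℝ)) = q at *
      have e : (2⁻¹ * ((l : ℝ) - k) * (l + k + 1) / (2 * q)) =
        ((l : ℝ) - k) * (l + k + 1) / (4 * q) := by field_simp; ring
      rw [e, mul_assoc, ← mul_div_assoc, h1']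
      field_simp
  · have h2 := constFactor_two_order hn l k
    have hnr : (3 : ℝ) ≤ n := by exact_mod_cast hn
    rw [orderConst_sq hn, orderConst_sq hn]
    simp only [ladderDown, ladderUp, angDown, angUp, symWeight]
    have hne : n ≠ 2 := by omega
    simp only [hne, if_false, false_and, mul_one]
    set C := ∏ τ ∈ Finset.Icc 3 (n - 1), constFactor n (multiIndex 0 0) τ
    set T1 := constFactor n (multiIndex l k) 1
    set T1' := constFactor n (multiIndex l (k + 1)) 1
    set T2 := constFactor n (multiIndex l k) 2
    set T2' := constFactor n (multiIndex l (k + 1)) 2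
    have p1 : (0 : ℝ) < (n - 1) / 2 + k := by linarith
    have p2 : (0 : ℝ) < n + 2 * k := by linarith
    have p3 : (0 : ℝ) < n - 2 + 2 * k := by linarith
    have hG : 0 < Real.Gamma (((n : ℝ) + 1) / 2) := Real.Gamma_pos_of_pos (by positivity)
    have e1 : ((k : ℝ) + 2 * (((n : ℝ) - 2) / 2)) / (2 * (k + 1 + ((n : ℝ) - 2) / 2)) *
        ((l : ℝ) - k) * (l + k + 2 * (((n : ℝ) - 2) / 2 + 1 / 2)) /
        (2 * (((n : ℝ) - 2) / 2 + 1 / 2 + k)) =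
        (n - 2 + k) / (n + 2 * k) * ((l - k) * (l + k + n - 1)) / (2 * ((n - 1) / 2 + k)) := by
      congr 1
      · rw [show 2 * ((k : ℝ) + 1 + ((n : ℝ) - 2) / 2) = n + 2 * k by ring]; ring
      · ring
    have e2 : 2 * (((n : ℝ) - 2) / 2 + 1 / 2 + k) * (((k : ℝ) + 1) / (2 * (k + ((n : ℝ) - 2) / 2))) =
        2 * ((n - 1) / 2 + k) * ((k + 1) / (n - 2 + 2 * k)) := by
      congr 1
      · ring
      · congr 1; ring
    rw [e1, e2]
    generalize ((n : ℝ) - 1) / 2 + k = q at *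
    generalize ((l : ℝ) - k) * (l + k + n - 1) = L at *
    generalize (n : ℝ) - 2 + 2 * k = r at *
    generalize (n : ℝ) + 2 * k = t at *
    have key : T1' * T2' * L * (n - 2 + k) * r = T1 * T2 * (4 * q ^ 2) * (k + 1) * t := by
      linear_combination (T2' * ((n : ℝ) - 2 + k) * r) * h1 + (T1 * (4 * q ^ 2)) * h2
    field_simp
    linear_combination C * key

theorem orderConst_sq_degree {n : ℕ} (hn : 2 ≤ n) (l : ℕ) :
    orderConst n (l + 1) 0 ^ 2 * (((n : ℝ) - 1 + 2 * l) * (n - 1 + l)) =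
      (l + 1) * (n + 1 + 2 * l) * orderConst n l 0 ^ 2 := by
  have h1 := constFactor_one_degree hn l
  rcases hn.eq_or_lt with rfl | hn
  · rw [orderConst_sq_two, orderConst_sq_two]
    linear_combination (1 / Real.Gamma (((2 : ℕ) + 1 : ℝ) / 2)) * h1
  · rw [orderConst_sq hn, orderConst_sq hn]
    have e : constFactor n (multiIndex (l + 1) 0) 2 = constFactor n (multiIndex l 0) 2 := rfl
    rw [e]
    linear_combination (1 / Real.Gamma (((n : ℝ) + 1) / 2)) * constFactor n (multiIndex l 0) 2 *
      (∏ τ ∈ Finset.Icc 3 (n - 1), constFactor n (multiIndex 0 0) τ) * h1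

theorem beta_nonneg (n l k : ℕ) : 0 ≤ beta n l k := by
  unfold beta
  split_ifs <;> positivity

theorem beta_sq {n l k : ℕ} (hn : 2 ≤ n) (hk : k ≤ l) :
    beta n l k ^ 2 * symWeight n (k + 1) = ladderDown n l k * ladderUp n k * symWeight n k := by
  have hkl : (0 : ℝ) ≤ (l : ℝ) - k := sub_nonneg.2 (by exact_mod_cast hk)
  have hk0 : (0 : ℝ) ≤ k := Nat.cast_nonneg k
  rcases hn.eq_or_lt with rfl | hn
  · have hb : beta 2 l k ^ 2 = ((l : ℝ) - k) * (l + k + 1) / 4 := by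
      rw [beta, if_pos rfl, div_pow, Real.sq_sqrt (by positivity)]; norm_num
    rw [hb]
    simp only [ladderDown, ladderUp, angDown, angUp, symWeight]
    by_cases hk1 : k = 0
    · subst hk1; simp; ring
    · simp [hk1]
      have : (1 : ℝ) / 2 + k ≠ 0 := by positivity
      field_simp
      ring
  · have hnr : (3 : ℝ) ≤ n := by exact_mod_cast hn
    have hne : n ≠ 2 := by omega
    have p1 : (0 : ℝ) < n - 2 + k := by linarith
    have p2 : (0 : ℝ) < n - 1 + l + k := by
      have : (0 : ℝ) ≤ l := Nat.cast_nonneg l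
      linarith
    have p3 : (0 : ℝ) < n - 2 + 2 * k := by linarith
    have p4 : (0 : ℝ) < n + 2 * k := by linarith
    have p5 : (0 : ℝ) < (n - 1) / 2 + k := by linarith
    have hb : beta n l k ^ 2 = ((k : ℝ) + 1) * (n - 2 + k) * (l - k) * (n - 1 + l + k) /
        ((n - 2 + 2 * k) * (n + 2 * k)) := by
      rw [beta, if_neg hne]
      simp only
      rw [show 2 * (((n : ℝ) - 1) / 2) + k - 1 = n - 2 + k by ring,
        show 2 * (((n : ℝ) - 1) / 2) + l + k = n - 1 + l + k by ring,
        show 2 * (((n : ℝ) - 1) / 2) + 2 * k - 1 = n - 2 + 2 * k by ring,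
        show 2 * (((n : ℝ) - 1) / 2) + 2 * k + 1 = n + 2 * k by ring, Real.sq_sqrt (by positivity)]
    rw [hb]
    simp only [ladderDown, ladderUp, angDown, angUp, symWeight, hne, if_false, false_and, mul_one]
    rw [show ((n : ℝ) - 2) / 2 + 1 / 2 + k = (n - 1) / 2 + k by ring,
      show 2 * ((k : ℝ) + 1 + ((n : ℝ) - 2) / 2) = n + 2 * k by ring,
      show 2 * ((k : ℝ) + ((n : ℝ) - 2) / 2) = n - 2 + 2 * k by ring,
      show (k : ℝ) + 2 * (((n : ℝ) - 2) / 2) = n - 2 + k by ring,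
      show (l : ℝ) + k + 2 * (((n : ℝ) - 2) / 2 + 1 / 2) = n - 1 + l + k by ring]
    generalize ((n : ℝ) - 1) / 2 + k = q at *
    generalize (n : ℝ) - 2 + 2 * k = r at *
    generalize (n : ℝ) + 2 * k = t at *
    field_simp

theorem ladderUp_pos {n : ℕ} (hn : 2 ≤ n) (k : ℕ) : 0 < ladderUp n k := by
  have h := (angularFamily_angPoly hn).a_pos k
  have := (angularFamily_angPoly hn).param_nonneg
  unfold ladderUp
  positivity

theorem ladderDown_nonneg {n l k : ℕ} (hn : 2 ≤ n) (hk : k ≤ l) : 0 ≤ ladderDown n l k := by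
  have h := (angularFamily_angPoly hn).b_pos k
  have := (angularFamily_angPoly hn).param_nonneg
  have hkl : (0 : ℝ) ≤ (l : ℝ) - k := sub_nonneg.2 (by exact_mod_cast hk)
  unfold ladderDown
  positivity

/-- Both sides are nonnegative, so it suffices to compare squares, which `orderConst_sq_order` and
`beta_sq` identify. This and `orderConst_mul_ladderUp` are where β enters the recursion. -/
theorem orderConst_mul_ladderDown {n l k : ℕ} (hn : 2 ≤ n) (hk : k < l) :
    orderConst n l (k + 1) * ladderDown n l k = beta n l k * orderConst n l k := by
  have h1 := orderConst_sq_order hn hk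
  have h2 := beta_sq hn hk.le
  have hw := symWeight_pos n (k + 1)
  have a1 := orderConst_pos n l k
  have a2 := orderConst_pos n l (k + 1)
  have hu := ladderDown_nonneg hn hk.le
  have hb := beta_nonneg n l k
  refine (pow_left_inj₀ (by positivity) (by positivity) two_ne_zero).1 ?_
  refine mul_right_cancel₀ hw.ne' ?_
  linear_combination ladderDown n l k * h1 - orderConst n l k ^ 2 * h2

theorem orderConst_mul_ladderUp {n l k : ℕ} (hn : 2 ≤ n) (hk : k < l) :
    symWeight n k * (orderConst n l k * ladderUp n k) =
      symWeight n (k + 1) * (beta n l k * orderConst n l (k + 1)) := by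
  have h1 := orderConst_sq_order hn hk
  have h2 := beta_sq hn hk.le
  have hw := symWeight_pos n (k + 1)
  have hw' := symWeight_pos n k
  have a1 := orderConst_pos n l k
  have a2 := orderConst_pos n l (k + 1)
  have hv := ladderUp_pos hn k
  have hb := beta_nonneg n l k
  refine (pow_left_inj₀ (by positivity) (by positivity) two_ne_zero).1 ?_
  linear_combination -symWeight n k * ladderUp n k * h1
    - symWeight n (k + 1) * orderConst n l (k + 1) ^ 2 * h2

end DirSphere
end

noncomputable section
namespace DirSphere

open MvPolynomial (X)

/-! ### The harmonics as polynomials -/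

theorem geg_scale (ν : ℝ) (m : ℕ) (r t : ℝ) :
    geg ν (m : ℤ) (r * t) (r ^ 2) = r ^ m * gegenbauer ν m t := by
  rw [geg_eq_sum ν m _ _ (m / 2 + 1) (by omega), gegenbauer, Finset.mul_sum]
  refine Finset.sum_congr rfl fun j hj => ?_
  have hj2 : 2 * j ≤ m := by
    have := Finset.mem_range.1 hj
    omega
  obtain ⟨i, rfl⟩ : ∃ i, m = i + 2 * j := ⟨m - 2 * j, by omega⟩
  rw [show ((i + 2 * j : ℕ) : ℤ) - 2 * (j : ℤ) = (i : ℤ) by push_cast; ring, gegTerm_natCast,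
    Nat.add_sub_cancel, gegCoeff,
    show ν + ((i + 2 * j : ℕ) : ℝ) - j = ν + i + j by push_cast; ring, smul_eq_mul]
  ring

theorem gegenbauer_eq_geg (ν : ℝ) (m : ℕ) (t : ℝ) : gegenbauer ν m t = geg ν (m : ℤ) t 1 := by
  have := geg_scale ν m 1 t
  simpa using this.symm

theorem gegenbauer_zero {ν : ℝ} (hν : 0 < ν) (t : ℝ) : gegenbauer ν 0 t = 1 := by
  rw [gegenbauer_eq_geg]
  exact geg_zero hν t 1

theorem map_cheb {A B : Type*} [CommRing A] [Algebra ℝ A] [CommRing B] [Algebra ℝ B]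
    (g : A →ₐ[ℝ] B) (k : ℕ) (y s : A) : g (cheb k y s) = cheb k (g y) (g s) := by
  unfold cheb
  split_ifs
  · exact map_one g
  · simp only [map_sub, map_mul, map_geg]

/-- Both sides satisfy the recurrence whose characteristic roots are z and its conjugate. For n = 2
it identifies the sum of the orders k and -k with the angular polynomial. -/
theorem cheb_eq_pow (k : ℕ) (z : ℂ) :
    ((2 * cheb k z.re (Complex.normSq z) : ℝ) : ℂ) = z ^ k + (starRingEnd ℂ) z ^ k := by
  induction k using Nat.twoStepInduction with
  | zero => simp [cheb_zero]; norm_num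
  | one => simp [cheb_one, Complex.add_conj]
  | more k ih1 ih2 =>
    rw [cheb_add_two]
    have h1 : (2 * z.re : ℂ) = z + (starRingEnd ℂ) z := by rw [Complex.add_conj]; push_cast; ring
    have h2 := Complex.mul_conj z
    push_cast at *
    linear_combination (2 * z.re : ℂ) * ih2 - (Complex.normSq z : ℂ) * ih1
      + (z ^ (k + 1) + (starRingEnd ℂ) z ^ (k + 1)) * h1
      + (z ^ k + (starRingEnd ℂ) z ^ k) * h2

variable {n : ℕ}

/-- The unnormalized harmonic `Y_l^k` (for `n = 2` its symmetrization) as a polynomial. -/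
def solidPoly (n l k : ℕ) : MvPolynomial (Fin (n + 1)) ℝ :=
  solid (X 0) (((n : ℝ) - 2) / 2) (angPoly n) l k

theorem evalSph_eq_aeval (p : MvPolynomial (Fin (n + 1)) ℝ) (x : Sph n) :
    evalSph p x = MvPolynomial.aeval (fun k => x.1 k) p := by
  rw [MvPolynomial.aeval_eq_eval]; rfl

theorem evalSph_solidPoly {l k : ℕ} (hk : k ≤ l) (x : Sph n) :
    evalSph (solidPoly n l k) x =
      gegenbauer (((n : ℝ) - 1) / 2 + k) (l - k) (x.1 0) * evalSph (angPoly n k) x := by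
  simp only [evalSph_eq_aeval, solidPoly, solid, map_mul, map_geg, MvPolynomial.aeval_X, map_one,
    gegenbauer_eq_geg, Nat.cast_sub hk]
  congr 2
  ring

theorem evalSph_angPoly_two (k : ℕ) (x : Sph 2) :
    evalSph (angPoly 2 k) x = cheb k (x.1 1) (1 - x.1 0 ^ 2) := by
  rw [evalSph_eq_aeval, angPoly, if_pos rfl, map_cheb]
  simp

theorem evalSph_angPoly (hn : n ≠ 2) (k : ℕ) (x : Sph n) :
    evalSph (angPoly n k) x = geg (((n : ℝ) - 2) / 2) (k : ℤ) (x.1 1) (1 - x.1 0 ^ 2) := by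
  rw [evalSph_eq_aeval, angPoly, if_neg hn, map_geg]
  simp

theorem sum_coord_sq (x : Sph n) : ∑ i ∈ Finset.Icc 1 (n + 1), coord x i ^ 2 = 1 := by
  rw [← sum_sq_sph x, Finset.sum_fin_eq_sum_range]
  refine Finset.sum_bij' (fun i _ => i - 1) (fun i _ => i + 1) ?_ ?_ ?_ ?_ ?_
  · intro i hi
    simp only [Finset.mem_Icc, Finset.mem_range] at *
    omega
  · intro i hi
    simp only [Finset.mem_Icc, Finset.mem_range] at *
    omega
  · intro i hi
    simp only [Finset.mem_Icc] at hi
    omega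
  · intro i hi
    simp
  · intro i hi
    simp only [Finset.mem_Icc] at hi
    have e : Fin.ofNat (n + 1) (i - 1) = ⟨i - 1, by omega⟩ :=
      Fin.ext (Nat.mod_eq_of_lt (by omega))
    rw [dif_pos (by omega), coord, e]

theorem tailRadius_one (x : Sph n) : tailRadius x 1 = 1 := by
  rw [tailRadius, sum_coord_sq, Real.sqrt_one]

theorem sum_coord_sq_two (hn : 1 ≤ n) (x : Sph n) :
    ∑ i ∈ Finset.Icc 2 (n + 1), coord x i ^ 2 = 1 - x.1 0 ^ 2 := by
  have h := sum_coord_sq x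
  rw [← Finset.insert_Icc_add_one_left_eq_Icc (by omega), Finset.sum_insert (by simp),
    coord_one] at h
  exact eq_sub_of_add_eq' h

theorem tailRadius_two_sq (hn : 1 ≤ n) (x : Sph n) : tailRadius x 2 ^ 2 = 1 - x.1 0 ^ 2 := by
  rw [tailRadius, Real.sq_sqrt (Finset.sum_nonneg fun _ _ => sq_nonneg _), sum_coord_sq_two hn]

theorem cos_polarAngle_one (hn : 1 ≤ n) (x : Sph n) : Real.cos (polarAngle x 1) = x.1 0 := by
  have h := tailRadius_two_sq hn x
  have h2 : x.1 0 ^ 2 ≤ 1 := by nlinarith [sq_nonneg (tailRadius x 2)]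
  have h3 := abs_le.1 ((sq_le_one_iff_abs_le_one _).1 h2)
  rw [polarAngle, tailRadius_one, div_one, coord_one, Real.cos_arccos h3.1 h3.2]

theorem sin_polarAngle_one (hn : 1 ≤ n) (x : Sph n) :
    Real.sin (polarAngle x 1) = tailRadius x 2 := by
  rw [polarAngle, tailRadius_one, div_one, coord_one, Real.sin_arccos, ← tailRadius_two_sq hn,
    Real.sqrt_sq (show 0 ≤ tailRadius x 2 from Real.sqrt_nonneg _)]

theorem tailRadius_mul_cos (hn : 1 ≤ n) (x : Sph n) :
    tailRadius x 2 * Real.cos (polarAngle x 2) = x.1 1 := by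
  have h0 : 0 ≤ tailRadius x 2 := Real.sqrt_nonneg _
  have h1 : x.1 1 ^ 2 ≤ tailRadius x 2 ^ 2 := by
    rw [tailRadius_two_sq hn, ← sum_coord_sq_two hn, ← coord_two]
    exact Finset.single_le_sum (f := fun i => coord x i ^ 2) (fun i _ => sq_nonneg _)
      (Finset.mem_Icc.2 ⟨le_rfl, by omega⟩)
  have h2 := abs_le_of_sq_le_sq' h1 h0
  rw [polarAngle, coord_two]
  -- If the tail radius is 0, the angle is a junk value, but x_2 vanishes too.
  rcases h0.eq_or_lt with h | h
  · rw [← h] at h2 ⊢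
    rw [zero_mul]
    linarith [h2.1, h2.2]
  · rw [Real.cos_arccos, mul_div_cancel₀ _ h.ne']
    · rw [le_div_iff₀ h]; linarith [h2.1]
    · rw [div_le_one h]; exact h2.2

/-- The factors with τ ≥ 3 and the exponential equal 1. The power sin^k θ_1 is absorbed by
`geg_scale`, since r = sin θ_1 satisfies r cos θ_2 = x_2 and r² = 1 - x_1². -/
theorem Y_eq_evalSph (hn : 3 ≤ n) (l k : ℕ) (x : Sph n) :
    Y n l k 1 x = ((orderConst n l k * evalSph (solidPoly n l k) x : ℝ) : ℂ) := by
  rw [Y]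
  split_ifs with hk
  · have hprod : ∏ τ ∈ Finset.Icc 1 (n - 1),
        (gegenbauer (((n : ℝ) - τ) / 2 + multiIndex l k τ) (multiIndex l k (τ - 1) - multiIndex l k τ)
          (Real.cos (polarAngle x τ)) * Real.sin (polarAngle x τ) ^ multiIndex l k τ) =
        evalSph (solidPoly n l k) x := by
      rw [← Finset.insert_Icc_add_one_left_eq_Icc (by omega), Finset.prod_insert (by simp),
        ← Finset.insert_Icc_add_one_left_eq_Icc (by omega), Finset.prod_insert (by simp)]
      rw [Finset.prod_eq_one (s := Finset.Icc (1 + 1 + 1) (n - 1)), evalSph_solidPoly hk,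
        evalSph_angPoly (by omega), ← tailRadius_two_sq (by omega), ← tailRadius_mul_cos (by omega),
        geg_scale, ← cos_polarAngle_one (by omega), ← sin_polarAngle_one (by omega)]
      · simp only [multiIndex]
        push_cast
        norm_num
        ring
      · intro τ hτ
        obtain ⟨p, rfl⟩ : ∃ p, τ = p + 3 := ⟨τ - 3, by
          have := Finset.mem_Icc.1 hτ; omega⟩
        have hp := (Finset.mem_Icc.1 hτ).2
        have hnp : ((p + 3 : ℕ) : ℝ) + 1 ≤ n := by exact_mod_cast (show p + 3 + 1 ≤ n by omega)
        simp only [multiIndex]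
        rw [show p + 3 - 1 = p + 2 by omega]
        simp only
        rw [Nat.sub_self, gegenbauer_zero (by push_cast at *; linarith)]
        simp
    have hlast : multiIndex l k (n - 1) = 0 := by
      obtain ⟨p, rfl⟩ : ∃ p, n = p + 3 := ⟨n - 3, by omega⟩
      rfl
    rw [harmonic, hlast, ← Complex.ofReal_prod, hprod]
    simp [orderConst]
  · rw [solidPoly, solid_of_lt _ _ _ (by omega)]
    simp [evalSph]

theorem normSq_tail (x : Sph 2) :
    Complex.normSq ⟨x.1 1, x.1 2⟩ = 1 - x.1 0 ^ 2 := by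
  have := sum_sq_sph x
  rw [Fin.sum_univ_three] at this
  rw [Complex.normSq_mk]
  linarith

theorem tailRadius_mul_exp (x : Sph 2) :
    (tailRadius x 2 : ℂ) * Complex.exp (azimuth x * Complex.I) = ⟨x.1 1, x.1 2⟩ := by
  have h : tailRadius x 2 = ‖(⟨x.1 1, x.1 2⟩ : ℂ)‖ := by
    refine (pow_left_inj₀ (show 0 ≤ tailRadius x 2 from Real.sqrt_nonneg _) (norm_nonneg _)
      two_ne_zero).1 ?_
    rw [tailRadius_two_sq (by norm_num), ← Complex.normSq_eq_norm_sq, normSq_tail]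
  rw [h]
  exact Complex.norm_mul_exp_arg_mul_I _

theorem Y_two {l k : ℕ} (hk : k ≤ l) (x : Sph 2) :
    Y 2 l k 1 x = ((orderConst 2 l k * gegenbauer (((2 : ℕ) - 1 : ℝ) / 2 + k) (l - k) (x.1 0) : ℝ) : ℂ)
      * (⟨x.1 1, x.1 2⟩ : ℂ) ^ k := by
  rw [Y, if_pos hk, harmonic, ← tailRadius_mul_exp, mul_pow, ← Complex.exp_nat_mul]
  simp only [show 2 - 1 = 1 from rfl, Finset.Icc_self, Finset.prod_singleton, multiIndex,
    Nat.sub_self, cos_polarAngle_one (show 1 ≤ 2 by norm_num),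
    sin_polarAngle_one (show 1 ≤ 2 by norm_num)]
  rw [show Complex.I * ((1 : ℤ) : ℂ) * (k : ℂ) * (azimuth x : ℂ) =
    (k : ℂ) * ((azimuth x : ℂ) * Complex.I) by push_cast; ring]
  simp only [orderConst]
  push_cast
  ring

theorem Y_two_neg (l k : ℕ) (x : Sph 2) : Y 2 l k (-1) x = (starRingEnd ℂ) (Y 2 l k 1 x) := by
  simp only [Y, harmonic]
  split_ifs
  · rw [map_mul, map_mul, ← Complex.exp_conj, ← Complex.ofReal_prod, Complex.conj_ofReal,
      Complex.conj_ofReal]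
    congr 2
    simp
  · simp

theorem Y_two_add_conj (l k : ℕ) (x : Sph 2) :
    Y 2 l k 1 x + (starRingEnd ℂ) (Y 2 l k 1 x) =
      ((2 * orderConst 2 l k * evalSph (solidPoly 2 l k) x : ℝ) : ℂ) := by
  by_cases hk : k ≤ l
  · rw [Y_two hk, evalSph_solidPoly hk, evalSph_angPoly_two, map_mul, Complex.conj_ofReal, map_pow,
      ← mul_add, ← cheb_eq_pow, normSq_tail]
    push_cast
    ring
  · rw [Y, if_neg hk, solidPoly, solid_of_lt _ _ _ (by omega)]
    simp [evalSph]

theorem symY_eq (hn : 2 ≤ n) (l k : ℕ) (x : Sph n) :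
    symY n l k x = ((symWeight n k * orderConst n l k * evalSph (solidPoly n l k) x : ℝ) : ℂ) := by
  rw [symY, symWeight]
  rcases hn.eq_or_lt with rfl | hn
  · split_ifs with h
    · rw [Y_two_neg, Y_two_add_conj]
    · have hk : k = 0 := by simpa using h
      subst hk
      have h1 := Y_two_add_conj l 0 x
      have h2 : (starRingEnd ℂ) (Y 2 l 0 1 x) = Y 2 l 0 1 x := by
        rw [Y_two (Nat.zero_le l)]; simp
      rw [h2] at h1
      push_cast at *
      linear_combination h1 / 2
  · rw [if_neg (by omega), if_neg (by omega), Y_eq_evalSph hn, one_mul]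

/-! ### Fourier coefficients -/

/-- A function on the sphere that depends only on the first two coordinates. -/
def IsBizonal (g : Sph n → ℂ) : Prop :=
  ∀ x y : Sph n, x.1 0 = y.1 0 → x.1 1 = y.1 1 → g x = g y

/-- The reflection `x_3 ↦ -x_3` of `ℝ³`. -/
def flipLast : Amb 2 ≃ₗᵢ[ℝ] Amb 2 :=
  LinearIsometryEquiv.piLpCongrRight 2 fun i : Fin 3 =>
    if i = 2 then LinearIsometryEquiv.neg ℝ else LinearIsometryEquiv.refl ℝ ℝ

theorem isometrySph_flipLast (x : Sph 2) (i : Fin 3) :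
    (isometrySph flipLast x).1 i = if i = 2 then -x.1 i else x.1 i := by
  show (flipLast x.1) i = _
  simp only [flipLast, LinearIsometryEquiv.piLpCongrRight_apply]
  split_ifs <;> simp

theorem Y_two_flipLast (l k : ℕ) (x : Sph 2) :
    Y 2 l k 1 (isometrySph flipLast x) = (starRingEnd ℂ) (Y 2 l k 1 x) := by
  by_cases hk : k ≤ l
  · rw [Y_two hk, Y_two hk, isometrySph_flipLast, isometrySph_flipLast, isometrySph_flipLast,
      if_neg (by decide), if_neg (by decide), if_pos rfl, map_mul, map_pow, Complex.conj_ofReal]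
    rfl
  · rw [Y, if_neg hk, Y, if_neg hk, map_zero]

theorem continuous_Y_two (l k : ℕ) : Continuous (Y 2 l k 1) := by
  by_cases hk : k ≤ l
  · have e : Y 2 l k 1 = fun x : Sph 2 =>
        ((orderConst 2 l k * gegenbauer (((2 : ℕ) - 1 : ℝ) / 2 + k) (l - k) (x.1 0) : ℝ) : ℂ)
          * ((x.1 1 : ℂ) + (x.1 2 : ℂ) * Complex.I) ^ k := by
      funext x
      rw [Y_two hk, Complex.mk_eq_add_mul_I]
    rw [e]
    unfold gegenbauer
    have h0 : Continuous fun x : Sph 2 => x.1 0 := by fun_prop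
    have h1 : Continuous fun x : Sph 2 => x.1 1 := by fun_prop
    have h2 : Continuous fun x : Sph 2 => x.1 2 := by fun_prop
    fun_prop
  · have e : Y 2 l k 1 = fun _ : Sph 2 => (0 : ℂ) := by
      funext x
      rw [Y, if_neg hk]
    rw [e]
    exact continuous_const

/-- For n = 2 the reflection x_3 ↦ -x_3 fixes g and conjugates Y_l^k, so the conjugate may be
replaced by the average of Y_l^k and its conjugate, which is a polynomial in x_1, x_2. The average
cancels the weight 2, hence no `symWeight` here. -/
theorem sphCoeff_eq (hn : 2 ≤ n) {g : Sph n → ℂ} (hg : Integrable g (surfaceMeasure n))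
    (hb : IsBizonal g) (l k : ℕ) :
    sphCoeff n l k g = (orderConst n l k / sphereArea n : ℝ) * pairing hg (solidPoly n l k) := by
  have key : ∫ x, (starRingEnd ℂ) (Y n l k 1 x) * g x ∂(surfaceMeasure n) =
      (orderConst n l k : ℂ) * pairing hg (solidPoly n l k) := by
    rw [pairing_apply, ← integral_const_mul]
    rcases hn.eq_or_lt with rfl | hn
    · have hc := continuous_Y_two l k
      have hc' : Continuous fun x => (starRingEnd ℂ) (Y 2 l k 1 x) :=
        Complex.continuous_conj.comp hc
      have hint : ∀ {u : Sph 2 → ℂ}, Continuous u →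
          Integrable (fun x => u x * g x) (surfaceMeasure 2) := by
        intro u hu
        obtain ⟨C, hC⟩ := isCompact_univ.exists_bound_of_continuousOn hu.continuousOn
        exact hg.bdd_mul hu.aestronglyMeasurable
          (Eventually.of_forall fun x => hC x (Set.mem_univ x))
      have hp := measurePreserving_isometrySph flipLast
      have hflip : ∫ x, (starRingEnd ℂ) (Y 2 l k 1 x) * g x ∂(surfaceMeasure 2) =
          ∫ x, Y 2 l k 1 x * g x ∂(surfaceMeasure 2) := by
        have ha : AEStronglyMeasurable (fun x => Y 2 l k 1 x * g x)
            (Measure.map (isometrySph flipLast) (surfaceMeasure 2)) := by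
          rw [hp.map_eq]; exact (hint hc).aestronglyMeasurable
        have h1 := integral_map hp.measurable.aemeasurable ha
        rw [hp.map_eq] at h1
        rw [h1]
        refine integral_congr_ae (Eventually.of_forall fun x => ?_)
        simp only [Y_two_flipLast]
        congr 1
        refine hb _ _ ?_ ?_
        · rw [isometrySph_flipLast, if_neg (by decide)]
        · rw [isometrySph_flipLast, if_neg (by decide)]
      have hadd := integral_add (hint hc) (hint hc')
      rw [hflip, ← two_mul] at hadd
      rw [hflip]
      have h2 : ∫ x, Y 2 l k 1 x * g x ∂(surfaceMeasure 2) =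
          (1 / 2 : ℂ) * ∫ x, (Y 2 l k 1 x * g x + (starRingEnd ℂ) (Y 2 l k 1 x) * g x)
            ∂(surfaceMeasure 2) := by
        rw [hadd]; ring
      rw [h2, ← integral_const_mul]
      refine integral_congr_ae (Eventually.of_forall fun x => ?_)
      simp only
      rw [← add_mul, Y_two_add_conj]
      push_cast
      ring
    · refine integral_congr_ae (Eventually.of_forall fun x => ?_)
      simp only
      rw [Y_eq_evalSph hn, Complex.conj_ofReal]
      push_cast
      ring
  rw [sphCoeff, key]
  push_cast
  ring

/-- Induction along the ladder: `norm_ladder` climbs in the order k, `norm_degree` climbs in the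
degree l at k = 0, and the constant polynomial starts both. In each step the ratio of norms cancels
the ratio of squared constants. -/
theorem norm_solidPoly (hn : 2 ≤ n) {l k : ℕ} (hk : k ≤ l) :
    symWeight n k * orderConst n l k ^ 2 * mean n (solidPoly n l k * solidPoly n l k) = 1 := by
  have hA := angularFamily_angPoly hn
  have h01 := zero_ne_one_fin hn
  induction k with
  | zero =>
    clear hk
    induction l with
    | zero =>
      rw [orderConst_zero_zero hn]
      have : solidPoly n 0 0 = 1 := by
        have := hA.param_nonneg
        rw [solidPoly, solid, hA.H_zero, mul_one]
        exact geg_zero (by positivity) _ _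
      simp [this, symWeight, mean_one]
    | succ l ih =>
      have h1 := hA.norm_degree (mean n) (mean_rotD h01) (mean_angPoly hn) l
      have h2 := orderConst_sq_degree hn l
      have hnr : (2 : ℝ) ≤ n := by exact_mod_cast hn
      have hpos : (0 : ℝ) < (l + 1) * (l + 1 + (((n : ℝ) - 2) / 2 + 1 / 2)) := by
        have : (0 : ℝ) < ((n : ℝ) - 2) / 2 + 1 / 2 := by linarith
        positivity
      simp only [pow_two (solid _ _ _ _ _)] at h1
      rw [← solidPoly, ← solidPoly] at h1
      have w0 : symWeight n 0 = 1 := by simp [symWeight]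
      rw [w0, one_mul] at ih ⊢
      refine mul_left_cancel₀ hpos.ne' ?_
      linear_combination orderConst n (l + 1) 0 ^ 2 * h1
        + mean n (solidPoly n l 0 * solidPoly n l 0) / 2 * h2
        + ((l + 1) * (l + 1 + (((n : ℝ) - 2) / 2 + 1 / 2))) * ih
  | succ k ih =>
    have h1 := hA.norm_ladder (mean n) (mean_rotD h01) (mean_angPoly hn) l l k
    have h2 := orderConst_sq_order hn (show k < l by omega)
    rw [← solidPoly, ← solidPoly] at h1
    have hv := ladderUp_pos hn k
    have ih := ih (by omega)
    refine mul_left_cancel₀ hv.ne' ?_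
    rw [← ladderUp, ← ladderDown] at h1
    linear_combination symWeight n (k + 1) * orderConst n l (k + 1) ^ 2 * h1
      + mean n (solidPoly n l k * solidPoly n l k) * h2 + ladderUp n k * ih

theorem solidPoly_orthogonal (hn : 2 ≤ n) {l m j k : ℕ} (h : (l, j) ≠ (m, k)) :
    mean n (solidPoly n l j * solidPoly n m k) = 0 := by
  have hA := angularFamily_angPoly hn
  have h01 := zero_ne_one_fin hn
  by_cases hjk : j = k
  · subst hjk
    exact hA.solid_orthogonal_degree (mean n) (mean_rotD h01) (mean_angPoly hn)
      (fun hl => h (by rw [hl])) j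
  · exact hA.solid_orthogonal_order (mean n) (mean_angPoly hn) l m hjk

end DirSphere
end

noncomputable section
namespace DirSphere

open MvPolynomial (X)

variable {n : ℕ}

/-! ### Density of polynomials among the functions of the first two coordinates -/

/-- The vector `(a, b, √(1 - a² - b²), 0, …, 0)`. -/
def liftVec (n : ℕ) (q : ℝ × ℝ) : Amb n :=
  WithLp.toLp 2 fun k => if (k : ℕ) = 0 then q.1 else if (k : ℕ) = 1 then q.2
    else if (k : ℕ) = 2 then √(1 - q.1 ^ 2 - q.2 ^ 2) else 0

theorem continuous_liftVec : Continuous (liftVec n) := by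
  refine (PiLp.continuous_toLp 2 _).comp (continuous_pi fun k => ?_)
  split_ifs <;> fun_prop

theorem norm_liftVec_sq (hn : 2 ≤ n) (q : ℝ × ℝ) :
    ‖liftVec n q‖ ^ 2 = q.1 ^ 2 + q.2 ^ 2 + √(1 - q.1 ^ 2 - q.2 ^ 2) ^ 2 := by
  obtain ⟨m, rfl⟩ : ∃ m, n = m + 2 := ⟨n - 2, by omega⟩
  rw [EuclideanSpace.norm_sq_eq, Fin.sum_univ_succ, Fin.sum_univ_succ, Fin.sum_univ_succ]
  have h2 : (2 : ℕ) % (m + 2 + 1) = 2 := Nat.mod_eq_of_lt (by omega)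
  have h3 : (2 : Fin (m + 2 + 1)) ≠ 0 := fun h => by simpa [h2] using congrArg Fin.val h
  simp [liftVec, h2, h3]
  ring

theorem liftVec_ne_zero (hn : 2 ≤ n) (q : ℝ × ℝ) : ‖liftVec n q‖ ≠ 0 := by
  intro h
  have h2 := norm_liftVec_sq hn q
  rw [h] at h2
  have h3 := Real.sqrt_nonneg (1 - q.1 ^ 2 - q.2 ^ 2)
  have h4 : √(1 - q.1 ^ 2 - q.2 ^ 2) = 0 := by nlinarith [sq_nonneg q.1, sq_nonneg q.2]
  rw [Real.sqrt_eq_zero'] at h4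
  nlinarith [sq_nonneg (√(1 - q.1 ^ 2 - q.2 ^ 2))]

/-- A continuous section of the projection of the sphere to the first two coordinates. -/
def liftSph (hn : 2 ≤ n) (q : ℝ × ℝ) : Sph n :=
  ⟨‖liftVec n q‖⁻¹ • liftVec n q, by
    rw [mem_sphere_zero_iff_norm, norm_smul, norm_inv, norm_norm,
      inv_mul_cancel₀ (liftVec_ne_zero hn q)]⟩

theorem continuous_liftSph (hn : 2 ≤ n) : Continuous (liftSph hn) :=
  ((continuous_liftVec.norm.inv₀ (liftVec_ne_zero hn)).smul continuous_liftVec).subtype_mk _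

/-- The projection of the sphere to the first two coordinates. -/
def projSph (x : Sph n) : ℝ × ℝ := (x.1 0, x.1 1)

theorem continuous_projSph : Continuous (projSph (n := n)) := by
  unfold projSph
  fun_prop

theorem comp_liftSph_projSph (hn : 2 ≤ n) {g : Sph n → ℂ} (hb : IsBizonal g) (x : Sph n) :
    g (liftSph hn (projSph x)) = g x := by
  have hle : 0 ≤ 1 - x.1 0 ^ 2 - x.1 1 ^ 2 := by
    have h := sum_sq_sph x
    have h01 := zero_ne_one_fin hn
    have h2 : ∑ k ∈ ({0, 1} : Finset (Fin (n + 1))), x.1 k ^ 2 ≤ ∑ k, x.1 k ^ 2 :=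
      Finset.sum_le_sum_of_subset_of_nonneg (Finset.subset_univ _) fun _ _ _ => sq_nonneg _
    rw [Finset.sum_pair h01, h] at h2
    linarith
  have hnorm : ‖liftVec n (projSph x)‖ = 1 := by
    have h := norm_liftVec_sq hn (projSph x)
    simp only [projSph] at h ⊢
    rw [Real.sq_sqrt hle] at h
    nlinarith [norm_nonneg (liftVec n (x.1 0, x.1 1))]
  have hval : (liftSph hn (projSph x)).1 = liftVec n (projSph x) := by
    simp [liftSph, hnorm]
  have h01 := zero_ne_one_fin hn
  refine hb _ _ ?_ ?_
  · rw [hval]; simp [liftVec, projSph]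
  · rw [hval]
    have h1 : ((1 : Fin (n + 1)) : ℕ) = 1 := by
      obtain ⟨m, rfl⟩ : ∃ m, n = m + 1 := ⟨n - 1, by omega⟩
      rfl
    simp only [liftVec, projSph, h1]
    simp

theorem exists_adjoin_near (b : ℝ × ℝ → ℝ) (hb : Continuous b) {δ : ℝ} (hδ : 0 < δ) :
    ∃ u ∈ Algebra.adjoin ℝ ({X 0, X 1} : Set (MvPolynomial (Fin (n + 1)) ℝ)),
      ∀ x : Sph n, ‖evalSph u x - b (projSph x)‖ < δ := by
  set A : Subalgebra ℝ C(ℝ × ℝ, ℝ) :=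
    Algebra.adjoin ℝ {ContinuousMap.fst, ContinuousMap.snd}
  have hA : A.SeparatesPoints := by
    intro p q hpq
    by_cases h : p.1 = q.1
    · have h2 : p.2 ≠ q.2 := fun h2 => hpq (Prod.ext h h2)
      exact ⟨_, ⟨ContinuousMap.snd, Algebra.subset_adjoin (by simp), rfl⟩, h2⟩
    · exact ⟨_, ⟨ContinuousMap.fst, Algebra.subset_adjoin (by simp), rfl⟩, h⟩
  have hK : IsCompact (Set.range (projSph (n := n))) := isCompact_range continuous_projSph
  obtain ⟨a, ha, hab⟩ :=
    ContinuousMap.exists_mem_subalgebra_near_continuous_of_isCompact_of_separatesPoints hA ⟨b, hb⟩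
      hK hδ
  have hpoly : ∃ u ∈ Algebra.adjoin ℝ ({X 0, X 1} : Set (MvPolynomial (Fin (n + 1)) ℝ)),
      ∀ x : Sph n, evalSph u x = a (projSph x) := by
    clear hab
    induction ha using Algebra.adjoin_induction with
    | mem r hr =>
      rcases hr with rfl | hr
      · exact ⟨X 0, Algebra.subset_adjoin (by simp), fun x => by simp [evalSph, projSph]⟩
      · rw [Set.mem_singleton_iff.1 hr]
        exact ⟨X 1, Algebra.subset_adjoin (by simp), fun x => by simp [evalSph, projSph]⟩
    | algebraMap c =>
      exact ⟨algebraMap ℝ _ c, Subalgebra.algebraMap_mem _ c, fun x => by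
        simp [evalSph, MvPolynomial.algebraMap_eq]⟩
    | add p q _ _ hp hq =>
      obtain ⟨u, hu, hu'⟩ := hp
      obtain ⟨v, hv, hv'⟩ := hq
      refine ⟨u + v, add_mem hu hv, fun x => ?_⟩
      rw [ContinuousMap.add_apply, ← hu', ← hv']
      simp [evalSph]
    | mul p q _ _ hp hq =>
      obtain ⟨u, hu, hu'⟩ := hp
      obtain ⟨v, hv, hv'⟩ := hq
      refine ⟨u * v, mul_mem hu hv, fun x => ?_⟩
      rw [ContinuousMap.mul_apply, ← hu', ← hv']
      simp [evalSph]
  obtain ⟨u, hu, hu'⟩ := hpoly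
  refine ⟨u, hu, fun x => ?_⟩
  rw [hu']
  exact hab _ ⟨x, rfl⟩

-- A continuous section of the projection to (x_1, x_2) turns g into a function on the plane, square
-- integrable for the image measure. It is approximated there by a bounded continuous function, and
-- that one uniformly on the compact image of the sphere by Stone–Weierstrass.
open scoped ENNReal in
theorem exists_poly_near (hn : 2 ≤ n) {g : Sph n → ℂ} (hm : Measurable g) (hb : IsBizonal g)
    (hg : MemLp g 2 (surfaceMeasure n)) {ε : ℝ≥0∞} (hε : ε ≠ 0) :
    ∃ u ∈ Algebra.adjoin ℝ ({X 0, X 1} : Set (MvPolynomial (Fin (n + 1)) ℝ)),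
    ∃ v ∈ Algebra.adjoin ℝ ({X 0, X 1} : Set (MvPolynomial (Fin (n + 1)) ℝ)),
      eLpNorm (fun x => g x - ((evalSph u x : ℂ) + Complex.I * (evalSph v x : ℂ))) 2
        (surfaceMeasure n) ≤ ε := by
  set G : ℝ × ℝ → ℂ := fun q => g (liftSph hn q)
  have hGm : Measurable G := hm.comp (continuous_liftSph hn).measurable
  have hGg : G ∘ projSph = g := funext fun x => comp_liftSph_projSph hn hb x
  set ν : Measure (ℝ × ℝ) := Measure.map projSph (surfaceMeasure n)
  have hpm := (continuous_projSph (n := n)).measurable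
  have : IsFiniteMeasure ν := Measure.isFiniteMeasure_map _ _
  have hGL : MemLp G 2 ν := by
    rw [memLp_map_measure_iff hGm.aestronglyMeasurable hpm.aemeasurable, hGg]
    exact hg
  have hε2 : ε / 2 ≠ 0 := by simpa using hε
  obtain ⟨b, hb1, hb2⟩ := hGL.exists_boundedContinuous_eLpNorm_sub_le (by norm_num) hε2
  -- Real and imaginary parts are approximated separately, each within δ, hence the bound 2δ.
  obtain ⟨δ, hδ, hδε⟩ : ∃ δ : ℝ, 0 < δ ∧
      (surfaceMeasure n) Set.univ ^ (2 : ℝ≥0∞).toReal⁻¹ * ENNReal.ofReal (2 * δ) ≤ ε / 2 := by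
    have hM : (surfaceMeasure n) Set.univ ^ (2 : ℝ≥0∞).toReal⁻¹ ≠ ∞ :=
      ENNReal.rpow_ne_top_of_nonneg (by positivity) (measure_ne_top _ _)
    have ht : Tendsto (fun δ : ℝ => (surfaceMeasure n) Set.univ ^ (2 : ℝ≥0∞).toReal⁻¹ *
        ENNReal.ofReal (2 * δ)) (𝓝[>] 0) (𝓝 0) := by
      have h1 : Tendsto (fun δ : ℝ => ENNReal.ofReal (2 * δ)) (𝓝 0) (𝓝 (ENNReal.ofReal (2 * 0))) :=
        (ENNReal.continuous_ofReal.comp (continuous_const.mul continuous_id)).tendsto 0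
      have h2 := ENNReal.Tendsto.const_mul (h1.mono_left (nhdsWithin_le_nhds (s := Set.Ioi 0)))
        (Or.inr hM)
      simpa using h2
    have hev := ht.eventually (Iio_mem_nhds (pos_iff_ne_zero.2 hε2))
    obtain ⟨δ, h1, h2⟩ := (hev.and self_mem_nhdsWithin).exists
    exact ⟨δ, h2, le_of_lt h1⟩
  obtain ⟨u, hu, hu'⟩ := exists_adjoin_near (n := n) (fun q => (b q).re)
    (Complex.continuous_re.comp b.continuous) hδ
  obtain ⟨v, hv, hv'⟩ := exists_adjoin_near (n := n) (fun q => (b q).im)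
    (Complex.continuous_im.comp b.continuous) hδ
  refine ⟨u, hu, v, hv, ?_⟩
  have hP : Continuous fun x : Sph n => ((evalSph u x : ℂ) + Complex.I * (evalSph v x : ℂ)) := by
    have h1 := continuous_evalSph u
    have h2 := continuous_evalSph v
    fun_prop
  have hbp : Continuous fun x : Sph n => b (projSph x) := b.continuous.comp continuous_projSph
  have e : (fun x => g x - ((evalSph u x : ℂ) + Complex.I * (evalSph v x : ℂ))) =
      (fun x => g x - b (projSph x)) +
        fun x => b (projSph x) - ((evalSph u x : ℂ) + Complex.I * (evalSph v x : ℂ)) := by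
    funext x
    simp
  rw [e]
  refine (eLpNorm_add_le (hg.1.sub hbp.aestronglyMeasurable) (hbp.sub hP).aestronglyMeasurable
    (by norm_num)).trans ?_
  rw [← ENNReal.add_halves ε]
  refine add_le_add ?_ ?_
  · rw [eLpNorm_map_measure (hGm.aestronglyMeasurable.sub hb2.1) hpm.aemeasurable] at hb1
    have e3 : (g - fun x => b (projSph x)) = (G - ⇑b) ∘ projSph := by
      funext x
      simp [G, comp_liftSph_projSph hn hb]
    rw [e3]
    exact hb1
  · refine (eLpNorm_le_of_ae_bound (C := 2 * δ) (Eventually.of_forall fun x => ?_)).trans hδε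
    have e2 : b (projSph x) - ((evalSph u x : ℂ) + Complex.I * (evalSph v x : ℂ)) =
        -(((evalSph u x - (b (projSph x)).re : ℝ) : ℂ) +
          Complex.I * ((evalSph v x - (b (projSph x)).im : ℝ) : ℂ)) := by
      have := Complex.re_add_im (b (projSph x))
      push_cast
      linear_combination -this
    rw [Pi.sub_apply, e2, norm_neg]
    refine (norm_add_le _ _).trans ?_
    rw [norm_mul, Complex.norm_I, one_mul, Complex.norm_real, Complex.norm_real]
    linarith [hu' x, hv' x]

/-! ### Orthogonal expansions -/

/-- Each partial sum is the best approximation from the span of its vectors, by Pythagoras, and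
these spans exhaust a subspace whose closure contains g. Zero vectors are allowed, as is needed for
orders above the degree; their terms contribute nothing. -/
theorem tendsto_orthogonal_expansion {E : Type*} [NormedAddCommGroup E] [InnerProductSpace ℂ E]
    {ι : Type*} (v : ι → E) (hv : Pairwise fun i j => inner ℂ (v i) (v j) = 0)
    (s : ℕ → Finset ι) (hs : Monotone s) (hcov : ∀ i, ∃ N, i ∈ s N) (g : E)
    (hg : g ∈ closure (Submodule.span ℂ (Set.range v) : Set E)) :
    Tendsto (fun N => ‖g - ∑ i ∈ s N, (inner ℂ (v i) g / (‖v i‖ ^ 2 : ℂ)) • v i‖) atTop (𝓝 0) := by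
  have hbest : ∀ (t : Finset ι) (w : E), w ∈ Submodule.span ℂ (v '' t) →
      ‖g - ∑ i ∈ t, (inner ℂ (v i) g / (‖v i‖ ^ 2 : ℂ)) • v i‖ ≤ ‖g - w‖ := by
    intro t w hw
    set S := ∑ i ∈ t, (inner ℂ (v i) g / (‖v i‖ ^ 2 : ℂ)) • v i
    have horth : ∀ z ∈ Submodule.span ℂ (v '' t), inner ℂ z (g - S) = 0 := by
      intro z hz
      induction hz using Submodule.span_induction with
      | mem z hz =>
        obtain ⟨i, hi, rfl⟩ := hz
        rw [inner_sub_right, inner_sum, Finset.sum_eq_single_of_mem i hi, inner_smul_right,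
          inner_self_eq_norm_sq_to_K]
        · by_cases h0 : v i = 0
          · simp [h0]
          · have h1 : ((‖v i‖ : ℂ)) ^ 2 ≠ 0 := by simpa using h0
            exact sub_eq_zero.2 (div_mul_cancel₀ _ h1).symm
        · intro j _ hj
          rw [inner_smul_right, hv hj.symm, mul_zero]
      | zero => simp
      | add x y _ _ hx hy => rw [inner_add_left, hx, hy, add_zero]
      | smul c x _ hx => rw [inner_smul_left, hx, mul_zero]
    have hS : S ∈ Submodule.span ℂ (v '' t) :=
      Submodule.sum_mem _ fun i hi => Submodule.smul_mem _ _
        (Submodule.subset_span ⟨i, hi, rfl⟩)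
    have hpy := norm_add_sq_eq_norm_sq_add_norm_sq_of_inner_eq_zero (𝕜 := ℂ) (S - w) (g - S)
      (horth _ (Submodule.sub_mem _ hS hw))
    rw [show S - w + (g - S) = g - w by abel] at hpy
    exact abs_le_of_sq_le_sq' (by nlinarith [norm_nonneg (S - w)]) (norm_nonneg _) |>.2
  have hfin : ∀ w ∈ Submodule.span ℂ (Set.range v), ∃ N, w ∈ Submodule.span ℂ (v '' (s N)) := by
    intro w hw
    have hmono : ∀ {N M}, N ≤ M → Submodule.span ℂ (v '' (s N)) ≤ Submodule.span ℂ (v '' (s M)) :=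
      fun h => Submodule.span_mono (Set.image_mono (by exact_mod_cast hs h))
    induction hw using Submodule.span_induction with
    | mem z hz =>
      obtain ⟨i, rfl⟩ := hz
      obtain ⟨N, hN⟩ := hcov i
      exact ⟨N, Submodule.subset_span ⟨i, hN, rfl⟩⟩
    | zero => exact ⟨0, Submodule.zero_mem _⟩
    | add x y _ _ hx hy =>
      obtain ⟨N, hN⟩ := hx
      obtain ⟨M, hM⟩ := hy
      exact ⟨max N M, Submodule.add_mem _ (hmono (le_max_left _ _) hN)
        (hmono (le_max_right _ _) hM)⟩
    | smul c x _ hx =>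
      obtain ⟨N, hN⟩ := hx
      exact ⟨N, Submodule.smul_mem _ _ hN⟩
  rw [Metric.tendsto_atTop]
  intro ε hε
  obtain ⟨w, hw, hgw⟩ := Metric.mem_closure_iff.1 hg ε hε
  obtain ⟨N, hN⟩ := hfin w hw
  refine ⟨N, fun M hM => ?_⟩
  have h1 := hbest (s M) w
    (Submodule.span_mono (Set.image_mono (by exact_mod_cast hs hM)) hN)
  rw [dist_eq_norm] at hgw
  rw [Real.dist_0_eq_abs, abs_of_nonneg (norm_nonneg _)]
  exact h1.trans_lt hgw

/-- A polynomial as an element of `L²(S^n)`. -/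
theorem memLp_evalSph (p : MvPolynomial (Fin (n + 1)) ℝ) :
    MemLp (fun x => (evalSph p x : ℂ)) 2 (surfaceMeasure n) := by
  have hc : Continuous fun x : Sph n => (evalSph p x : ℂ) :=
    Complex.continuous_ofReal.comp (continuous_evalSph p)
  obtain ⟨C, hC⟩ := isCompact_univ.exists_bound_of_continuousOn hc.continuousOn
  exact MemLp.of_bound hc.aestronglyMeasurable C (Eventually.of_forall fun x => hC x (Set.mem_univ x))

/-- Polynomials as elements of `L²(S^n)`. -/
def polyLp (n : ℕ) : MvPolynomial (Fin (n + 1)) ℝ →ₗ[ℝ] Lp ℂ 2 (surfaceMeasure n) where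
  toFun p := (memLp_evalSph p).toLp _
  map_add' p q := by
    rw [← MemLp.toLp_add]
    congr 1
    funext x
    simp [evalSph]
  map_smul' c p := by
    rw [RingHom.id_apply, ← MemLp.toLp_const_smul]
    congr 1
    funext x
    simp [evalSph]

theorem mem_closure_span (hn : 2 ≤ n) {g : Sph n → ℂ} (hm : Measurable g) (hb : IsBizonal g)
    (hg : MemLp g 2 (surfaceMeasure n)) :
    hg.toLp g ∈ closure (Submodule.span ℂ (Set.range fun q : ℕ × ℕ =>
      polyLp n (solidPoly n q.1 q.2)) : Set (Lp ℂ 2 (surfaceMeasure n))) := by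
  set W := Submodule.span ℂ (Set.range fun q : ℕ × ℕ => polyLp n (solidPoly n q.1 q.2))
  have hpoly : ∀ u ∈ Algebra.adjoin ℝ ({X 0, X 1} : Set (MvPolynomial (Fin (n + 1)) ℝ)),
      polyLp n u ∈ W := by
    intro u hu
    have h := (angularFamily_angPoly hn).adjoin_le_span hu
    clear hu
    induction h using Submodule.span_induction with
    | mem z hz =>
      obtain ⟨q, rfl⟩ := hz
      exact Submodule.subset_span ⟨q, rfl⟩
    | zero => rw [map_zero]; exact W.zero_mem
    | add x y _ _ hx hy => rw [map_add]; exact W.add_mem hx hy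
    | smul c x _ hx =>
      rw [map_smul]
      have e : c • polyLp n x = (c : ℂ) • polyLp n x := by
        rw [← algebraMap_smul ℂ c (polyLp n x)]
        rfl
      rw [e]
      exact W.smul_mem _ hx
  rw [Metric.mem_closure_iff]
  intro ε hε
  obtain ⟨u, hu, v, hv, h⟩ := exists_poly_near hn hm hb hg (ε := ENNReal.ofReal (ε / 2))
    (by simpa using hε)
  refine ⟨polyLp n u + Complex.I • polyLp n v,
    W.add_mem (hpoly u hu) (W.smul_mem _ (hpoly v hv)), ?_⟩
  have e : polyLp n u + Complex.I • polyLp n v =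
      ((memLp_evalSph u).add ((memLp_evalSph v).const_smul Complex.I)).toLp _ := rfl
  rw [e, ← ENNReal.ofReal_lt_ofReal_iff hε, ← edist_dist, Lp.edist_toLp_toLp]
  exact lt_of_le_of_lt h ((ENNReal.ofReal_lt_ofReal_iff hε).2 (half_lt_self hε))

end DirSphere
end

noncomputable section
namespace DirSphere

variable {n : ℕ}

/-! ### The expansion of functions of the first two coordinates -/

theorem inner_polyLp (p : MvPolynomial (Fin (n + 1)) ℝ) {g : Sph n → ℂ}
    (hg : MemLp g 2 (surfaceMeasure n)) (hi : Integrable g (surfaceMeasure n)) :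
    inner ℂ (polyLp n p) (hg.toLp g) = pairing hi p := by
  rw [L2.inner_def, pairing_apply]
  refine integral_congr_ae ?_
  filter_upwards [(memLp_evalSph p).coeFn_toLp, hg.coeFn_toLp] with x h1 h2
  show inner ℂ (((memLp_evalSph p).toLp _ : Sph n → ℂ) x) _ = _
  rw [h1, h2, RCLike.inner_apply, mul_comm]
  simp

theorem inner_polyLp_polyLp (p q : MvPolynomial (Fin (n + 1)) ℝ) :
    inner ℂ (polyLp n p) (polyLp n q) = ((sphereArea n * mean n (p * q) : ℝ) : ℂ) := by
  have h := inner_polyLp p (memLp_evalSph q) ((memLp_evalSph q).integrable (by norm_num))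
  refine h.trans ?_
  have : (sphereArea n : ℂ) ≠ 0 := Complex.ofReal_ne_zero.2 (sphereArea_pos (n := n)).ne'
  rw [pairing_apply, Complex.ofReal_mul, ofReal_mean, ← mul_assoc, mul_inv_cancel₀ this, one_mul,
    pairing_apply]
  simp [evalSph]

theorem norm_polyLp_sq (p : MvPolynomial (Fin (n + 1)) ℝ) :
    (‖polyLp n p‖ ^ 2 : ℂ) = ((sphereArea n * mean n (p * p) : ℝ) : ℂ) := by
  rw [← inner_polyLp_polyLp, inner_self_eq_norm_sq_to_K]
  rfl

theorem solidPoly_of_lt {l k : ℕ} (h : l < k) : solidPoly n l k = 0 := solid_of_lt _ _ _ h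

/-- The identity is stated with the vector attached because for k > l the vector is 0; otherwise the
coefficients agree by `norm_solidPoly`. -/
theorem fourier_smul_polyLp (hn : 2 ≤ n) {g : Sph n → ℂ} (hb : IsBizonal g)
    (hg : MemLp g 2 (surfaceMeasure n)) (l k : ℕ) :
    (inner ℂ (polyLp n (solidPoly n l k)) (hg.toLp g) / (‖polyLp n (solidPoly n l k)‖ ^ 2 : ℂ)) •
        polyLp n (solidPoly n l k) =
      (sphCoeff n l k g * ((symWeight n k * orderConst n l k : ℝ) : ℂ)) •
        polyLp n (solidPoly n l k) := by
  rcases lt_or_ge l k with h | hk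
  · rw [solidPoly_of_lt h, map_zero, smul_zero, smul_zero]
  · congr 1
    have hi := hg.integrable (by norm_num)
    rw [inner_polyLp _ hg hi, norm_polyLp_sq, sphCoeff_eq hn hi hb]
    have h1 := norm_solidPoly hn hk
    have h2 := (sphereArea_pos (n := n)).ne'
    have h3 : mean n (solidPoly n l k * solidPoly n l k) ≠ 0 := fun h => by simp [h] at h1
    rw [div_eq_iff (by exact_mod_cast mul_ne_zero h2 h3)]
    have h4 : orderConst n l k / sphereArea n * (symWeight n k * orderConst n l k) *
        (sphereArea n * mean n (solidPoly n l k * solidPoly n l k)) = 1 := by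
      rw [← h1]
      field_simp
    have h5 := congrArg (fun r : ℝ => (r : ℂ)) h4
    push_cast at h5 ⊢
    linear_combination -pairing hi (solidPoly n l k) * h5

theorem sum_smul_polyLp {ι : Type*} (s : Finset ι) (c : ι → ℂ)
    (p : ι → MvPolynomial (Fin (n + 1)) ℝ) :
    ∃ h : MemLp (fun x => ∑ i ∈ s, c i * (evalSph (p i) x : ℂ)) 2 (surfaceMeasure n),
      ∑ i ∈ s, c i • polyLp n (p i) = h.toLp _ := by
  classical
  induction s using Finset.induction_on with
  | empty => exact ⟨by simp, by simp⟩
  | insert a s ha ih =>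
    obtain ⟨h, e⟩ := ih
    simp only [Finset.sum_insert ha]
    refine ⟨((memLp_evalSph (p a)).const_smul (c a)).add h, ?_⟩
    rw [e]
    rfl

theorem sum_eq_sum_parity {E : Type*} [AddCommMonoid E] (F : ℕ → E) {d M : ℕ} (hM : d < M)
    (hF : ∀ k, ¬(k ≤ d ∧ k % 2 = d % 2) → F k = 0) :
    ∑ k ∈ Finset.range M, F k = ∑ j ∈ Finset.range (d / 2 + 1), F (2 * j + d % 2) := by
  symm
  refine Finset.sum_of_injOn (fun j => 2 * j + d % 2) (fun a _ b _ h => ?_) (fun j hj => ?_)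
    (fun k _ hk => hF k fun h => hk ⟨k / 2, ?_, ?_⟩) (fun _ _ => rfl)
  · simp only at h
    omega
  · simp only [Finset.coe_range, Set.mem_Iio] at hj ⊢
    omega
  · simp only [Finset.coe_range, Set.mem_Iio]
    omega
  · simp only
    omega

theorem tendsto_expansion (hn : 2 ≤ n) {g : Sph n → ℂ} (hm : Measurable g) (hb : IsBizonal g)
    (hg : MemLp g 2 (surfaceMeasure n)) (d : ℕ)
    (hvan : ∀ l k, ¬(k ≤ d ∧ k % 2 = d % 2) → sphCoeff n l k g = 0) :
    Tendsto (fun N : ℕ => eLpNorm (fun x : Sph n => g x -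
        ∑ l ∈ Finset.range N, ∑ j ∈ Finset.range (d / 2 + 1),
          sphCoeff n l (2 * j + d % 2) g * symY n l (2 * j + d % 2) x)
        2 (surfaceMeasure n)) atTop (𝓝 0) := by
  have h := tendsto_orthogonal_expansion (fun q : ℕ × ℕ => polyLp n (solidPoly n q.1 q.2))
    (fun q r hqr => by
      show inner ℂ (polyLp n _) (polyLp n _) = 0
      rw [inner_polyLp_polyLp, solidPoly_orthogonal hn hqr, mul_zero, Complex.ofReal_zero])
    -- The range of orders always exceeds d, so each partial sum already contains every surviving
    -- order; it also grows with N, so that all pairs are eventually covered.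
    (fun N => Finset.range N ×ˢ Finset.range (N + d + 1))
    (fun N M hNM => Finset.product_subset_product (Finset.range_mono hNM)
      (Finset.range_mono (by omega)))
    (fun q => ⟨q.1 + q.2 + 1, by
      simp only [Finset.mem_product, Finset.mem_range]
      omega⟩)
    (hg.toLp g) (mem_closure_span hn hm hb hg)
  have h' := ENNReal.tendsto_ofReal h
  rw [ENNReal.ofReal_zero] at h'
  refine h'.congr fun N => ?_
  have e1 : ∑ q ∈ Finset.range N ×ˢ Finset.range (N + d + 1),
      (inner ℂ (polyLp n (solidPoly n q.1 q.2)) (hg.toLp g) /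
        (‖polyLp n (solidPoly n q.1 q.2)‖ ^ 2 : ℂ)) • polyLp n (solidPoly n q.1 q.2) =
      ∑ q ∈ Finset.range N ×ˢ Finset.range (d / 2 + 1),
        (sphCoeff n q.1 (2 * q.2 + d % 2) g *
          ((symWeight n (2 * q.2 + d % 2) * orderConst n q.1 (2 * q.2 + d % 2) : ℝ) : ℂ)) •
          polyLp n (solidPoly n q.1 (2 * q.2 + d % 2)) := by
    rw [Finset.sum_product, Finset.sum_product]
    refine Finset.sum_congr rfl fun l _ => ?_
    simp only [fourier_smul_polyLp hn hb hg]
    exact sum_eq_sum_parity (fun k => (sphCoeff n l k g *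
      ((symWeight n k * orderConst n l k : ℝ) : ℂ)) • polyLp n (solidPoly n l k)) (by omega)
      fun k hk => by simp only [hvan l k hk, zero_mul, zero_smul]
  obtain ⟨hS, e2⟩ := sum_smul_polyLp (Finset.range N ×ˢ Finset.range (d / 2 + 1))
    (fun q : ℕ × ℕ => sphCoeff n q.1 (2 * q.2 + d % 2) g *
      ((symWeight n (2 * q.2 + d % 2) * orderConst n q.1 (2 * q.2 + d % 2) : ℝ) : ℂ))
    (fun q => solidPoly n q.1 (2 * q.2 + d % 2))
  rw [e1, e2, ← MemLp.toLp_sub, ofReal_norm, Lp.enorm_toLp]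
  congr 1
  funext x
  simp only [Pi.sub_apply, Finset.sum_product, symY_eq hn]
  congr 1
  refine Finset.sum_congr rfl fun l _ => Finset.sum_congr rfl fun j _ => ?_
  push_cast
  ring

end DirSphere
end

noncomputable section
namespace DirSphere

variable {n : ℕ}

/-! ### The derivatives of a zonal function along the rotations -/

/-- The rotations form a one-parameter group, so a derivative at angle t is the derivative at angle
0 based at the rotated point. -/
theorem iteratedDeriv_rot (hn : 2 ≤ n) (f : Sph n → ℂ) (m : ℕ) (x : Sph n) (t : ℝ) :
    iteratedDeriv m (fun Θ : ℝ => f (rot hn Θ x)) t = thetaDeriv hn f m (rot hn t x) := by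
  have h01 := zero_ne_one_fin hn
  simp only [thetaDeriv, rot_eq_planar hn h01, planar_add]
  have := congrFun (iteratedDeriv_comp_add_const m (fun Θ : ℝ => f (planar h01 Θ x)) t) 0
  rw [this, zero_add]

theorem thetaDeriv_zero (hn : 2 ≤ n) (f : Sph n → ℂ) : thetaDeriv hn f 0 = f := by
  funext x
  rw [thetaDeriv, iteratedDeriv_zero, rot_eq_planar hn (zero_ne_one_fin hn), planar_zero]

theorem hasDerivAt_thetaDeriv (hn : 2 ≤ n) {f : Sph n → ℂ} {m : ℕ} {x : Sph n}
    (hf : Differentiable ℝ (iteratedDeriv m (fun Θ : ℝ => f (rot hn Θ x)))) (t : ℝ) :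
    HasDerivAt (fun t => thetaDeriv hn f m (planar (zero_ne_one_fin hn) t x))
      (thetaDeriv hn f (m + 1) (planar (zero_ne_one_fin hn) t x)) t := by
  have h := (hf t).hasDerivAt
  rw [← iteratedDeriv_succ, iteratedDeriv_rot] at h
  simp only [← rot_eq_planar hn (zero_ne_one_fin hn)]
  exact h.congr_of_eventuallyEq (Eventually.of_forall fun s => (iteratedDeriv_rot hn f m x s).symm)

/-- Each derivative is a pointwise limit of difference quotients along one sequence of nonzero
angles tending to 0. -/
theorem measurable_thetaDeriv (hn : 2 ≤ n) {f : Sph n → ℂ} (hm : Measurable f) {d : ℕ}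
    (hf : ∀ x : Sph n, ∀ m < d,
      Differentiable ℝ (iteratedDeriv m (fun Θ : ℝ => f (rot hn Θ x)))) :
    ∀ m ≤ d, Measurable (thetaDeriv hn f m) := by
  intro m
  induction m with
  | zero => intro _; rwa [thetaDeriv_zero]
  | succ m ih =>
    intro hmd
    have ih := ih (by omega)
    have h01 := zero_ne_one_fin hn
    obtain ⟨u, hu⟩ := exists_seq_tendsto (𝓝[≠] (0 : ℝ))
    have hmeas : ∀ N : ℕ, Measurable fun x : Sph n =>
        (u N)⁻¹ • (thetaDeriv hn f m (planar h01 (u N) x) - thetaDeriv hn f m x) := fun N => by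
      have hc : Continuous (planar h01 (u N)) := continuous_isometrySph _
      have h1 : Measurable fun x => thetaDeriv hn f m (planar h01 (u N) x) := ih.comp hc.measurable
      exact (h1.sub ih).const_smul (u N)⁻¹
    refine measurable_of_tendsto_metrizable hmeas (tendsto_pi_nhds.2 fun x => ?_)
    have h := hasDerivAt_thetaDeriv hn (hf x m (by omega)) 0
    rw [hasDerivAt_iff_tendsto_slope_zero] at h
    have h2 := h.comp hu
    simp only [planar_zero, zero_add] at h2
    exact h2

theorem isBizonal_thetaDeriv (hn : 2 ≤ n) {f : Sph n → ℂ} (hz : IsZonal f) (m : ℕ) :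
    IsBizonal (thetaDeriv hn f m) := by
  intro x y h0 h1
  have h01 := zero_ne_one_fin hn
  simp only [thetaDeriv, rot_eq_planar hn h01]
  congr 1
  funext t
  refine hz _ _ ?_
  rw [coord_one, coord_one, planar_apply, planar_apply, if_pos rfl, if_pos rfl, h0, h1]

/-! ### The recursion for the Fourier coefficients -/

theorem beta_self (n l : ℕ) : beta n l l = 0 := by
  simp [beta]

section Recursion

variable (hn : 2 ≤ n) {h h' : Sph n → ℂ} (hh : Integrable h (surfaceMeasure n))
  (hh' : Integrable h' (surfaceMeasure n)) (hb : IsBizonal h) (hb' : IsBizonal h')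
  (hd : ∀ x t, HasDerivAt (fun t => h (planar (zero_ne_one_fin hn) t x))
    (h' (planar (zero_ne_one_fin hn) t x)) t)

include hd in
theorem pairing_deriv (p : MvPolynomial (Fin (n + 1)) ℝ) :
    pairing hh' p = -pairing hh (rotD 0 1 p) :=
  integral_rotD_mul (zero_ne_one_fin hn) p hh hh' hd

include hh hh' hb hb' hd in
theorem sphCoeff_deriv_zero (l : ℕ) :
    sphCoeff n l 0 h' = symWeight n 1 * beta n l 0 * sphCoeff n l 1 h := by
  rw [sphCoeff_eq hn hh' hb', pairing_deriv hn hh hh' hd]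
  have h1 : rotD 0 1 (solidPoly n l 0) = -(ladderUp n 0 • solidPoly n l 1) := by
    rw [solidPoly, (angularFamily_angPoly hn).D_solid_zero]
    simp [ladderUp, solidPoly]
  rw [h1, map_neg, neg_neg, map_smul]
  rcases Nat.eq_zero_or_pos l with rfl | hl
  · rw [beta_self, solidPoly_of_lt (by norm_num)]
    simp
  · have h2 := orderConst_mul_ladderUp hn hl
    rw [sphCoeff_eq hn hh hb, Complex.real_smul, ← mul_assoc, ← mul_assoc]
    congr 1
    have h3 : symWeight n 0 = 1 := by simp [symWeight]
    rw [h3] at h2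
    norm_cast
    simp only [zero_add] at h2
    linear_combination (1 / sphereArea n) * h2

include hh hh' hb hb' hd in
theorem sphCoeff_deriv_succ (l k : ℕ) :
    sphCoeff n l (k + 1) h' =
      beta n l (k + 1) * sphCoeff n l (k + 2) h - beta n l k * sphCoeff n l k h := by
  rw [sphCoeff_eq hn hh' hb', pairing_deriv hn hh hh' hd]
  have h1 : rotD 0 1 (solidPoly n l (k + 1)) =
      ladderDown n l k • solidPoly n l k - ladderUp n (k + 1) • solidPoly n l (k + 2) := by
    rw [solidPoly, (angularFamily_angPoly hn).D_solid_succ]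
    simp [ladderUp, ladderDown, solidPoly]
  have h2 : (orderConst n l (k + 1) * ladderDown n l k) • solidPoly n l k =
      (beta n l k * orderConst n l k) • solidPoly n l k := by
    -- At the boundary k = l both coefficients vanish; beyond it the polynomial does.
    rcases lt_trichotomy k l with hk | rfl | hk
    · rw [orderConst_mul_ladderDown hn hk]
    · simp [beta_self, ladderDown]
    · rw [solidPoly_of_lt hk, smul_zero, smul_zero]
  have h3 : (orderConst n l (k + 1) * ladderUp n (k + 1)) • solidPoly n l (k + 2) =
      (beta n l (k + 1) * orderConst n l (k + 2)) • solidPoly n l (k + 2) := by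
    rcases lt_or_ge (k + 1) l with hk | hk
    · have h4 := orderConst_mul_ladderUp hn hk
      -- The weight is constant for orders at least 1, so it cancels here. In `sphCoeff_deriv_zero`
      -- it does not, which is the source of the extra factor 2 when n = 2.
      have h5 : symWeight n (k + 1 + 1) = symWeight n (k + 1) := by simp [symWeight]
      rw [h5] at h4
      rw [mul_left_cancel₀ (symWeight_pos n (k + 1)).ne' h4]
    · rw [solidPoly_of_lt (by omega), smul_zero, smul_zero]
  have h2' := congrArg (pairing hh) h2
  have h3' := congrArg (pairing hh) h3
  rw [h1, map_sub]
  simp only [map_smul, Complex.real_smul] at h2' h3' ⊢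
  rw [sphCoeff_eq hn hh hb, sphCoeff_eq hn hh hb]
  push_cast at h2' h3' ⊢
  linear_combination (1 / (sphereArea n : ℂ)) * (h3' - h2')

end Recursion

theorem sphCoeff_zonal (hn : 2 ≤ n) {f : Sph n → ℂ} (hf : Integrable f (surfaceMeasure n))
    (hz : IsZonal f) (l k : ℕ) : sphCoeff n l (k + 1) f = 0 := by
  have hb : IsBizonal f := fun x y h0 _ => hz x y (by rw [coord_one, coord_one, h0])
  rw [sphCoeff_eq hn hf hb, solidPoly, solid, geg_eq_aeval, pairing_zonal hn hf hz, mul_zero]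

end DirSphere

end

theorem mainTheorem2 (n : ℕ) (hn : 2 ≤ n) (d : ℕ) (f : Sph n → ℂ)
    (hf_meas : Measurable f) (hf_zonal : IsZonal f)
    (hf_diff : ∀ x : Sph n, ∀ m < d,
      Differentiable ℝ (iteratedDeriv m (fun Θ : ℝ => f (rot hn Θ x))))
    (hf_L2 : ∀ m ≤ d, MemLp (thetaDeriv hn f m) 2 (surfaceMeasure n)) :
    -- the expansion of `f^{(d)}`, convergent in `L²(S^n)`
    Tendsto (fun N : ℕ => eLpNorm (fun x : Sph n => thetaDeriv hn f d x -
        ∑ l ∈ Finset.range N, ∑ j ∈ Finset.range (d / 2 + 1),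
          sphCoeff n l (2 * j + d % 2) (thetaDeriv hn f d) * symY n l (2 * j + d % 2) x)
        2 (surfaceMeasure n)) atTop (𝓝 0) ∧
    -- coefficients of order `k > d` vanish
    (∀ l k : ℕ, d < k → sphCoeff n l k (thetaDeriv hn f d) = 0) ∧
    -- the recursion for odd `d`
    (Odd d → ∀ l j : ℕ,
      sphCoeff n l (2 * j + 1) (thetaDeriv hn f d) =
          beta n l (2 * j + 1) * sphCoeff n l (2 * j + 2) (thetaDeriv hn f (d - 1))
            - beta n l (2 * j) * sphCoeff n l (2 * j) (thetaDeriv hn f (d - 1)) ∧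
      sphCoeff n l (2 * j) (thetaDeriv hn f d) = 0) ∧
    -- the recursion for even `d`
    (Even d → ∀ l : ℕ,
      (1 ≤ d → 3 ≤ n → sphCoeff n l 0 (thetaDeriv hn f d) =
          beta n l 0 * sphCoeff n l 1 (thetaDeriv hn f (d - 1))) ∧
      (1 ≤ d → n = 2 → sphCoeff n l 0 (thetaDeriv hn f d) =
          2 * beta n l 0 * sphCoeff n l 1 (thetaDeriv hn f (d - 1))) ∧
      (1 ≤ d → ∀ j : ℕ, 1 ≤ j → sphCoeff n l (2 * j) (thetaDeriv hn f d) =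
          beta n l (2 * j) * sphCoeff n l (2 * j + 1) (thetaDeriv hn f (d - 1))
            - beta n l (2 * j - 1) * sphCoeff n l (2 * j - 1) (thetaDeriv hn f (d - 1))) ∧
      (∀ j : ℕ, sphCoeff n l (2 * j + 1) (thetaDeriv hn f d) = 0)) := by
  have hm := fun m (h : m ≤ d) => measurable_thetaDeriv hn hf_meas hf_diff m h
  have hb := isBizonal_thetaDeriv hn hf_zonal
  have hi := fun m (h : m ≤ d) => (hf_L2 m h).integrable (by norm_num)
  have hd := fun m (h : m < d) (x : Sph n) => hasDerivAt_thetaDeriv hn (hf_diff x m h)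
  have hzero := fun m (h : m < d) =>
    sphCoeff_deriv_zero hn (hi m h.le) (hi (m + 1) h) (hb m) (hb (m + 1)) (hd m h)
  have hsucc := fun m (h : m < d) =>
    sphCoeff_deriv_succ hn (hi m h.le) (hi (m + 1) h) (hb m) (hb (m + 1)) (hd m h)
  -- Selection rule by induction on m: order k of f^(m+1) draws only on the orders k ± 1 of f^(m),
  -- and if k exceeds m + 1 or has the wrong parity, the same defect is passed to both neighbours at
  -- level m.
  have hvan : ∀ m ≤ d, ∀ l k, ¬(k ≤ m ∧ k % 2 = m % 2) →
      sphCoeff n l k (thetaDeriv hn f m) = 0 := by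
    intro m
    induction m with
    | zero =>
      intro h l k hk
      obtain ⟨k, rfl⟩ : ∃ j, k = j + 1 := ⟨k - 1, by omega⟩
      have h0 := hi 0 h
      rw [thetaDeriv_zero] at h0 ⊢
      exact sphCoeff_zonal hn h0 hf_zonal l k
    | succ m ih =>
      intro h l k hk
      have ih := ih (by omega) l
      rcases k with _ | k
      · rw [hzero m h, ih 1 (by omega), mul_zero]
      · rw [hsucc m h, ih k (by omega), ih (k + 2) (by omega), mul_zero, mul_zero, sub_zero]
  have hvan := hvan d le_rfl
  refine ⟨tendsto_expansion hn (hm d le_rfl) (hb d) (hf_L2 d le_rfl) d hvan,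
    fun l k hk => hvan l k (by omega), ?_, ?_⟩
  · intro hodd l j
    obtain ⟨e, rfl⟩ : ∃ e, d = e + 1 := ⟨d - 1, by have := hodd.pos; omega⟩
    have := Nat.odd_iff.1 hodd
    exact ⟨hsucc e e.lt_succ_self l (2 * j), hvan l (2 * j) (by omega)⟩
  · intro heven l
    have hpar := Nat.even_iff.1 heven
    refine ⟨fun hd1 hn3 => ?_, fun hd1 hn2 => ?_, fun hd1 j hj => ?_,
      fun j => hvan l (2 * j + 1) (by omega)⟩
    all_goals obtain ⟨e, rfl⟩ : ∃ e, d = e + 1 := ⟨d - 1, by omega⟩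
    · have hw : symWeight n 1 = 1 := by simp [symWeight, show n ≠ 2 by omega]
      have h := hzero e e.lt_succ_self l
      rw [hw, Complex.ofReal_one, one_mul] at h
      exact h
    · have hw : symWeight n 1 = 2 := by simp [symWeight, hn2]
      have h := hzero e e.lt_succ_self l
      rw [hw] at h
      exact_mod_cast h
    · obtain ⟨i, rfl⟩ : ∃ i, j = i + 1 := ⟨j - 1, by omega⟩
      exact hsucc e e.lt_succ_self l (2 * i + 1)
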